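/- **Setting.** Let $d\in\{2,3\}$, let $\Omega\subset\mathbb R^d$ be a polygonal/polyhedral domain (bounded, open, connected, interior of its closure, the closure a finite union of simplices), $T>0$, $k\ge 1$. $\|\cdot\|_m,|\cdot|_m$ are the norm and seminorm of $H^m(\Omega)$ ($H^0=L^2$), $(\cdot,\cdot)$ is the $L^2$ inner product, $L^2_0(\Omega)$ the mean-zero functions, $|w|_{1,\infty}=\|(\sum_{i,j}(\partial_jw_i)^2)^{1/2}\|_{L^\infty}$, $|w|_{C(W^{1,\infty})}=\max_{t\in[0,T]}|w(t)|_{1,\infty}$. For $\nu>0$ let $(u,p)$, $u(t)\in H^1_0(\Omega)^d$, $p(t)\in L^2_0(\Omega)$, be a weak solution of the Oseen problem: for $t\in(0,T)$, $$(\partial_tu+(w\cdot\nabla)u,v)+\nu(\nabla u,\nabla v)+(\nabla p,v)=(f,v)\ \ \forall v\in H^1_0(\Omega)^d,\qquad (\nabla\cdot u,q)=0\ \ \forall q\in L^2_0(\Omega),\qquad u(0)=u^0,$$ where $f\in C([0,T];L^2(\Omega)^d)$, $p^0:=p(0)$. **Scheme.** Let $\mathcal T_h$ be a conforming triangulation of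 $\overline\Omega$ into simplices, $h_K=\operatorname{diam}K$, $h=\max_Kh_K$, such that each $K$ contains a ball of diameter at least $h_K/\sigma$. Let $W_h$ be the continuous functions on $\overline\Omega$ that are polynomials of degree $\le k$ on each $K\in\mathcal T_h$, $V_h=[W_h\cap H^1_0(\Omega)]^d$, $Q_h=W_h\cap L^2_0(\Omega)$, $Y_h=V_h+\nabla Q_h$, $i_h^T:Y_h\to V_h$ the $L^2$-projection, $\Delta t>0$, $t^n=n\Delta t$, $g^n=g(t^n)$, $N_T=\lfloor T/\Delta t\rfloor$, $X_1(w^n)(x)=x-w^n(x)\Delta t$. Let $\delta_0>0$ and let $s:Q_h\times Q_h\to\mathbb R$ be a bilinear form. Given $(u_h^0,p_h^0)\in Y_h\times Q_h$, let $(\tilde u_h^n,u_h^n,p_h^n)\in V_h\times Y_h\times Q_h$, $1\le n\le N_T$, satisfy for $0\le n\le N_T-1$ $$\Bigl(\tfrac{\tilde u_h^{n+1}-(i_h^Tu_h^n)\circ X_1(w^n)}{\Delta t},v_h\Bigr)+\nu(\nabla\tilde u_h^{n+1},\nabla v_h)+(\nabla p_h^n,v_h)=(f^{n+1},v_h)\quad\forall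 v_h\in V_h,$$ $$\tfrac{u_h^{n+1}-\tilde u_h^{n+1}}{\Delta t}+\nabla(p_h^{n+1}-p_h^n)=0,\qquad (u_h^{n+1},\nabla q_h)-\delta_0\,s(p_h^{n+1},q_h)=0\quad\forall q_h\in Q_h.$$ **Hypotheses.** (H1) $w\in C(W^{1,\infty}_0)\cap H^1(L^\infty)$, $u\in\bigcap_{j=0}^2H^j(H^{2-j})\cap H^1(H^k)\cap C(H^{k+1})$, $p\in H^1(H^1)\cap C(H^{k+1})$, where $C(X)=C([0,T];X)$, $H^j(X)=H^j(0,T;X)$; all these norms are at most $M$. (H2) $4\Delta t\,|w|_{C(W^{1,\infty})}\le 1$. (H3) $s$ is symmetric and positive semidefinite, $s(q_h,q_h)\le c_s\|q_h\|_0^2$; with $|q_h|_s=s(q_h,q_h)^{1/2}$ there are maps $\Pi_h:L^2_0(\Omega)\to Q_h$ and $\mathcal I_h:V^{\rm div}\to V_h$, $V^{\rm div}=\{v\in H^1_0(\Omega)^d:\nabla\cdot v=0\}$, with - $\|q-\Pi_hq\|_m\le c_sh^{r+1-m}\|q\|_{r+1}$ for $q\in L^2_0\cap H^{r+1}$, $0\le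 r\le k$, $m=0,1$; $|\Pi_hq|_s\le c_sh^r\|q\|_r$ for $q\in L^2_0\cap H^r$, $0\le r\le k$; - $|(\nabla\cdot(v-\mathcal I_hv),q_h)|\le c_s\bigl(\sum_Kh_K^{-2}\|v-\mathcal I_hv\|_{0,K}^2+\|v-\mathcal I_hv\|_1^2\bigr)^{1/2}|q_h|_s$ for $v\in V^{\rm div}$, $q_h\in Q_h$; - for $v\in V^{\rm div}\cap H^{r+1}(\Omega)^d$, $1\le r\le k$: $\|v-\mathcal I_hv\|_m\le c_sh^{r+1-m}|v|_{r+1}$, $m=0,1$, and $\bigl(\sum_Kh_K^{-2}\|v-\mathcal I_hv\|_{0,K}^2\bigr)^{1/2}\le c_sh^r|v|_{r+1}$ (the last bound follows from the case $m=0$, up to the constant, if the meshes are quasi-uniform). (H4) $\|u_h^0-u^0\|_0\le c_ih^k$, $\|\nabla(p_h^0-p^0)\|_0\le c_i$. **Theorem 1.** There is a constant $c>0$ depending only on $d,\Omega,T,k,\sigma,M,c_s,c_i$ (in particular not on $\nu,\delta_0,\Delta t,h$) such that, whenever the above holds, each of the four quantities $$\max_{0\le n\le N_T}\|u_h^n-u^n\|_0,\qquad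 \max_{1\le n\le N_T}\|\tilde u_h^n-u^n\|_0,$$ $$\nu^{1/2}\Bigl(\Delta t\sum_{n=1}^{N_T}\|\nabla(\tilde u_h^n-u^n)\|_0^2\Bigr)^{1/2},\qquad \delta_0^{1/2}\Bigl(\Delta t\sum_{n=1}^{N_T}|p_h^n-\Pi_hp^n|_s^2\Bigr)^{1/2}$$ is at most $c\,(1+\nu^{1/2}+\delta_0^{1/2}+\delta_0^{-1/2})(\Delta t+h^k)$ (a maximum over no indices is read as $0$). -/

import Mathlib

open MeasureTheory Set
open scoped ContDiff ENNReal

noncomputable section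

namespace Oseen

/-! ### Lebesgue and Sobolev spaces -/

/-- The Euclidean space `ℝ^d`. -/
abbrev Eu (d : ℕ) : Type := EuclideanSpace ℝ (Fin d)

/-- The Lebesgue space `L^p(Ω; F)`. -/
abbrev LpΩ {d : ℕ} (p : ℝ≥0∞) (Ω : Set (Eu d)) (F : Type) [NormedAddCommGroup F] : Type :=
  Lp F p ((volume : Measure (Eu d)).restrict Ω)

/-- Test functions: smooth, with compact support contained in `Ω`. -/
def IsTest {V F : Type} [NormedAddCommGroup V] [NormedSpace ℝ V] [NormedAddCommGroup F]
    [NormedSpace ℝ F] (Ω : Set V) (φ : V → F) : Prop :=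
  ContDiff ℝ ∞ φ ∧ HasCompactSupport φ ∧ tsupport φ ⊆ Ω

/-- Indices of the partial derivatives of order at most `m`: a tuple `(i_1, …, i_n)` of directions
with `n ≤ m` stands for `∂_{i_1} ⋯ ∂_{i_n}`. -/
abbrev DIdx (d m : ℕ) : Type := Σ n : Fin (m + 1), (Fin n → Fin d)

/-- The classical partial derivative `∂_{i_1} ⋯ ∂_{i_n} φ`. -/
def classD {d m : ℕ} (α : DIdx d m) (φ : Eu d → ℝ) (x : Eu d) : ℝ :=
  iteratedFDeriv ℝ α.1 φ x (fun j => EuclideanSpace.single (α.2 j) (1 : ℝ))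

/-- `g` is the weak derivative `∂_{i_1} ⋯ ∂_{i_n} f` on `Ω`. -/
def IsWeakD {d m : ℕ} {F : Type} [NormedAddCommGroup F] [NormedSpace ℝ F] (Ω : Set (Eu d))
    (α : DIdx d m) (f g : Eu d → F) : Prop :=
  ∀ φ : Eu d → ℝ, IsTest Ω φ →
    ∫ x in Ω, classD α φ x • f x = (-1 : ℝ) ^ (α.1 : ℕ) • ∫ x in Ω, φ x • g x

/-- The index of the function itself. -/
def idx0 (d m : ℕ) : DIdx d m := ⟨0, Fin.elim0⟩

/-- The index of the first derivative `∂_i`. -/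
def idx1 {d : ℕ} (i : Fin d) : DIdx d 1 := ⟨1, fun _ => i⟩

lemma classD_continuous {d m : ℕ} (α : DIdx d m) {φ : Eu d → ℝ} (h : ContDiff ℝ ∞ φ) :
    Continuous (classD α φ) := by
  have h1 : Continuous (iteratedFDeriv ℝ (α.1 : ℕ) φ) :=
    h.continuous_iteratedFDeriv (by exact_mod_cast le_top)
  unfold classD
  fun_prop

lemma classD_hasCompactSupport {d m : ℕ} (α : DIdx d m) {φ : Eu d → ℝ}
    (h : HasCompactSupport φ) : HasCompactSupport (classD α φ) := by
  have h1 := h.iteratedFDeriv (𝕜 := ℝ) (α.1 : ℕ)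
  refine h1.mono' ?_
  refine subset_trans ?_ subset_closure
  intro x hx hx'
  apply hx
  simp only [classD]
  rw [hx']
  rfl

/-- Integration against a continuous compactly supported function is a continuous linear
functional on `L^p(Ω; F)`. -/
lemma exists_pairing {d : ℕ} {F : Type} [NormedAddCommGroup F] [NormedSpace ℝ F] [CompleteSpace F]
    (p : ℝ≥0∞) [hp : Fact (1 ≤ p)] (Ω : Set (Eu d)) {ψ : Eu d → ℝ} (hc : Continuous ψ)
    (hs : HasCompactSupport ψ) :
    ∃ L : LpΩ p Ω F →L[ℝ] F, ∀ f : LpΩ p Ω F, L f = ∫ x in Ω, ψ x • f x := by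
  have hq : ENNReal.HolderConjugate (1 - p⁻¹)⁻¹ p := by
    rw [ENNReal.holderConjugate_iff, inv_inv]
    exact tsub_add_cancel_of_le (ENNReal.inv_le_one.2 hp.out)
  have hq1 : Fact (1 ≤ (1 - p⁻¹)⁻¹) := ⟨by
    rw [ENNReal.one_le_inv]; exact tsub_le_self⟩
  have hψ : MemLp ψ (1 - p⁻¹)⁻¹ ((volume : Measure (Eu d)).restrict Ω) :=
    hc.memLp_of_hasCompactSupport hs
  refine ⟨(ContinuousLinearMap.lsmul ℝ ℝ (E := F)).lpPairing _ (1 - p⁻¹)⁻¹ p (hψ.toLp ψ), ?_⟩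
  intro f
  rw [ContinuousLinearMap.lpPairing_eq_integral]
  refine integral_congr_ae ?_
  filter_upwards [hψ.coeFn_toLp] with x hx
  simp [hx]

/-- For a fixed index, the weak derivative relation is the kernel of continuous functionals. -/
lemma exists_weakD_functional {d m : ℕ} {F : Type} [NormedAddCommGroup F] [NormedSpace ℝ F]
    [CompleteSpace F] (p : ℝ≥0∞) [Fact (1 ≤ p)] (Ω : Set (Eu d)) (α : DIdx d m)
    {φ : Eu d → ℝ} (hφ : IsTest Ω φ) :
    ∃ L : PiLp p (fun _ : DIdx d m => LpΩ p Ω F) →L[ℝ] F, ∀ f,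
      L f = 0 ↔ ∫ x in Ω, classD α φ x • f (idx0 d m) x
        = (-1 : ℝ) ^ (α.1 : ℕ) • ∫ x in Ω, φ x • f α x := by
  obtain ⟨L1, h1⟩ := exists_pairing (F := F) p Ω (classD_continuous α hφ.1)
    (classD_hasCompactSupport α hφ.2.1)
  obtain ⟨L2, h2⟩ := exists_pairing (F := F) p Ω hφ.1.continuous hφ.2.1
  refine ⟨L1.comp (PiLp.proj p _ (idx0 d m))
    - (-1 : ℝ) ^ (α.1 : ℕ) • L2.comp (PiLp.proj p _ α), fun f => ?_⟩
  simp [h1, h2, sub_eq_zero]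

/-- The Sobolev space `W^{m,p}(Ω; F)`, realised as the space of families `(∂^α f)_α` of all weak
derivatives of order at most `m`, each of them in `L^p(Ω; F)`. Its norm is
`(∑_α ‖∂^α f‖_{L^p}^p)^{1/p}` for `p < ∞` and `max_α ‖∂^α f‖_{L^∞}` for `p = ∞`. -/
def Sob {d : ℕ} (m : ℕ) (p : ℝ≥0∞) [Fact (1 ≤ p)] (Ω : Set (Eu d)) (F : Type)
    [NormedAddCommGroup F] [NormedSpace ℝ F] [CompleteSpace F] :
    Submodule ℝ (PiLp p (fun _ : DIdx d m => LpΩ p Ω F)) where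
  carrier := {f | ∀ α, IsWeakD Ω α (f (idx0 d m)) (f α)}
  zero_mem' := by
    intro α φ hφ
    obtain ⟨L, hL⟩ := exists_weakD_functional (F := F) p Ω α hφ
    exact (hL 0).1 (map_zero L)
  add_mem' := by
    intro f g hf hg α φ hφ
    obtain ⟨L, hL⟩ := exists_weakD_functional (F := F) p Ω α hφ
    refine (hL (f + g)).1 ?_
    rw [map_add, (hL f).2 (hf α φ hφ), (hL g).2 (hg α φ hφ), add_zero]
  smul_mem' := by
    intro c f hf α φ hφ
    obtain ⟨L, hL⟩ := exists_weakD_functional (F := F) p Ω α hφ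
    refine (hL (c • f)).1 ?_
    rw [map_smul, (hL f).2 (hf α φ hφ), smul_zero]

lemma Sob.isClosed {d : ℕ} (m : ℕ) (p : ℝ≥0∞) [Fact (1 ≤ p)] (Ω : Set (Eu d)) (F : Type)
    [NormedAddCommGroup F] [NormedSpace ℝ F] [CompleteSpace F] :
    IsClosed (Sob m p Ω F : Set (PiLp p (fun _ : DIdx d m => LpΩ p Ω F))) := by
  have : (Sob m p Ω F : Set (PiLp p (fun _ : DIdx d m => LpΩ p Ω F)))
      = ⋂ α : DIdx d m, ⋂ φ : Eu d → ℝ, ⋂ _ : IsTest Ω φ,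
        {f | ∫ x in Ω, classD α φ x • f (idx0 d m) x
          = (-1 : ℝ) ^ (α.1 : ℕ) • ∫ x in Ω, φ x • f α x} := by
    ext f
    simp only [mem_iInter]
    rfl
  rw [this]
  refine isClosed_iInter fun α => isClosed_iInter fun φ => isClosed_iInter fun hφ => ?_
  obtain ⟨L, hL⟩ := exists_weakD_functional (F := F) p Ω α hφ
  have h2 : {f : PiLp p (fun _ : DIdx d m => LpΩ p Ω F) |
      ∫ x in Ω, classD α φ x • f (idx0 d m) x
          = (-1 : ℝ) ^ (α.1 : ℕ) • ∫ x in Ω, φ x • f α x} = L ⁻¹' {0} := by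
    ext f
    exact (hL f).symm
  rw [h2]
  exact isClosed_singleton.preimage L.continuous

instance {d : ℕ} (m : ℕ) (p : ℝ≥0∞) [Fact (1 ≤ p)] (Ω : Set (Eu d)) (F : Type)
    [NormedAddCommGroup F] [NormedSpace ℝ F] [CompleteSpace F] : CompleteSpace (Sob m p Ω F) :=
  (Sob.isClosed m p Ω F).completeSpace_coe

section
variable {d m : ℕ} {p : ℝ≥0∞} [Fact (1 ≤ p)] {Ω : Set (Eu d)} {F : Type}
  [NormedAddCommGroup F] [NormedSpace ℝ F] [CompleteSpace F]

/-- The embedding `W^{m,p}(Ω; F) → L^p(Ω; F)`. -/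
def val : Sob m p Ω F →L[ℝ] LpΩ p Ω F :=
  (PiLp.proj p (fun _ : DIdx d m => LpΩ p Ω F) (idx0 d m)).comp (Sob m p Ω F).subtypeL

/-- The weak partial derivative `∂_i : W^{1,p}(Ω; F) → L^p(Ω; F)`. -/
def pd (i : Fin d) : Sob 1 p Ω F →L[ℝ] LpΩ p Ω F :=
  (PiLp.proj p (fun _ : DIdx d 1 => LpΩ p Ω F) (idx1 i)).comp (Sob 1 p Ω F).subtypeL

/-- The seminorm `|v|_m = (∑_{|α| = m} ‖∂^α v‖_0²)^{1/2}` on `H^m(Ω; F)`. -/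
def semi (v : Sob m 2 Ω F) : ℝ :=
  √(∑ α : Fin m → Fin d, ‖v.1 ⟨Fin.last m, α⟩‖ ^ 2)

/-- Elements of `W^{m,p}(Ω; F)` that are represented by test functions. -/
def testSub (m : ℕ) (p : ℝ≥0∞) [Fact (1 ≤ p)] (Ω : Set (Eu d)) (F : Type)
    [NormedAddCommGroup F] [NormedSpace ℝ F] [CompleteSpace F] : Submodule ℝ (Sob m p Ω F) where
  carrier := {v | ∃ φ : Eu d → F, IsTest Ω φ ∧ val v =ᵐ[volume.restrict Ω] φ}
  zero_mem' := by
    refine ⟨0, ⟨contDiff_const, HasCompactSupport.zero, ?_⟩, ?_⟩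
    · simp [tsupport]
    · rw [map_zero]
      exact Lp.coeFn_zero _ _ _
  add_mem' := by
    rintro v w ⟨φ, hφ, hv⟩ ⟨ψ, hψ, hw⟩
    refine ⟨φ + ψ, ⟨hφ.1.add hψ.1, hφ.2.1.add hψ.2.1,
      (tsupport_add φ ψ).trans (union_subset hφ.2.2 hψ.2.2)⟩, ?_⟩
    rw [map_add]
    exact (Lp.coeFn_add _ _).trans (hv.add hw)
  smul_mem' := by
    rintro c v ⟨φ, hφ, hv⟩
    refine ⟨c • φ, ⟨contDiff_const.smul hφ.1, hφ.2.1.smul_left,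
      (closure_mono (Function.support_const_smul_subset c φ)).trans hφ.2.2⟩, ?_⟩
    rw [map_smul]
    exact (Lp.coeFn_smul _ _).trans (hv.const_smul c)

/-- `H^1_0(Ω; F)`, the closure of the test functions in `H^1(Ω; F)`. -/
def H10 (Ω : Set (Eu d)) (F : Type) [NormedAddCommGroup F] [NormedSpace ℝ F] [CompleteSpace F] :
    Submodule ℝ (Sob 1 2 Ω F) :=
  (testSub 1 2 Ω F).topologicalClosure

end

section
variable {d : ℕ} {Ω : Set (Eu d)}

/-- `w ∈ W^{1,∞}(Ω)^d` vanishes on the boundary of the bounded set `Ω`: it belongs to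
`H^1_0(Ω)^d`. -/
def IsW0 (w : Sob 1 ∞ Ω (Eu d)) : Prop :=
  ∃ v ∈ H10 Ω (Eu d), val v =ᵐ[volume.restrict Ω] val w

/-- `L^2_0(Ω)`, the functions in `L^2(Ω)` of mean zero (on a bounded set each of them is
integrable). -/
def L20 (Ω : Set (Eu d)) : Submodule ℝ (LpΩ 2 Ω ℝ) where
  carrier := {q | Integrable q (volume.restrict Ω) ∧ ∫ x in Ω, q x = 0}
  zero_mem' := by
    refine ⟨(integrable_zero _ _ _).congr (Lp.coeFn_zero ℝ 2 (volume.restrict Ω)).symm, ?_⟩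
    rw [integral_congr_ae (Lp.coeFn_zero ℝ 2 (volume.restrict Ω))]
    simp
  add_mem' := by
    rintro q r ⟨hq, hq0⟩ ⟨hr, hr0⟩
    refine ⟨(hq.add hr).congr (Lp.coeFn_add q r).symm, ?_⟩
    rw [integral_congr_ae (Lp.coeFn_add q r)]
    simp only [Pi.add_apply]
    rw [integral_add hq hr, hq0, hr0, add_zero]
  smul_mem' := by
    rintro c q ⟨hq, hq0⟩
    refine ⟨(hq.smul c).congr (Lp.coeFn_smul c q).symm, ?_⟩
    rw [integral_congr_ae (Lp.coeFn_smul c q)]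
    simp only [Pi.smul_apply]
    rw [integral_smul, hq0, smul_zero]

/-- The gradient `H^1(Ω) → L^2(Ω)^d`. -/
def grad : Sob 1 2 Ω ℝ →L[ℝ] LpΩ 2 Ω (Eu d) :=
  ∑ i, ((ContinuousLinearMap.toSpanSingleton ℝ (EuclideanSpace.single i (1 : ℝ))).compLpL 2
    ((volume : Measure (Eu d)).restrict Ω)).comp (pd i)

/-- The divergence `H^1(Ω)^d → L^2(Ω)`. -/
def dvg : Sob 1 2 Ω (Eu d) →L[ℝ] LpΩ 2 Ω ℝ :=
  ∑ i, ((EuclideanSpace.proj i : Eu d →L[ℝ] ℝ).compLpL 2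
    ((volume : Measure (Eu d)).restrict Ω)).comp (pd i)

/-- The inner product `(∇u, ∇v)` of `L^2(Ω)^{d×d}`. -/
def gradInner (u v : Sob 1 2 Ω (Eu d)) : ℝ := ∑ i, inner ℝ (pd i u) (pd i v)

/-- `V^div`, the divergence-free elements of `H^1_0(Ω)^d`. -/
def Vdiv (Ω : Set (Eu d)) : Set (Sob 1 2 Ω (Eu d)) := {v | v ∈ H10 Ω (Eu d) ∧ dvg v = 0}

/-- The seminorm `|w|_{1,∞} = ‖(∑_{i,j} (∂_j w_i)²)^{1/2}‖_{0,∞}`. -/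
def semiW (w : Sob 1 ∞ Ω (Eu d)) : ℝ :=
  (eLpNorm (fun x => √(∑ j, ‖pd j w x‖ ^ 2)) ∞ (volume.restrict Ω)).toReal

/-- `|w|_{C(W^{1,∞})}`, the maximum of `|w(t)|_{1,∞}` over `t ∈ [0,T]`. -/
def semiCW (T : ℝ) (w : ℝ → Sob 1 ∞ Ω (Eu d)) : ℝ := sSup ((fun t => semiW (w t)) '' Icc 0 T)

/-! ### Functions of time -/

/-- `g'` is the weak derivative of `g` on `(0,T)`. -/
def IsWeakTimeD {X : Type} [NormedAddCommGroup X] [NormedSpace ℝ X] [CompleteSpace X]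
    (T : ℝ) (g g' : ℝ → X) : Prop :=
  ∀ φ : ℝ → ℝ, IsTest (Ioo 0 T) φ →
    ∫ t in Ioo 0 T, deriv φ t • g t = -∫ t in Ioo 0 T, φ t • g' t

/-- `g` belongs to `H^j(0,T; X)` and its norm there is at most `M`. -/
def HTimeLe {X : Type} [NormedAddCommGroup X] [NormedSpace ℝ X] [CompleteSpace X]
    (T : ℝ) (j : ℕ) (M : ℝ) (g : ℝ → X) : Prop :=
  ∃ G : ℕ → ℝ → X, (∀ᵐ t ∂(volume.restrict (Ioo 0 T)), G 0 t = g t) ∧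
    (∀ i ≤ j, MemLp (G i) 2 (volume.restrict (Ioo 0 T))) ∧
    (∀ i < j, IsWeakTimeD T (G i) (G (i + 1))) ∧
    √(∑ i ∈ Finset.range (j + 1), ∫ t in Ioo 0 T, ‖G i t‖ ^ 2) ≤ M

/-- `g` (given through its values in `L^2`) belongs to `H^j(0,T; H^m(Ω; F))` and its norm there is
at most `M`. -/
def HTimeSobLe {F : Type} [NormedAddCommGroup F] [NormedSpace ℝ F] [CompleteSpace F]
    (T : ℝ) (j m : ℕ) (M : ℝ) (g : ℝ → LpΩ 2 Ω F) : Prop :=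
  ∃ U : ℝ → Sob m 2 Ω F, (∀ᵐ t ∂(volume.restrict (Ioo 0 T)), val (U t) = g t) ∧ HTimeLe T j M U

/-- `g` belongs to `C([0,T]; X)` and its norm there is at most `M`. -/
def CTimeLe {X : Type} [NormedAddCommGroup X] (T M : ℝ) (g : ℝ → X) : Prop :=
  ContinuousOn g (Icc 0 T) ∧ ∀ t ∈ Icc 0 T, ‖g t‖ ≤ M

/-- `g` (given through its values in `L^2`) belongs to `C([0,T]; H^m(Ω; F))` and its norm there is
at most `M`. -/
def CTimeSobLe {F : Type} [NormedAddCommGroup F] [NormedSpace ℝ F] [CompleteSpace F]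
    (T : ℝ) (m : ℕ) (M : ℝ) (g : ℝ → LpΩ 2 Ω F) : Prop :=
  ∃ U : ℝ → Sob m 2 Ω F, (∀ t ∈ Icc 0 T, val (U t) = g t) ∧ CTimeLe T M U

/-! ### The Oseen problem -/

/-- A polygonal (`d = 2`) or polyhedral (`d = 3`) domain: a bounded, connected open set that is
the interior of its closure, the latter being a finite union of simplices. -/
def IsPolyhedralDomain (Ω : Set (Eu d)) : Prop :=
  IsOpen Ω ∧ IsConnected Ω ∧ Bornology.IsBounded Ω ∧ interior (closure Ω) = Ω ∧
    ∃ S : Finset (Finset (Eu d)), closure Ω = ⋃ s ∈ S, convexHull ℝ (s : Set (Eu d))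

/-- The number `((w·∇)u, v)`. -/
def convInner (w : Sob 1 ∞ Ω (Eu d)) (u v : Sob 1 2 Ω (Eu d)) : ℝ :=
  ∫ x in Ω, inner ℝ (∑ i, val w x i • pd i u x) (val v x)

/-- `(u, p)` is a (weak) solution of the Oseen problem with viscosity `ν`, convecting velocity `w`,
force `f` and initial velocity `u0` on `Ω × (0,T)`. -/
structure IsOseenSolution (T ν : ℝ) (w : ℝ → Sob 1 ∞ Ω (Eu d)) (f : ℝ → LpΩ 2 Ω (Eu d))
    (u0 : LpΩ 2 Ω (Eu d)) (u : ℝ → Sob 1 2 Ω (Eu d)) (p : ℝ → Sob 1 2 Ω ℝ) : Prop where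
  mem_u : ∀ t ∈ Icc 0 T, u t ∈ H10 Ω (Eu d)
  mem_p : ∀ t ∈ Icc 0 T, val (p t) ∈ L20 Ω
  momentum : ∀ t ∈ Ioo 0 T, ∃ du : LpΩ 2 Ω (Eu d), HasDerivAt (fun r => val (u r)) du t ∧
    ∀ v ∈ H10 Ω (Eu d),
      inner ℝ du (val v) + convInner (w t) (u t) v + ν * gradInner (u t) v
        + inner ℝ (grad (p t)) (val v) = inner ℝ (f t) (val v)
  mass : ∀ t ∈ Ioo 0 T, ∀ q ∈ L20 Ω, inner ℝ (dvg (u t)) q = 0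
  init : val (u 0) = u0

/-- The regularity of the velocity `w` and of the exact solution `(u, p)`:
`w ∈ C(W^{1,∞}_0) ∩ H^1(L^∞)`, `u ∈ Z^2 ∩ H^1(H^k) ∩ C(H^{k+1})`, `p ∈ H^1(H^1) ∩ C(H^{k+1})`,
with all the norms bounded by `M`. The space `Z^2` is the intersection of `H^j(0,T; H^{2-j})`,
`j = 0, 1, 2`. -/
structure Regularity (T : ℝ) (k : ℕ) (M : ℝ) (w : ℝ → Sob 1 ∞ Ω (Eu d))
    (u : ℝ → Sob 1 2 Ω (Eu d)) (p : ℝ → Sob 1 2 Ω ℝ) : Prop where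
  w_zero : ∀ t ∈ Icc 0 T, IsW0 (w t)
  w_C : CTimeLe T M w
  w_H1 : HTimeLe T 1 M (fun t => val (w t))
  u_Z2 : ∀ j ≤ 2, HTimeSobLe T j (2 - j) M (fun t => val (u t))
  u_H1 : HTimeSobLe T 1 k M (fun t => val (u t))
  u_C : CTimeSobLe T (k + 1) M (fun t => val (u t))
  p_H1 : HTimeSobLe T 1 1 M (fun t => val (p t))
  p_C : CTimeSobLe T (k + 1) M (fun t => val (p t))

/-! ### Triangulations and finite element spaces -/

/-- A (conforming) triangulation of the closure of `Ω` into nondegenerate `d`-simplices, each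
given by its set of vertices. -/
structure Triangulation (Ω : Set (Eu d)) where
  elems : Finset (Finset (Eu d))
  card_eq : ∀ K ∈ elems, K.card = d + 1
  indep : ∀ K ∈ elems, AffineIndependent ℝ ((↑) : K → Eu d)
  inter_eq : ∀ K ∈ elems, ∀ L ∈ elems,
    convexHull ℝ (K : Set (Eu d)) ∩ convexHull ℝ (L : Set (Eu d))
      = convexHull ℝ ((K : Set (Eu d)) ∩ (L : Set (Eu d)))
  union_eq : ⋃ K ∈ elems, convexHull ℝ (K : Set (Eu d)) = closure Ω

/-- The diameter `h_K` of an element. -/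
def hK (K : Finset (Eu d)) : ℝ := Metric.diam (convexHull ℝ (K : Set (Eu d)))

/-- The mesh size `h = max_K h_K`. -/
def Triangulation.h (𝒯 : Triangulation Ω) : ℝ := sSup (hK '' (𝒯.elems : Set (Finset (Eu d))))

/-- Shape regularity with constant `σ`: each element `K` contains a ball whose diameter is at least
`h_K / σ`. A family of triangulations is regular if all its members satisfy this with one `σ`. -/
def Triangulation.ShapeRegular (𝒯 : Triangulation Ω) (σ : ℝ) : Prop :=
  ∀ K ∈ 𝒯.elems, ∃ x r, 0 < r ∧ Metric.closedBall x r ⊆ convexHull ℝ (K : Set (Eu d)) ∧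
    hK K ≤ σ * (2 * r)

/-- Functions that are continuous on the closure of `Ω` and, on each element, polynomials of degree
at most `m`. -/
def feFun (𝒯 : Triangulation Ω) (m : ℕ) : Submodule ℝ (Eu d → ℝ) where
  carrier := {ψ | ContinuousOn ψ (closure Ω) ∧ ∀ K ∈ 𝒯.elems,
    ∃ P ∈ MvPolynomial.restrictTotalDegree (Fin d) ℝ m,
      ∀ x ∈ convexHull ℝ (K : Set (Eu d)), ψ x = MvPolynomial.eval (fun i => x i) P}
  zero_mem' := ⟨continuousOn_const, fun _ _ => ⟨0, Submodule.zero_mem _, by simp⟩⟩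
  add_mem' := by
    rintro ψ χ ⟨h1, h2⟩ ⟨h3, h4⟩
    refine ⟨h1.add h3, fun K hK => ?_⟩
    obtain ⟨P, hP, hP'⟩ := h2 K hK
    obtain ⟨Q, hQ, hQ'⟩ := h4 K hK
    exact ⟨P + Q, Submodule.add_mem _ hP hQ, fun x hx => by simp [hP' x hx, hQ' x hx]⟩
  smul_mem' := by
    rintro c ψ ⟨h1, h2⟩
    refine ⟨h1.const_smul c, fun K hK => ?_⟩
    obtain ⟨P, hP, hP'⟩ := h2 K hK
    exact ⟨c • P, Submodule.smul_mem _ c hP, fun x hx => by simp [hP' x hx]⟩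

/-- `V_h = [W_h^{(m)} ∩ H^1_0(Ω)]^d`. -/
def Vh (𝒯 : Triangulation Ω) (m : ℕ) : Submodule ℝ (Sob 1 2 Ω (Eu d)) where
  carrier := {v | v ∈ H10 Ω (Eu d) ∧ ∃ ψ : Eu d → Eu d, (∀ i, (fun x => ψ x i) ∈ feFun 𝒯 m) ∧
    val v =ᵐ[volume.restrict Ω] ψ}
  zero_mem' := by
    refine ⟨Submodule.zero_mem _, 0, fun i => Submodule.zero_mem (feFun 𝒯 m), ?_⟩
    rw [map_zero]
    exact Lp.coeFn_zero _ _ _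
  add_mem' := by
    rintro v w ⟨h1, φ, hφ, hv⟩ ⟨h2, ψ, hψ, hw⟩
    refine ⟨Submodule.add_mem _ h1 h2, φ + ψ,
      fun i => Submodule.add_mem (feFun 𝒯 m) (hφ i) (hψ i), ?_⟩
    rw [map_add]
    exact (Lp.coeFn_add _ _).trans (hv.add hw)
  smul_mem' := by
    rintro c v ⟨h1, φ, hφ, hv⟩
    refine ⟨Submodule.smul_mem _ c h1, c • φ,
      fun i => Submodule.smul_mem (feFun 𝒯 m) c (hφ i), ?_⟩
    rw [map_smul]
    exact (Lp.coeFn_smul _ _).trans (hv.const_smul c)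

/-- `Q_h = W_h^{(m)} ∩ L^2_0(Ω)`, as a subspace of `H^1(Ω)`. -/
def Qh (𝒯 : Triangulation Ω) (m : ℕ) : Submodule ℝ (Sob 1 2 Ω ℝ) where
  carrier := {q | val q ∈ L20 Ω ∧ ∃ ψ ∈ feFun 𝒯 m, val q =ᵐ[volume.restrict Ω] ψ}
  zero_mem' := by
    refine ⟨by rw [map_zero]; exact Submodule.zero_mem _, 0, Submodule.zero_mem _, ?_⟩
    rw [map_zero]
    exact Lp.coeFn_zero _ _ _
  add_mem' := by
    rintro v w ⟨h1, φ, hφ, hv⟩ ⟨h2, ψ, hψ, hw⟩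
    refine ⟨by rw [map_add]; exact Submodule.add_mem _ h1 h2, φ + ψ,
      Submodule.add_mem _ hφ hψ, ?_⟩
    rw [map_add]
    exact (Lp.coeFn_add _ _).trans (hv.add hw)
  smul_mem' := by
    rintro c v ⟨h1, φ, hφ, hv⟩
    refine ⟨by rw [map_smul]; exact Submodule.smul_mem _ c h1, c • φ,
      Submodule.smul_mem _ c hφ, ?_⟩
    rw [map_smul]
    exact (Lp.coeFn_smul _ _).trans (hv.const_smul c)

/-- `Y_h = V_h + ∇Q_h`, as a subspace of `L^2(Ω)^d`, for the `P_k/P_l` element. -/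
def Yh (𝒯 : Triangulation Ω) (k l : ℕ) : Submodule ℝ (LpΩ 2 Ω (Eu d)) :=
  (Vh 𝒯 k).map (val (m := 1) (p := 2) (Ω := Ω) (F := Eu d)).toLinearMap ⊔
    (Qh 𝒯 l).map (grad (Ω := Ω)).toLinearMap

/-- `z = i_h^T y`: the element `z` of `V_h` is the `L^2`-projection of `y`. -/
def IsProjVh (𝒯 : Triangulation Ω) (k : ℕ) (y : LpΩ 2 Ω (Eu d)) (z : Sob 1 2 Ω (Eu d)) : Prop :=
  z ∈ Vh 𝒯 k ∧ ∀ v ∈ Vh 𝒯 k, inner ℝ (val z) (val v) = inner ℝ y (val v)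

/-! ### The scheme -/

/-- The map `X_1(w)(x) = x - w(x) Δt`. -/
def X1 (Δt : ℝ) (w : Sob 1 ∞ Ω (Eu d)) (x : Eu d) : Eu d := x - Δt • val w x

/-- The number `(z ∘ X_1(w), v)`. -/
def compInner (Δt : ℝ) (w : Sob 1 ∞ Ω (Eu d)) (z v : Sob 1 2 Ω (Eu d)) : ℝ :=
  ∫ x in Ω, inner ℝ (val z (X1 Δt w x)) (val v x)

/-- The number of time steps. -/
def NT (T Δt : ℝ) : ℕ := ⌊T / Δt⌋₊

/-- `(ut, u, p)` (`ut` for `ũ_h`) is a solution of Scheme`(k, l, δ₀)` with the stabilization form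
`s`. Only `u n`, `p n` for `0 ≤ n ≤ N_T` and `ut n` for `1 ≤ n ≤ N_T` are relevant. -/
structure IsSchemeSolution (𝒯 : Triangulation Ω) (k l : ℕ) (δ₀ : ℝ)
    (s : LinearMap.BilinForm ℝ (Qh 𝒯 l)) (T Δt ν : ℝ) (w : ℝ → Sob 1 ∞ Ω (Eu d))
    (f : ℝ → LpΩ 2 Ω (Eu d)) (ut : ℕ → Vh 𝒯 k) (u : ℕ → Yh 𝒯 k l) (p : ℕ → Qh 𝒯 l) : Prop where
  momentum : ∀ n < NT T Δt, ∃ z, IsProjVh 𝒯 k (u n).1 z ∧ ∀ v ∈ Vh 𝒯 k,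
    (inner ℝ (val (ut (n + 1)).1) (val v) - compInner Δt (w (n * Δt)) z v) / Δt
      + ν * gradInner (ut (n + 1)).1 v + inner ℝ (grad (p n).1) (val v)
      = inner ℝ (f ((n + 1 : ℕ) * Δt)) (val v)
  projection : ∀ n < NT T Δt,
    Δt⁻¹ • ((u (n + 1)).1 - val (ut (n + 1)).1) + grad ((p (n + 1)).1 - (p n).1) = 0
  mass : ∀ n < NT T Δt, ∀ q : Qh 𝒯 l,
    inner ℝ (u (n + 1)).1 (grad q.1) - δ₀ * s (p (n + 1)) q = 0

/-! ### The stabilization hypotheses -/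

/-- The seminorm `|q|_s = s(q,q)^{1/2}`. -/
def snorm {𝒯 : Triangulation Ω} {l : ℕ} (s : LinearMap.BilinForm ℝ (Qh 𝒯 l)) (q : Qh 𝒯 l) : ℝ :=
  √(s q q)

/-- The mesh-weighted quantity `∑_K h_K^{-2} ‖v‖_{0,K}²`. -/
def weightedSq (𝒯 : Triangulation Ω) (v : Sob 1 2 Ω (Eu d)) : ℝ :=
  ∑ K ∈ 𝒯.elems, (hK K)⁻¹ ^ 2 * ∫ x in convexHull ℝ (K : Set (Eu d)) ∩ Ω, ‖val v x‖ ^ 2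

/-- The stabilization hypotheses on `s`, with operators `Π : L^2_0(Ω) → Q_h` and `I : V^div → V_h`
(no condition is put on them outside `L^2_0(Ω)` and `V^div`) and the constant `c`. -/
structure StabHyp (𝒯 : Triangulation Ω) (k : ℕ) (c : ℝ) (s : LinearMap.BilinForm ℝ (Qh 𝒯 k))
    (Pr : LpΩ 2 Ω ℝ → Qh 𝒯 k) (I : Sob 1 2 Ω (Eu d) → Vh 𝒯 k) : Prop where
  symm : ∀ q r, s q r = s r q
  nonneg : ∀ q, 0 ≤ s q q
  bounded : ∀ q, s q q ≤ c * ‖val q.1‖ ^ 2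
  pr_approx : ∀ q : Sob 1 2 Ω ℝ, val q ∈ L20 Ω → ∀ r ≤ k, ∀ q' : Sob (r + 1) 2 Ω ℝ,
    val q' = val q →
      ‖val q - val (Pr (val q)).1‖ ≤ c * 𝒯.h ^ (r + 1) * ‖q'‖ ∧
      ‖q - (Pr (val q)).1‖ ≤ c * 𝒯.h ^ r * ‖q'‖
  pr_stable : ∀ r ≤ k, ∀ q : Sob r 2 Ω ℝ, val q ∈ L20 Ω →
    snorm s (Pr (val q)) ≤ c * 𝒯.h ^ r * ‖q‖
  i_div : ∀ v ∈ Vdiv Ω, ∀ q : Qh 𝒯 k,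
    |inner ℝ (dvg (v - (I v).1)) (val q.1)|
      ≤ c * √(weightedSq 𝒯 (v - (I v).1) + ‖v - (I v).1‖ ^ 2) * snorm s q
  i_approx : ∀ v ∈ Vdiv Ω, ∀ r, 1 ≤ r → r ≤ k → ∀ v' : Sob (r + 1) 2 Ω (Eu d),
    val v' = val v →
      ‖val v - val (I v).1‖ ≤ c * 𝒯.h ^ (r + 1) * semi v' ∧
      ‖v - (I v).1‖ ≤ c * 𝒯.h ^ r * semi v' ∧
      √(weightedSq 𝒯 (v - (I v).1)) ≤ c * 𝒯.h ^ r * semi v'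

/-- The discrete norm `(Δt ∑_{n=1}^{N_T} (a^n)²)^{1/2}` of a sequence of (semi)norms `a^n`. -/
def ell2 (T Δt : ℝ) (a : ℕ → ℝ) : ℝ := √(Δt * ∑ n ∈ Finset.Icc 1 (NT T Δt), a n ^ 2)

/-- The norm `‖∇v‖_0`. -/
def gradNorm (v : Sob 1 2 Ω (Eu d)) : ℝ := √(gradInner v v)

end

end Oseen

end

/-!
The error is split as `u_h - u = (u_h - û) - (u - û)` with a discrete function `û` close to `u`. The
discrete part satisfies the equations of the scheme with small data (`momentum_error`,
`mass_error`), and it is bounded by an energy estimate for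
`E^n = ‖u_h^n - û^n‖² + Δt² ‖∇(p_h^n - Π_h p^n)‖²`. Squaring the projection step
`e' + Δt ∇ε' = ẽ' + Δt (∇ε - ∇π)` turns the pressure term of the momentum equation into the
difference of the second parts of `E` (`energy_step`); the stabilization provides the dissipation
`δ₀ |ε|_s²`, against which the consistency errors of the mass equation are absorbed, whence the
powers of `δ₀` in the bound. The residual of the momentum equation enters through the sum of its
`L²` norms over the steps only: it is weighted against this sum `S₀` in Young's inequality, and the
Gronwall factors multiply to `exp (∑ r_n / S₀) ≤ e` (`energy_estimate`).

*Transport.* The energy estimate needs `‖z ∘ X_1‖² ≤ (1 + κ Δt) ‖z‖²`, and the consistency needs the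
expansion of `z ∘ X_1` up to order `Δt²` in `L²` for `z ∈ H²`. The boundary of `Ω` is not assumed to
be Lipschitz, and no extension or density theorem is available. Functions with zero boundary values
extend by zero, however, so that mollification yields a representative of `w` that is Lipschitz on
the whole space and vanishes off `Ω` (`exists_lipschitz_representative`). With
`Δt |w|_{1,∞} ≤ 1/4` the map `x ↦ x - Δt w(x)` is then injective with a Lipschitz inverse, which
bounds the compression of volumes, and it takes `Ω` to itself. For fixed `x` the segment from `x` to
`X_1(x)` is a compact subset of `Ω`; the Taylor expansion along it holds for mollifications of
sufficiently small radius, and Fatou's lemma gives the estimates for the functions themselves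
(`exists_transport`).

*Time.* A function with an integrable weak time derivative is a primitive of it
(`IsWeakTimeD.ae_eq_primitive`). Hence the increments of `w`, `u` and `∂_t u` are bounded by
integrals of functions in `L²(0,T)`, and the residual of the exact solution in the momentum equation
sums to `O(Δt)` (`exists_residual`).

*The choice of `û`.* The difference quotients of `u - û` appear in the residual. The operator `I_h`
is neither linear nor continuous, so that `û^n = I_h u^n` does not do: its increments are only known
to be `O(h^{k+1})`, not `O(Δt h^k)`. Instead `û` relaxes to the interpolants over a time of order
`h`,

  `û^{n+1} = (1-θ) û^n + θ I_h u^{n+1} + (1-θ) J (u^{n+1} - u^n)`,  `θ = Δt / (h + Δt)`,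

where `J = I_h` for `k ≥ 2`, and `J = 0` for `k = 1`. The increments of the averaged interpolation
errors are `O(θ h^{k+1}) = O(Δt h^k)`. What remains is the average of `δ - J δ` for the increments
`δ` of `u`, which are bounded in `H^k`. For `k ≥ 2` the approximation property of `I_h` for functions
in `H^k` suffices. For `k = 1` there is none, and `δ` itself has to be averaged; the increments of
this average are summable with the sum `O(h + Δt)`, since the second differences of `u` are
(`exists_average`). In `H¹`, and in the dual norm for the divergence in the hypothesis on `I_h`,
averaging over a time of order `h` multiplies the sizes `O(Δt h^{k-1})` of the summands by
`1/θ`, which gives `O(h^k + Δt)` in the mean (`sum_average_le`, `sum_sq_average_le`).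
-/

set_option linter.unusedSectionVars false

noncomputable section

namespace Oseen

/-! ### Sobolev spaces: uniqueness of weak derivatives and embeddings -/

section
variable {d m : ℕ} {Ω : Set (Eu d)} {F : Type} [NormedAddCommGroup F] [NormedSpace ℝ F]

/-- On an open set a function has at most one weak derivative with a given index. -/
lemma IsWeakD.ae_eq [CompleteSpace F] (hΩ : IsOpen Ω) {α : DIdx d m} {f f' g g' : Eu d → F}
    (hf : f =ᵐ[volume.restrict Ω] f') (h : IsWeakD Ω α f g) (h' : IsWeakD Ω α f' g')
    (hg : IntegrableOn g Ω) (hg' : IntegrableOn g' Ω) : g =ᵐ[volume.restrict Ω] g' := by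
  have key : ∀ φ : Eu d → ℝ, IsTest Ω φ → ∫ x in Ω, φ x • (g x - g' x) = 0 := by
    intro φ hφ
    have h1 := h φ hφ
    have h2 := h' φ hφ
    have h3 : ∫ x in Ω, classD α φ x • f x = ∫ x in Ω, classD α φ x • f' x :=
      integral_congr_ae (hf.mono fun x hx => by simp only [hx])
    rw [h3, h2] at h1
    have h4 : ∫ x in Ω, φ x • g x = ∫ x in Ω, φ x • g' x :=
      (smul_right_injective F (pow_ne_zero _ (by norm_num : (-1 : ℝ) ≠ 0)) h1).symm
    obtain ⟨C, hC⟩ := hφ.1.continuous.bounded_above_of_compact_support hφ.2.1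
    have hi : ∀ {g : Eu d → F}, IntegrableOn g Ω → Integrable (fun x => φ x • g x)
        (volume.restrict Ω) := fun {g} hg =>
      hg.bdd_smul C hφ.1.continuous.aestronglyMeasurable (Filter.Eventually.of_forall hC)
    simp only [smul_sub]
    rw [integral_sub (hi hg) (hi hg'), h4, sub_self]
  have h0 := hΩ.ae_eq_zero_of_integral_contDiff_smul_eq_zero
    (μ := (volume : Measure (Eu d)).restrict Ω) (f := fun x => g x - g' x)
    ((hg.sub hg').locallyIntegrable.locallyIntegrableOn _)
    (fun φ h1 h2 h3 => key φ ⟨h1, h2, h3⟩)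
  have h5 : ∀ᵐ x ∂((volume : Measure (Eu d)).restrict Ω), x ∈ Ω := ae_restrict_mem hΩ.measurableSet
  filter_upwards [h0, h5] with x hx hx'
  exact sub_eq_zero.1 (hx hx')

lemma isFiniteMeasure_restrict (hb : Bornology.IsBounded Ω) :
    IsFiniteMeasure ((volume : Measure (Eu d)).restrict Ω) :=
  ⟨by rw [Measure.restrict_apply_univ]; exact hb.measure_lt_top⟩

lemma integrableOn_Lp {F : Type} [NormedAddCommGroup F] (hb : Bornology.IsBounded Ω)
    {p : ℝ≥0∞} [hp : Fact (1 ≤ p)] (f : LpΩ p Ω F) : IntegrableOn f Ω := by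
  have := isFiniteMeasure_restrict hb
  exact (Lp.memLp f).integrable hp.out

variable [CompleteSpace F] {p : ℝ≥0∞} [Fact (1 ≤ p)]

lemma val_apply (v : Sob m p Ω F) : val v = v.1 (idx0 d m) := rfl

lemma val_injective (hΩ : IsOpen Ω) (hb : Bornology.IsBounded Ω) :
    Function.Injective (val : Sob m p Ω F → LpΩ p Ω F) := by
  intro u v h
  apply Subtype.ext
  ext α : 1
  have h1 := u.2 α
  have h2 := v.2 α
  exact Lp.ext (h1.ae_eq hΩ (by rw [val_apply, val_apply] at h; rw [h]) h2
    (integrableOn_Lp hb _) (integrableOn_Lp hb _))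

/-- The index of order at most `m'` seen as an index of order at most `m`. -/
def DIdx.lift {d m m' : ℕ} (h : m' ≤ m) (α : DIdx d m') : DIdx d m :=
  ⟨Fin.castLE (Nat.succ_le_succ h) α.1, α.2⟩

lemma DIdx.lift_injective {d m m' : ℕ} (h : m' ≤ m) :
    Function.Injective (DIdx.lift (d := d) h) := by
  rintro ⟨n, a⟩ ⟨n', a'⟩ h'
  simp only [DIdx.lift, Sigma.mk.injEq] at h'
  obtain ⟨h1, h2⟩ := h'
  have : n = n' := by
    ext; simpa using congrArg Fin.val h1
  subst this
  simpa using h2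

lemma norm_sq_Sob (v : Sob m 2 Ω F) : ‖v‖ ^ 2 = ∑ α, ‖v.1 α‖ ^ 2 :=
  PiLp.norm_sq_eq_of_L2 _ v.1

lemma norm_comp_le (v : Sob m p Ω F) (α : DIdx d m) : ‖v.1 α‖ ≤ ‖v‖ :=
  PiLp.norm_apply_le v.1 α

lemma norm_val_le (v : Sob m p Ω F) : ‖val v‖ ≤ ‖v‖ := norm_comp_le v _

lemma norm_pd_le (i : Fin d) (v : Sob 1 p Ω F) : ‖pd i v‖ ≤ ‖v‖ := norm_comp_le v _

lemma semi_le_norm (v : Sob m 2 Ω F) : semi v ≤ ‖v‖ := by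
  rw [semi, Real.sqrt_le_left (norm_nonneg _), norm_sq_Sob]
  have : Function.Injective (fun α : Fin m → Fin d => (⟨Fin.last m, α⟩ : DIdx d m)) := by
    intro a b h
    simpa using h
  calc _ = ∑ α ∈ Finset.univ.map ⟨_, this⟩, ‖v.1 α‖ ^ 2 := by
        rw [Finset.sum_map]; rfl
    _ ≤ _ := Finset.sum_le_sum_of_subset_of_nonneg (Finset.subset_univ _)
        fun _ _ _ => by positivity

/-- The inclusion `H^m(Ω) → H^{m'}(Ω)` for `m' ≤ m`, as a linear map. -/
def resSobₗ {m m' : ℕ} (h : m' ≤ m) : Sob m 2 Ω F →ₗ[ℝ] Sob m' 2 Ω F where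
  toFun v := ⟨WithLp.toLp 2 fun α => v.1 (α.lift h), fun α φ hφ => v.2 (α.lift h) φ hφ⟩
  map_add' _ _ := rfl
  map_smul' _ _ := rfl

lemma norm_resSobₗ_le {m m' : ℕ} (h : m' ≤ m) (v : Sob m 2 Ω F) : ‖resSobₗ h v‖ ≤ ‖v‖ := by
  refine (sq_le_sq₀ (norm_nonneg _) (norm_nonneg v)).1 ?_
  rw [norm_sq_Sob, norm_sq_Sob]
  calc _ = ∑ α ∈ Finset.univ.map ⟨_, DIdx.lift_injective (d := d) h⟩, ‖v.1 α‖ ^ 2 := by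
        rw [Finset.sum_map]; rfl
    _ ≤ _ := Finset.sum_le_sum_of_subset_of_nonneg (Finset.subset_univ _)
        fun _ _ _ => by positivity

/-- The inclusion `H^m(Ω) → H^{m'}(Ω)` for `m' ≤ m`. -/
def resSob {m m' : ℕ} (h : m' ≤ m) : Sob m 2 Ω F →L[ℝ] Sob m' 2 Ω F :=
  (resSobₗ h).mkContinuous 1 fun v => by rw [one_mul]; exact norm_resSobₗ_le h v

lemma val_resSob {m m' : ℕ} (h : m' ≤ m) (v : Sob m 2 Ω F) : val (resSob h v) = val v := rfl

lemma norm_resSob_le {m m' : ℕ} (h : m' ≤ m) (v : Sob m 2 Ω F) : ‖resSob h v‖ ≤ ‖v‖ :=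
  norm_resSobₗ_le h v

lemma classD_idx0 (φ : Eu d → ℝ) : classD (idx0 d m) φ = φ := by
  ext x
  simp only [classD, idx0]
  exact iteratedFDeriv_zero_apply _

lemma classD_idx1 (i : Fin d) (φ : Eu d → ℝ) (x : Eu d) :
    classD (idx1 i) φ x = fderiv ℝ φ x (EuclideanSpace.single i 1) := by
  simp only [classD, idx1]
  exact iteratedFDeriv_one_apply _

lemma DIdx.one_cases (α : DIdx d 1) : α = idx0 d 1 ∨ ∃ i, α = idx1 i := by
  obtain ⟨n, a⟩ := α
  fin_cases n
  · left
    simp only [idx0]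
    congr
    ext j
    exact j.elim0
  · right
    refine ⟨a 0, ?_⟩
    simp only [idx1]
    congr
    ext j
    rw [Fin.fin_one_eq_zero j]

/-- The index of the second derivative `∂_i ∂_j`. -/
def idx2 (i j : Fin d) : DIdx d 2 := ⟨2, ![i, j]⟩

lemma classD_idx2 (i j : Fin d) {φ : Eu d → ℝ} (hφ : ContDiff ℝ ∞ φ) (x : Eu d) :
    classD (idx2 i j) φ x = classD (idx1 i) (classD (idx1 j) φ) x := by
  have h0 : classD (idx1 j) φ = fun x => fderiv ℝ φ x (EuclideanSpace.single j 1) := by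
    ext y; exact classD_idx1 j φ y
  have hd : DifferentiableAt ℝ (fderiv ℝ φ) x :=
    ((hφ.fderiv_right (m := ∞) (by simp)).differentiable (by simp)) x
  rw [classD_idx1, h0, fderiv_clm_apply hd (differentiableAt_const _)]
  simp only [classD, idx2]
  refine (iteratedFDeriv_two_apply φ x _).trans ?_
  simp

lemma IsTest.classD {α : DIdx d m} {φ : Eu d → ℝ} (hφ : IsTest Ω φ) : IsTest Ω (classD α φ) := by
  refine ⟨?_, classD_hasCompactSupport α hφ.2.1, ?_⟩
  · have : ContDiff ℝ ∞ (iteratedFDeriv ℝ (α.1 : ℕ) φ) :=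
      contDiff_infty.2 fun n => hφ.1.iteratedFDeriv_right (by exact_mod_cast le_top)
    exact (ContinuousMultilinearMap.apply ℝ (fun _ : Fin (α.1 : ℕ) => Eu d) ℝ
      fun j => EuclideanSpace.single (α.2 j) (1 : ℝ)).contDiff.comp this
  · refine subset_trans (closure_minimal ?_ (isClosed_tsupport φ)) hφ.2.2
    intro x hx
    refine support_iteratedFDeriv_subset (𝕜 := ℝ) (α.1 : ℕ) ?_
    intro h
    apply hx
    simp only [Oseen.classD, h]
    rfl

lemma exists_pd_Sob_two (g : Sob 2 2 Ω F) (j : Fin d) :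
    ∃ H : Sob 1 2 Ω F, val H = pd j (resSob one_le_two g) ∧
      ∀ i, pd i H = g.1 (idx2 j i) := by
  refine ⟨⟨WithLp.toLp 2 fun α => if h : α.1 = 0 then g.1 ((idx1 j).lift one_le_two)
    else g.1 (idx2 j (α.2 ⟨0, Nat.pos_of_ne_zero fun h' => h (Fin.ext h')⟩)), ?_⟩, ?_, ?_⟩
  · intro α
    rcases α.one_cases with rfl | ⟨i, rfl⟩
    · intro φ hφ
      simp [classD_idx0]
      simp [idx0]
    · intro φ hφ
      change ∫ x in Ω, Oseen.classD (idx1 i) φ x • g.1 ((idx1 j).lift one_le_two) x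
        = (-1 : ℝ) ^ 1 • ∫ x in Ω, φ x • g.1 (idx2 j i) x
      have h1 : ∫ x in Ω, Oseen.classD (idx2 j i) φ x • g.1 (idx0 d 2) x
        = (-1 : ℝ) ^ 2 • ∫ x in Ω, φ x • g.1 (idx2 j i) x := g.2 (idx2 j i) φ hφ
      have h2 : ∫ x in Ω, Oseen.classD (idx1 j) (Oseen.classD (idx1 i) φ) x • g.1 (idx0 d 2) x
          = (-1 : ℝ) ^ 1 • ∫ x in Ω, Oseen.classD (idx1 i) φ x • g.1 ((idx1 j).lift one_le_two) x :=
        g.2 ((idx1 j).lift one_le_two) (Oseen.classD (idx1 i) φ) hφ.classD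
      simp only [classD_idx2 j i hφ.1] at h1
      rw [h1] at h2
      simp only [even_two, Even.neg_pow, one_pow, one_smul, pow_one, neg_smul] at h2 ⊢
      rw [h2, neg_neg]
  · rfl
  · intro i
    rfl

end

/-! ### Integration by parts on `H^1_0` -/

section
variable {d m : ℕ} {Ω : Set (Eu d)} {F : Type} [NormedAddCommGroup F] [NormedSpace ℝ F]

/-- Integration by parts for a smooth function and a compactly supported smooth function. -/
lemma integral_fderiv_smul {η : Eu d → ℝ} {φ : Eu d → F} (hη : ContDiff ℝ ∞ η)
    (hφ : ContDiff ℝ ∞ φ) (hs : HasCompactSupport φ) (e : Eu d) :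
    ∫ x, fderiv ℝ η x e • φ x = -∫ x, η x • fderiv ℝ φ x e := by
  have h1 : Continuous fun x => fderiv ℝ η x e :=
    (hη.continuous_fderiv (by simp)).clm_apply continuous_const
  have h2 : Continuous fun x => fderiv ℝ φ x e :=
    (hφ.continuous_fderiv (by simp)).clm_apply continuous_const
  have hs' : HasCompactSupport fun x => fderiv ℝ φ x e := hs.fderiv_apply (𝕜 := ℝ) e
  rw [integral_smul_fderiv_eq_neg_fderiv_smul_of_integrable
    (((h1.smul hφ.continuous).integrable_of_hasCompactSupport hs.smul_left))
    ((hη.continuous.smul h2).integrable_of_hasCompactSupport hs'.smul_left)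
    ((hη.continuous.smul hφ.continuous).integrable_of_hasCompactSupport hs.smul_left)
    (fun x _ => hη.differentiable (by simp) x) (fun x _ => hφ.differentiable (by simp) x), neg_neg]

lemma IsTest.eq_zero_of_notMem {φ : Eu d → F} (hφ : IsTest Ω φ) {x : Eu d} (hx : x ∉ Ω) :
    φ x = 0 := image_eq_zero_of_notMem_tsupport fun h => hx (hφ.2.2 h)

lemma IsTest.fderiv_eq_zero_of_notMem {φ : Eu d → F} (hφ : IsTest Ω φ) {x : Eu d} (hx : x ∉ Ω) :
    fderiv ℝ φ x = 0 := by
  have := image_eq_zero_of_notMem_tsupport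
    (fun h => hx (hφ.2.2 (tsupport_fderiv_subset ℝ h)) : x ∉ tsupport (fderiv ℝ φ))
  exact this

lemma setIntegral_fderiv_smul {η : Eu d → ℝ} {φ : Eu d → F} (hη : ContDiff ℝ ∞ η)
    (hφ : IsTest Ω φ) (e : Eu d) :
    ∫ x in Ω, fderiv ℝ η x e • φ x = -∫ x in Ω, η x • fderiv ℝ φ x e := by
  rw [setIntegral_eq_integral_of_forall_compl_eq_zero, integral_fderiv_smul hη hφ.1 hφ.2.1,
    setIntegral_eq_integral_of_forall_compl_eq_zero]
  · intro x hx; simp [hφ.fderiv_eq_zero_of_notMem hx]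
  · intro x hx; simp [hφ.eq_zero_of_notMem hx]

variable [CompleteSpace F]

/-- The weak derivatives of a test function are the classical ones. -/
lemma pd_ae_eq_fderiv (hΩ : IsOpen Ω) (hb : Bornology.IsBounded Ω) {v : Sob 1 2 Ω F} {φ : Eu d → F}
    (hφ : IsTest Ω φ) (hv : val v =ᵐ[volume.restrict Ω] φ) (i : Fin d) :
    pd i v =ᵐ[volume.restrict Ω] fun x => fderiv ℝ φ x (EuclideanSpace.single i 1) := by
  have h2 : Continuous fun x => fderiv ℝ φ x (EuclideanSpace.single i 1) :=
    (hφ.1.continuous_fderiv (by simp)).clm_apply continuous_const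
  refine (v.2 (idx1 i)).ae_eq hΩ hv ?_ (integrableOn_Lp hb _)
    (h2.integrable_of_hasCompactSupport (hφ.2.1.fderiv_apply (𝕜 := ℝ) _)).integrableOn
  intro η hη
  simp only [classD_idx1]
  rw [setIntegral_fderiv_smul hη.1 hφ]
  simp [idx1]

/-- A closed condition on `H^1_0` needs to be checked for test functions only. -/
lemma H10_induction {P : Sob 1 2 Ω F → Prop} (hP : IsClosed {v | P v})
    (h : ∀ v φ, IsTest Ω φ → val v =ᵐ[volume.restrict Ω] φ → P v) {v : Sob 1 2 Ω F}
    (hv : v ∈ H10 Ω F) : P v := by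
  have h1 : (testSub 1 2 Ω F : Set (Sob 1 2 Ω F)) ⊆ {v | P v} := by
    rintro v ⟨φ, hφ, hv⟩
    exact h v φ hφ hv
  exact closure_minimal h1 hP hv

/-- For functions in `H^1_0` the integration by parts formula holds for smooth functions that need
not vanish near the boundary: the extension by zero is weakly differentiable on the whole space. -/
lemma integral_fderiv_smul_H10 (hΩ : IsOpen Ω) (hb : Bornology.IsBounded Ω) {η : Eu d → ℝ}
    (hη : ContDiff ℝ ∞ η) (hs : HasCompactSupport η) {v : Sob 1 2 Ω F} (hv : v ∈ H10 Ω F)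
    (i : Fin d) :
    ∫ x in Ω, fderiv ℝ η x (EuclideanSpace.single i 1) • val v x
      = -∫ x in Ω, η x • pd i v x := by
  have h2 : Continuous fun x => fderiv ℝ η x (EuclideanSpace.single i 1) :=
    (hη.continuous_fderiv (by simp)).clm_apply continuous_const
  obtain ⟨L1, h1⟩ := exists_pairing (F := F) 2 Ω h2 (hs.fderiv_apply (𝕜 := ℝ) _)
  obtain ⟨L2, h2⟩ := exists_pairing (F := F) 2 Ω hη.continuous hs
  refine H10_induction (P := fun v => ∫ x in Ω, fderiv ℝ η x (EuclideanSpace.single i 1) • val v x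
      = -∫ x in Ω, η x • pd i v x) ?_ ?_ hv
  · simp only [← h1, ← h2]
    exact isClosed_eq (L1.comp val).continuous (L2.comp (pd i)).continuous.neg
  · intro v φ hφ hv
    rw [integral_congr_ae (g := fun x => fderiv ℝ η x (EuclideanSpace.single i 1) • φ x)
        (hv.mono fun x hx => by simp only [hx]), setIntegral_fderiv_smul hη hφ,
      integral_congr_ae (f := fun x => η x • pd i v x)
        (g := fun x => η x • fderiv ℝ φ x (EuclideanSpace.single i 1))
        ((pd_ae_eq_fderiv hΩ hb hφ hv i).mono fun x hx => by simp only [hx])]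

lemma setIntegral_pd_H10 (hΩ : IsOpen Ω) (hb : Bornology.IsBounded Ω) {v : Sob 1 2 Ω F}
    (hv : v ∈ H10 Ω F) (i : Fin d) : ∫ x in Ω, pd i v x = 0 := by
  obtain ⟨R, hR⟩ := hb.subset_ball (0 : Eu d)
  -- a cutoff function that is equal to one on `Ω`
  let η : ContDiffBump (0 : Eu d) := ⟨max R 1, max R 1 + 1, by positivity, by linarith⟩
  have h1 : ∀ x ∈ Ω, η x = 1 := fun x hx => η.one_of_mem_closedBall
    (Metric.ball_subset_closedBall (Metric.ball_subset_ball (le_max_left _ _) (hR hx)))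
  have h := integral_fderiv_smul_H10 hΩ hb η.contDiff η.hasCompactSupport hv i
  rw [setIntegral_congr_fun (g := fun _ => (0 : F)) hΩ.measurableSet,
    setIntegral_congr_fun (g := fun x => pd i v x) (f := fun x => η x • pd i v x)
      hΩ.measurableSet] at h
  · simpa using h.symm
  · intro x hx
    simp [h1 x hx]
  · intro x hx
    have : (η : Eu d → ℝ) =ᶠ[nhds x] fun _ => 1 :=
      Filter.eventually_of_mem (hΩ.mem_nhds hx) h1
    simp [this.fderiv_eq]

end

section
variable {d : ℕ} {Ω : Set (Eu d)}

lemma Lp_sum_ae {ι : Type} (s : Finset ι) {F : Type} [NormedAddCommGroup F] {p : ℝ≥0∞}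
    (f : ι → LpΩ p Ω F) : (∑ i ∈ s, f i : LpΩ p Ω F) =ᵐ[volume.restrict Ω]
      fun x => ∑ i ∈ s, f i x := by
  classical
  induction s using Finset.induction_on with
  | empty => simp only [Finset.sum_empty]; exact Lp.coeFn_zero F p _
  | insert a s ha ih =>
    rw [Finset.sum_insert ha]
    filter_upwards [ih, Lp.coeFn_add (f a) (∑ i ∈ s, f i)] with x h1 h2
    rw [h2, Pi.add_apply, h1, Finset.sum_insert ha]

lemma dvg_ae (v : Sob 1 2 Ω (Eu d)) :
    dvg v =ᵐ[volume.restrict Ω] fun x => ∑ i, pd i v x i := by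
  have h : dvg v = ∑ i, (EuclideanSpace.proj i : Eu d →L[ℝ] ℝ).compLpL 2
    ((volume : Measure (Eu d)).restrict Ω) (pd i v) := by simp [dvg]
  rw [h]
  have h1 : ∀ᵐ x ∂((volume : Measure (Eu d)).restrict Ω), ∀ i : Fin d,
      (EuclideanSpace.proj i : Eu d →L[ℝ] ℝ).compLpL 2
        ((volume : Measure (Eu d)).restrict Ω) (pd i v) x = pd i v x i :=
    ae_all_iff.2 fun i => ContinuousLinearMap.coeFn_compLpL (p := 2) _ (pd i v)
  filter_upwards [Lp_sum_ae (p := 2) Finset.univ (fun i => (EuclideanSpace.proj i :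
    Eu d →L[ℝ] ℝ).compLpL 2 ((volume : Measure (Eu d)).restrict Ω) (pd i v)), h1] with x hx h1
  rw [hx]
  exact Finset.sum_congr rfl fun i _ => h1 i

lemma grad_ae (q : Sob 1 2 Ω ℝ) :
    ∀ᵐ x ∂((volume : Measure (Eu d)).restrict Ω), ∀ i, grad q x i = pd i q x := by
  have h : grad q = ∑ i, (ContinuousLinearMap.toSpanSingleton ℝ
    (EuclideanSpace.single i (1 : ℝ))).compLpL 2
    ((volume : Measure (Eu d)).restrict Ω) (pd i q) := by simp [grad]
  rw [h]
  have h1 : ∀ᵐ x ∂((volume : Measure (Eu d)).restrict Ω), ∀ i : Fin d,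
      (ContinuousLinearMap.toSpanSingleton ℝ (EuclideanSpace.single i (1 : ℝ))).compLpL 2
        ((volume : Measure (Eu d)).restrict Ω) (pd i q) x
        = pd i q x • EuclideanSpace.single i (1 : ℝ) :=
    ae_all_iff.2 fun i => ContinuousLinearMap.coeFn_compLpL (p := 2) _ (pd i q)
  filter_upwards [Lp_sum_ae (p := 2) Finset.univ (fun i => (ContinuousLinearMap.toSpanSingleton ℝ
    (EuclideanSpace.single i (1 : ℝ))).compLpL 2
    ((volume : Measure (Eu d)).restrict Ω) (pd i q)), h1] with x hx h1 i
  rw [hx]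
  simp only [h1]
  simp [Pi.single_apply]

lemma norm_grad_sq (q : Sob 1 2 Ω ℝ) : ‖grad q‖ ^ 2 = ∑ i, ‖pd i q‖ ^ 2 := by
  have hL : ∀ {F : Type} [NormedAddCommGroup F] [InnerProductSpace ℝ F] (f : LpΩ 2 Ω F),
      ‖f‖ ^ 2 = ∫ x in Ω, ‖f x‖ ^ 2 := by
    intro F _ _ f
    rw [← real_inner_self_eq_norm_sq, L2.inner_def]
    simp
  rw [hL]
  simp_rw [hL]
  rw [← integral_finsetSum _ fun i _ => (Lp.memLp (pd i q)).integrable_norm_pow two_ne_zero]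
  refine integral_congr_ae ?_
  filter_upwards [grad_ae q] with x hx
  simp [EuclideanSpace.norm_sq_eq, hx]

lemma norm_grad_le (q : Sob 1 2 Ω ℝ) : ‖grad q‖ ≤ ‖q‖ := by
  refine (sq_le_sq₀ (norm_nonneg _) (norm_nonneg _)).1 ?_
  rw [norm_grad_sq, norm_sq_Sob]
  have : Function.Injective (fun i : Fin d => (idx1 i : DIdx d 1)) := by
    intro a b h
    simpa [idx1, funext_iff] using h
  calc _ = ∑ α ∈ Finset.univ.map ⟨_, this⟩, ‖q.1 α‖ ^ 2 := by
        rw [Finset.sum_map]; rfl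
    _ ≤ _ := Finset.sum_le_sum_of_subset_of_nonneg (Finset.subset_univ _)
        fun _ _ _ => by positivity

lemma gradInner_self_le (v : Sob 1 2 Ω (Eu d)) : gradInner v v ≤ ‖v‖ ^ 2 := by
  rw [norm_sq_Sob]
  have : Function.Injective (fun i : Fin d => (idx1 i : DIdx d 1)) := by
    intro a b h
    simpa [idx1, funext_iff] using h
  calc _ = ∑ α ∈ Finset.univ.map ⟨_, this⟩, ‖v.1 α‖ ^ 2 := by
        rw [Finset.sum_map]
        refine Finset.sum_congr rfl fun i _ => real_inner_self_eq_norm_sq _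
    _ ≤ _ := Finset.sum_le_sum_of_subset_of_nonneg (Finset.subset_univ _)
        fun _ _ _ => by positivity

/-- Green's formula `(∇·v, q) = -(v, ∇q)` for `v ∈ H^1_0` and `q ∈ H^1`. -/
lemma inner_dvg_eq_neg_inner_grad (hΩ : IsOpen Ω) (hb : Bornology.IsBounded Ω)
    {v : Sob 1 2 Ω (Eu d)} (hv : v ∈ H10 Ω (Eu d)) (q : Sob 1 2 Ω ℝ) :
    inner ℝ (dvg v) (val q) = -inner ℝ (val v) (grad q) := by
  refine H10_induction (P := fun v => inner ℝ (dvg v) (val q) = -inner ℝ (val v) (grad q))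
    ?_ ?_ hv
  · exact isClosed_eq (dvg.continuous.inner continuous_const)
      (val.continuous.inner continuous_const).neg
  · intro v φ hφ hv
    have hc : ∀ i, IsTest Ω fun x => φ x i := fun i => by
      refine ⟨?_, ?_, ?_⟩
      · exact (EuclideanSpace.proj i : Eu d →L[ℝ] ℝ).contDiff.comp hφ.1
      · exact hφ.2.1.comp_left (g := fun y : Eu d => y i) rfl
      · refine subset_trans (closure_mono fun x hx => ?_) hφ.2.2
        intro h; apply hx; simp [h]
    have hfd : ∀ i x e, fderiv ℝ (fun x => φ x i) x e = fderiv ℝ φ x e i := by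
      intro i x e
      have := ((EuclideanSpace.proj i : Eu d →L[ℝ] ℝ).hasFDerivAt.comp x
        (hφ.1.differentiable (by simp) x).hasFDerivAt).fderiv
      exact DFunLike.congr_fun this e
    have hW : ∀ i, ∫ x in Ω, fderiv ℝ φ x (EuclideanSpace.single i 1) i * val q x
        = -∫ x in Ω, φ x i * pd i q x := by
      intro i
      have := q.2 (idx1 i) _ (hc i)
      simp only [classD_idx1, hfd] at this
      have h1 : ((idx1 i : DIdx d 1).1 : ℕ) = 1 := rfl
      simp only [h1, pow_one, neg_mul, one_mul, smul_eq_mul] at this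
      exact this
    have hpd : ∀ᵐ x ∂((volume : Measure (Eu d)).restrict Ω), ∀ i,
        pd i v x = fderiv ℝ φ x (EuclideanSpace.single i 1) :=
      ae_all_iff.2 fun i => pd_ae_eq_fderiv hΩ hb hφ hv i
    have hint : ∀ (ψ : Eu d → ℝ), Continuous ψ → HasCompactSupport ψ → ∀ r : LpΩ 2 Ω ℝ,
        Integrable (fun x => ψ x * r x) (volume.restrict Ω) := by
      intro ψ h1 h2 r
      obtain ⟨C, hC⟩ := h1.bounded_above_of_compact_support h2
      exact (integrableOn_Lp hb r).bdd_mul h1.aestronglyMeasurable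
        (Filter.Eventually.of_forall hC)
    rw [L2.inner_def, L2.inner_def]
    have e1 : ∫ x in Ω, inner ℝ (dvg v x) (val q x)
        = ∑ i, ∫ x in Ω, fderiv ℝ φ x (EuclideanSpace.single i 1) i * val q x := by
      rw [← integral_finsetSum]
      · refine integral_congr_ae ?_
        filter_upwards [dvg_ae v, hpd] with x h1 h2
        rw [h1]
        simp only [h2, ← Finset.sum_mul]
        simp [mul_comm]
      · intro i _
        simp only [← hfd]
        refine hint _ ?_ ?_ _
        · exact ((hc i).1.continuous_fderiv (by simp)).clm_apply continuous_const
        · exact (hc i).2.1.fderiv_apply (𝕜 := ℝ) _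
    have e2 : ∫ x in Ω, inner ℝ (val v x) (grad q x)
        = ∑ i, ∫ x in Ω, φ x i * pd i q x := by
      rw [← integral_finsetSum]
      · refine integral_congr_ae ?_
        filter_upwards [grad_ae q, hv] with x h1 h2
        rw [PiLp.inner_apply]
        simp only [h1, h2]
        simp [mul_comm]
      · intro i _
        exact hint _ (hc i).1.continuous (hc i).2.1 _
    rw [e1, e2, ← Finset.sum_neg_distrib]
    exact Finset.sum_congr rfl fun i _ => hW i

lemma dvg_mem_L20 (hΩ : IsOpen Ω) (hb : Bornology.IsBounded Ω) {v : Sob 1 2 Ω (Eu d)}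
    (hv : v ∈ H10 Ω (Eu d)) : dvg v ∈ L20 Ω := by
  refine ⟨integrableOn_Lp hb _, ?_⟩
  rw [integral_congr_ae (dvg_ae v), integral_finsetSum]
  · refine Finset.sum_eq_zero fun i _ => ?_
    have := (EuclideanSpace.proj i : Eu d →L[ℝ] ℝ).integral_comp_comm
      (integrableOn_Lp hb (pd i v))
    rw [setIntegral_pd_H10 hΩ hb hv, map_zero] at this
    exact this
  · intro i _
    exact (EuclideanSpace.proj i : Eu d →L[ℝ] ℝ).integrable_comp (integrableOn_Lp hb (pd i v))

end

/-! ### Mollification -/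

/-- The Cauchy-Schwarz inequality for the product with the constant function `1`. -/
lemma sq_lintegral_le {α : Type} [MeasurableSpace α] (ν : Measure α) {f : α → ℝ≥0∞}
    (hf : AEMeasurable f ν) : (∫⁻ x, f x ∂ν) ^ 2 ≤ ν univ * ∫⁻ x, f x ^ 2 ∂ν := by
  have h := ENNReal.lintegral_mul_le_Lp_mul_Lq ν Real.HolderConjugate.two_two
    (aemeasurable_const (b := (1 : ℝ≥0∞))) hf
  simp only [Pi.mul_apply, one_mul, ENNReal.one_rpow, lintegral_const] at h
  calc (∫⁻ x, f x ∂ν) ^ 2 ≤ ((ν univ) ^ (1 / (2 : ℝ))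
        * (∫⁻ x, f x ^ (2 : ℝ) ∂ν) ^ (1 / (2 : ℝ))) ^ 2 := by gcongr
    _ = _ := by
      rw [mul_pow, ← ENNReal.rpow_natCast, ← ENNReal.rpow_natCast, ← ENNReal.rpow_mul,
        ← ENNReal.rpow_mul]
      norm_num

section
variable {E : Type} [NormedAddCommGroup E] [NormedSpace ℝ E] [HasContDiffBump E]
  [FiniteDimensional ℝ E] [MeasureSpace E] [BorelSpace E] [(volume : Measure E).IsAddHaarMeasure]
  {F : Type} [NormedAddCommGroup F] [NormedSpace ℝ F]

/-- A sequence of bump functions whose supports shrink to the origin. -/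
def mollBump (E : Type) [NormedAddCommGroup E] (n : ℕ) : ContDiffBump (0 : E) where
  rIn := ((n : ℝ) + 1)⁻¹ / 2
  rOut := ((n : ℝ) + 1)⁻¹
  rIn_pos := by positivity
  rIn_lt_rOut := half_lt_self (by positivity)

/-- The mollifying kernels: smooth, nonnegative, with integral one, and supported in the ball of
radius `1/(n+1)`. -/
def ker (E : Type) [NormedAddCommGroup E] [NormedSpace ℝ E] [HasContDiffBump E]
    [MeasureSpace E] (n : ℕ) : E → ℝ :=
  (mollBump E n).normed volume

/-- The mollification of `g`. -/
def moll (n : ℕ) (g : E → F) (x : E) : F := ∫ y, ker E n (x - y) • g y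

lemma moll_eq_convolution (n : ℕ) (g : E → F) :
    moll n g = convolution (ker E n) g (ContinuousLinearMap.lsmul ℝ ℝ) volume := by
  ext x
  rw [convolution_eq_swap]
  rfl

lemma contDiff_ker (n : ℕ) : ContDiff ℝ ∞ (ker E n) := (mollBump E n).contDiff_normed (n := ⊤)

lemma hasCompactSupport_ker (n : ℕ) : HasCompactSupport (ker E n) :=
  (mollBump E n).hasCompactSupport_normed

lemma ker_nonneg (n : ℕ) (x : E) : 0 ≤ ker E n x := (mollBump E n).nonneg_normed x

lemma integral_ker (n : ℕ) : ∫ x, ker E n x = 1 := (mollBump E n).integral_normed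

lemma ker_neg (n : ℕ) (x : E) : ker E n (-x) = ker E n x := (mollBump E n).normed_neg x

lemma tsupport_ker (n : ℕ) : tsupport (ker E n) = Metric.closedBall 0 ((n : ℝ) + 1)⁻¹ :=
  (mollBump E n).tsupport_normed_eq

lemma tendsto_radius : Filter.Tendsto (fun n : ℕ => ((n : ℝ) + 1)⁻¹) Filter.atTop (nhds 0) := by
  simpa using tendsto_one_div_add_atTop_nhds_zero_nat (𝕜 := ℝ)

lemma ae_tendsto_moll [CompleteSpace F] {g : E → F} (hg : LocallyIntegrable g) :
    ∀ᵐ x, Filter.Tendsto (fun n => moll n g x) Filter.atTop (nhds (g x)) := by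
  have := ContDiffBump.ae_convolution_tendsto_right_of_locallyIntegrable
    (φ := mollBump E) (l := Filter.atTop) (K := 2) (μ := volume) tendsto_radius
    (Filter.Eventually.of_forall fun n => by simp only [mollBump]; linarith) hg
  filter_upwards [this] with x hx
  simp only [moll_eq_convolution]
  exact hx

lemma continuous_moll (n : ℕ) {g : E → F} (hg : LocallyIntegrable g) : Continuous (moll n g) := by
  rw [moll_eq_convolution]
  exact (hasCompactSupport_ker n).continuous_convolution_left _ (contDiff_ker n).continuous hg

lemma hasFDerivAt_moll [CompleteSpace F] (n : ℕ) {g : E → F} (hg : LocallyIntegrable g) (x : E) :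
    ∃ D : E →L[ℝ] F, HasFDerivAt (moll n g) D x ∧
      ∀ e, D e = ∫ y, fderiv ℝ (ker E n) (x - y) e • g y := by
  refine ⟨_, by
    rw [moll_eq_convolution]
    exact (hasCompactSupport_ker n).hasFDerivAt_convolution_left _
      ((contDiff_ker n).of_le (by simp)) hg x, fun e => ?_⟩
  rw [convolution_eq_swap]
  have hex : Integrable (fun y => ((ContinuousLinearMap.lsmul ℝ ℝ (E := F)).precompL E
      (fderiv ℝ (ker E n) (x - y))) (g y)) := by
    have := (HasCompactSupport.convolutionExists_left
      ((ContinuousLinearMap.lsmul ℝ ℝ (E := F)).precompL E)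
      ((hasCompactSupport_ker (E := E) n).fderiv (𝕜 := ℝ))
      ((contDiff_ker n).continuous_fderiv (by simp)) hg x).integrable_swap
    exact this
  rw [ContinuousLinearMap.integral_apply hex]
  rfl

/-- Mollification is a contraction in `L^2`. -/
lemma lintegral_moll_sq_le (n : ℕ) {g : E → F} (hg : AEStronglyMeasurable g) :
    ∫⁻ x, ‖moll n g x‖ₑ ^ 2 ≤ ∫⁻ x, ‖g x‖ₑ ^ 2 := by
  have hk : Measurable fun x : E => ENNReal.ofReal (ker E n x) :=
    (contDiff_ker n).continuous.measurable.ennreal_ofReal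
  have hk1 : ∫⁻ x : E, ENNReal.ofReal (ker E n x) = 1 := by
    have := ofReal_integral_eq_lintegral_ofReal (f := ker E n) (mollBump E n).integrable_normed
      (Filter.Eventually.of_forall (ker_nonneg n))
    rw [← this, integral_ker, ENNReal.ofReal_one]
  have h1 : ∀ x : E, ‖moll n g x‖ₑ ^ 2
      ≤ ∫⁻ y, ENNReal.ofReal (ker E n (x - y)) * ‖g y‖ₑ ^ 2 := by
    intro x
    have hm : Measurable fun y : E => ENNReal.ofReal (ker E n (x - y)) :=
      hk.comp (measurable_const.sub measurable_id)
    have h2 : ‖moll n g x‖ₑ ≤ ∫⁻ y, ENNReal.ofReal (ker E n (x - y)) * ‖g y‖ₑ := by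
      refine (enorm_integral_le_lintegral_enorm _).trans_eq ?_
      refine lintegral_congr fun y => ?_
      rw [enorm_smul, Real.enorm_eq_ofReal (ker_nonneg n _)]
    let ν : Measure E := volume.withDensity fun y => ENNReal.ofReal (ker E n (x - y))
    have hν : ν univ = 1 := by
      rw [withDensity_apply _ MeasurableSet.univ, Measure.restrict_univ,
        lintegral_sub_left_eq_self (fun y => ENNReal.ofReal (ker E n y)) x, hk1]
    have h3 := sq_lintegral_le ν (f := fun y => ‖g y‖ₑ)
      (hg.enorm.mono_ac (withDensity_absolutelyContinuous _ _))
    rw [hν, one_mul, lintegral_withDensity_eq_lintegral_mul₀ hm.aemeasurable hg.enorm,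
      lintegral_withDensity_eq_lintegral_mul₀ hm.aemeasurable (hg.enorm.pow_const 2)] at h3
    exact (pow_le_pow_left' h2 2).trans h3
  calc _ ≤ ∫⁻ x : E, ∫⁻ y, ENNReal.ofReal (ker E n (x - y)) * ‖g y‖ₑ ^ 2 := lintegral_mono h1
    _ = ∫⁻ y, ∫⁻ x : E, ENNReal.ofReal (ker E n (x - y)) * ‖g y‖ₑ ^ 2 := by
        refine lintegral_lintegral_swap ?_
        exact (hk.comp (measurable_fst.sub measurable_snd)).aemeasurable.mul
          (hg.enorm.pow_const 2).comp_snd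
    _ = _ := by
        refine lintegral_congr fun y => ?_
        have hm : Measurable fun x : E => ENNReal.ofReal (ker E n (x - y)) :=
          hk.comp (measurable_id.sub measurable_const)
        rw [lintegral_mul_const'' _ hm.aemeasurable,
          lintegral_sub_right_eq_self (fun x => ENNReal.ofReal (ker E n x)) y, hk1, one_mul]

end

section
variable {d : ℕ} {Ω : Set (Eu d)} {F : Type} [NormedAddCommGroup F] [NormedSpace ℝ F]
  [CompleteSpace F]

/-- If `G` is the weak gradient of `f` as far as the mollifying kernel centered at `x` can see, then
the gradient of the mollification of `f` at `x` is the mollification of `G`. -/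
lemma hasFDerivAt_moll_of_weak (n : ℕ) {f : Eu d → F} {G : Fin d → Eu d → F}
    (hf : LocallyIntegrable f) (x : Eu d)
    (h : ∀ i, ∫ y, fderiv ℝ (fun y => ker (Eu d) n (x - y)) y (EuclideanSpace.single i 1) • f y
      = -∫ y, ker (Eu d) n (x - y) • G i y) :
    HasFDerivAt (moll n f) (∑ i, (EuclideanSpace.proj i : Eu d →L[ℝ] ℝ).smulRight
      (moll n (G i) x)) x := by
  obtain ⟨D, hD, hD'⟩ := hasFDerivAt_moll n hf x
  have h1 : ∀ i, D (EuclideanSpace.single i 1) = moll n (G i) x := by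
    intro i
    rw [hD', moll, ← neg_inj, ← h i, ← integral_neg]
    refine integral_congr_ae (Filter.Eventually.of_forall fun y => ?_)
    have h2 : HasFDerivAt (fun y => ker (Eu d) n (x - y))
        ((fderiv ℝ (ker (Eu d) n) (x - y)).comp (-ContinuousLinearMap.id ℝ (Eu d))) y := by
      refine (((contDiff_ker n).differentiable (by simp)) (x - y)).hasFDerivAt.comp y ?_
      simpa using (hasFDerivAt_id y).const_sub x
    simp only
    rw [h2.fderiv]
    simp
  have h2 : ∑ i, (EuclideanSpace.proj i : Eu d →L[ℝ] ℝ).smulRight (moll n (G i) x) = D := by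
    refine ContinuousLinearMap.ext fun e => ?_
    have h3 := (EuclideanSpace.basisFun (Fin d) ℝ).sum_repr e
    simp only [EuclideanSpace.basisFun_repr, EuclideanSpace.basisFun_apply] at h3
    conv_rhs => rw [← h3]
    simp [h1]
  rw [h2]
  exact hD

lemma contDiff_ker_sub (n : ℕ) (x : Eu d) : ContDiff ℝ ∞ fun y => ker (Eu d) n (x - y) :=
  (contDiff_ker n).comp (contDiff_const.sub contDiff_id)

lemma support_ker_sub (n : ℕ) (x : Eu d) :
    tsupport (fun y => ker (Eu d) n (x - y)) ⊆ Metric.closedBall x ((n : ℝ) + 1)⁻¹ := by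
  refine closure_minimal ?_ Metric.isClosed_closedBall
  intro y hy
  have h1 : x - y ∈ tsupport (ker (Eu d) n) := subset_tsupport _ hy
  rw [tsupport_ker] at h1
  simpa [dist_eq_norm, norm_sub_rev] using h1

lemma hasCompactSupport_ker_sub (n : ℕ) (x : Eu d) :
    HasCompactSupport fun y => ker (Eu d) n (x - y) :=
  (isCompact_closedBall x _).of_isClosed_subset (isClosed_tsupport _) (support_ker_sub n x)

lemma integral_smul_indicator (hΩ : IsOpen Ω) (a : Eu d → ℝ) (g : Eu d → F) :
    ∫ y, a y • Ω.indicator g y = ∫ y in Ω, a y • g y := by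
  rw [← integral_indicator hΩ.measurableSet]
  congr 1
  ext y
  by_cases h : y ∈ Ω <;> simp [h]

lemma locallyIntegrable_indicator (hΩ : IsOpen Ω) (hb : Bornology.IsBounded Ω) {p : ℝ≥0∞}
    [Fact (1 ≤ p)] (f : LpΩ p Ω F) : LocallyIntegrable (Ω.indicator f) :=
  ((integrable_indicator_iff hΩ.measurableSet).2 (integrableOn_Lp hb f)).locallyIntegrable

lemma hasFDerivAt_moll_interior (hΩ : IsOpen Ω) (hb : Bornology.IsBounded Ω) (n : ℕ)
    (v : Sob 1 2 Ω F) {x : Eu d} (hx : Metric.closedBall x ((n : ℝ) + 1)⁻¹ ⊆ Ω) :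
    HasFDerivAt (moll n (Ω.indicator (val v)))
      (∑ i, (EuclideanSpace.proj i : Eu d →L[ℝ] ℝ).smulRight
        (moll n (Ω.indicator (pd i v)) x)) x := by
  refine hasFDerivAt_moll_of_weak n (locallyIntegrable_indicator hΩ hb _) x fun i => ?_
  rw [integral_smul_indicator hΩ, integral_smul_indicator hΩ]
  have := v.2 (idx1 i) (fun y => ker (Eu d) n (x - y)) ⟨contDiff_ker_sub n x,
    hasCompactSupport_ker_sub n x, (support_ker_sub n x).trans hx⟩
  simp only [classD_idx1] at this
  have h1 : ((idx1 i : DIdx d 1).1 : ℕ) = 1 := rfl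
  simp only [h1, pow_one, neg_smul, one_smul] at this
  exact this

lemma hasFDerivAt_moll_H10 (hΩ : IsOpen Ω) (hb : Bornology.IsBounded Ω) (n : ℕ)
    {v : Sob 1 2 Ω F} (hv : v ∈ H10 Ω F) (x : Eu d) :
    HasFDerivAt (moll n (Ω.indicator (val v)))
      (∑ i, (EuclideanSpace.proj i : Eu d →L[ℝ] ℝ).smulRight
        (moll n (Ω.indicator (pd i v)) x)) x := by
  refine hasFDerivAt_moll_of_weak n (locallyIntegrable_indicator hΩ hb _) x fun i => ?_
  rw [integral_smul_indicator hΩ, integral_smul_indicator hΩ]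
  exact integral_fderiv_smul_H10 hΩ hb (contDiff_ker_sub n x) (hasCompactSupport_ker_sub n x) hv i

end

/-! ### Lipschitz representatives of convecting velocities and the flow map -/

section
variable {d : ℕ} {Ω : Set (Eu d)}

lemma norm_sum_smul_le (e : Eu d) (g : Fin d → Eu d) :
    ‖∑ i, e i • g i‖ ≤ ‖e‖ * √(∑ i, ‖g i‖ ^ 2) := by
  calc ‖∑ i, e i • g i‖ ≤ ∑ i, |e i| * ‖g i‖ :=
        (norm_sum_le _ _).trans (Finset.sum_le_sum fun i _ => by rw [norm_smul, Real.norm_eq_abs])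
    _ ≤ √(∑ i, |e i| ^ 2) * √(∑ i, ‖g i‖ ^ 2) := Real.sum_mul_le_sqrt_mul_sqrt _ _ _
    _ = _ := by rw [EuclideanSpace.norm_eq]; simp

lemma integrable_ker_smul {F : Type} [NormedAddCommGroup F] [NormedSpace ℝ F] (n : ℕ)
    {g : Eu d → F} (hg : LocallyIntegrable g) (x : Eu d) :
    Integrable fun y => ker (Eu d) n (x - y) • g y := by
  have := (HasCompactSupport.convolutionExists_left
    (ContinuousLinearMap.lsmul ℝ ℝ (E := F)) (hasCompactSupport_ker (E := Eu d) n)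
    (contDiff_ker n).continuous hg x).integrable_swap
  exact this

lemma norm_moll_le {F : Type} [NormedAddCommGroup F] [NormedSpace ℝ F] (n : ℕ) {g : Eu d → F}
    {C : ℝ} (hC : ∀ᵐ y, ‖g y‖ ≤ C) (x : Eu d) : ‖moll n g x‖ ≤ C := by
  have hi : Integrable fun y : Eu d => ker (Eu d) n (x - y) := by
    have := integrable_ker_smul (F := ℝ) n (g := fun _ : Eu d => (1 : ℝ))
      (locallyIntegrable_const 1) x
    simpa using this
  calc ‖moll n g x‖ ≤ ∫ y, ker (Eu d) n (x - y) * C := by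
        refine norm_integral_le_of_norm_le (hi.mul_const C) ?_
        filter_upwards [hC] with y hy
        rw [norm_smul, Real.norm_of_nonneg (ker_nonneg n _)]
        exact mul_le_mul_of_nonneg_left hy (ker_nonneg n _)
    _ = C := by
        rw [integral_mul_const, integral_sub_left_eq_self (fun y => ker (Eu d) n y), integral_ker,
          one_mul]

/-- A function in `W^{1,∞}` that vanishes on the boundary is represented by a function on the whole
space that vanishes outside `Ω` and is Lipschitz continuous, with the supremum of the Frobenius norm
of the gradient as the Lipschitz constant. No regularity of `∂Ω` is needed since the extension by
zero is weakly differentiable. -/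
lemma exists_lipschitz_representative (hΩ : IsOpen Ω) (hb : Bornology.IsBounded Ω)
    (hi : interior (closure Ω) = Ω) (w : Sob 1 ∞ Ω (Eu d)) (hw : IsW0 w) (L : NNReal)
    (hL : ∀ᵐ x ∂((volume : Measure (Eu d)).restrict Ω), √(∑ j, ‖pd j w x‖ ^ 2) ≤ L) :
    ∃ W : Eu d → Eu d, LipschitzWith L W ∧ (∀ x ∉ Ω, W x = 0) ∧
      val w =ᵐ[volume.restrict Ω] W := by
  obtain ⟨v, hv, hvw⟩ := hw
  set f : Eu d → Eu d := Ω.indicator (val v) with hf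
  have hpd : ∀ i, pd i v =ᵐ[volume.restrict Ω] pd i w := fun i =>
    (v.2 (idx1 i)).ae_eq hΩ hvw (w.2 (idx1 i)) (integrableOn_Lp hb _) (integrableOn_Lp hb _)
  have hG : ∀ e : Eu d, ∀ᵐ y, ‖∑ i, e i • Ω.indicator (pd i v) y‖ ≤ L * ‖e‖ := by
    intro e
    have h1 := (ae_restrict_iff' hΩ.measurableSet).1 (hL.and (ae_all_iff.2 hpd))
    filter_upwards [h1] with y hy
    by_cases hyΩ : y ∈ Ω
    · obtain ⟨h2, h3⟩ := hy hyΩ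
      simp only [indicator_of_mem hyΩ, h3]
      calc _ ≤ ‖e‖ * √(∑ i, ‖pd i w y‖ ^ 2) := norm_sum_smul_le e _
        _ ≤ ‖e‖ * L := by gcongr
        _ = _ := mul_comm _ _
    · simp only [indicator_of_notMem hyΩ]
      simp only [smul_zero, Finset.sum_const_zero, norm_zero]
      positivity
  have hlip : ∀ n, LipschitzWith L (moll n f) := by
    intro n
    have hD := fun x => hasFDerivAt_moll_H10 hΩ hb n hv x
    refine lipschitzWith_of_nnnorm_fderiv_le (𝕜 := ℝ) (fun x => (hD x).differentiableAt)
      fun x => ?_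
    rw [(hD x).fderiv, ← NNReal.coe_le_coe, coe_nnnorm]
    refine ContinuousLinearMap.opNorm_le_bound _ L.2 fun e => ?_
    have h1 : (∑ i, (EuclideanSpace.proj i : Eu d →L[ℝ] ℝ).smulRight
        (moll n (Ω.indicator (pd i v)) x)) e
        = moll n (fun y => ∑ i, e i • Ω.indicator (pd i v) y) x := by
      simp only [moll, Finset.smul_sum]
      rw [integral_finsetSum]
      · simp only [sum_apply, ContinuousLinearMap.smulRight_apply,
          PiLp.proj_apply]
        refine Finset.sum_congr rfl fun i _ => ?_
        rw [← integral_smul]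
        exact integral_congr_ae (Filter.Eventually.of_forall fun y => smul_comm _ _ _)
      · intro i _
        exact integrable_ker_smul n
          ((locallyIntegrable_indicator hΩ hb (pd i v)).smul (e i)) x
    rw [h1]
    exact norm_moll_le n (hG e) x
  have hae := ae_tendsto_moll (locallyIntegrable_indicator hΩ hb (val v))
  set S : Set (Eu d) := {x | Filter.Tendsto (fun n => moll n f x) Filter.atTop (nhds (f x))}
  have hS : Dense S := Measure.dense_of_ae hae
  have hfS : LipschitzWith L (fun x : S => f x) := by
    refine LipschitzWith.of_dist_le_mul fun x y => ?_
    exact le_of_tendsto (x.2.dist y.2)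
      (Filter.Eventually.of_forall fun n => (hlip n).dist_le_mul _ _)
  refine ⟨hS.extend (fun x : S => f x), hS.lipschitzWith_extend hfS, ?_, ?_⟩
  all_goals
    set W := hS.extend (fun x : S => f x) with hW
    have hWL : LipschitzWith L W := hS.lipschitzWith_extend hfS
    have hWf : ∀ᵐ x, f x = W x := by
      filter_upwards [hae] with x hx
      exact (hS.extend_eq hfS.continuous ⟨x, hx⟩).symm
  · -- `W` vanishes outside the closure of `Ω`, and the exterior is dense in the complement
    have h1 : EqOn W 0 (closure Ω)ᶜ := by
      refine Measure.eqOn_open_of_ae_eq (μ := volume) ?_ isClosed_closure.isOpen_compl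
        hWL.continuous.continuousOn continuousOn_const
      filter_upwards [ae_restrict_of_ae hWf, ae_restrict_mem isClosed_closure.isOpen_compl.measurableSet]
        with x hx hx'
      rw [← hx, hf, indicator_of_notMem fun h => hx' (subset_closure h)]
      rfl
    intro x hx
    have h2 : x ∈ closure (closure Ω)ᶜ := by
      rw [closure_compl, hi]; exact hx
    exact h1.closure hWL.continuous continuous_const h2
  · filter_upwards [hvw, ae_restrict_of_ae hWf, ae_restrict_mem hΩ.measurableSet] with x h1 h2 h3
    rw [← h1, ← h2, hf, indicator_of_mem h3]

/-- The map `x ↦ x - s W(x)`. -/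
def shift (W : Eu d → Eu d) (s : ℝ) (x : Eu d) : Eu d := x - s • W x

lemma antilipschitz_shift {W : Eu d → Eu d} {L : NNReal} (hW : LipschitzWith L W) {s : ℝ}
    (hs : 0 ≤ s) (hsL : s * L < 1) :
    AntilipschitzWith (Real.toNNReal (1 - s * L)⁻¹) (shift W s) := by
  refine AntilipschitzWith.of_le_mul_dist fun x y => ?_
  have h0 : 0 < 1 - s * L := by linarith
  rw [Real.coe_toNNReal _ (inv_nonneg.2 h0.le), ← div_eq_inv_mul, le_div_iff₀ h0]
  have h1 : dist x y ≤ dist (shift W s x) (shift W s y) + s * dist (W x) (W y) := by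
    rw [dist_eq_norm, dist_eq_norm, dist_eq_norm]
    have : x - y = (shift W s x - shift W s y) + s • (W x - W y) := by
      simp only [shift, smul_sub]; abel
    calc ‖x - y‖ ≤ ‖shift W s x - shift W s y‖ + ‖s • (W x - W y)‖ := by
          conv_lhs => rw [this]
          exact norm_add_le _ _
      _ = _ := by rw [norm_smul, Real.norm_of_nonneg hs]
  have h2 : s * dist (W x) (W y) ≤ s * (L * dist x y) :=
    mul_le_mul_of_nonneg_left (hW.dist_le_mul x y) hs
  linarith

lemma continuous_shift {W : Eu d → Eu d} (hW : Continuous W) (s : ℝ) : Continuous (shift W s) := by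
  unfold shift; fun_prop

/-- Since `W` vanishes outside `Ω` and `x ↦ x - s W(x)` is injective, this map takes `Ω` to `Ω`. -/
lemma shift_mem {W : Eu d → Eu d} {L : NNReal} (hW : LipschitzWith L W)
    (hW0 : ∀ x ∉ Ω, W x = 0) {s : ℝ} (hs : 0 ≤ s) (hsL : s * L < 1) {x : Eu d} (hx : x ∈ Ω) :
    shift W s x ∈ Ω := by
  by_contra h
  have h1 : shift W s (shift W s x) = shift W s x := by
    conv_lhs => rw [shift, hW0 _ h]
    simp
  exact h (by rwa [(antilipschitz_shift hW hs hsL).injective h1])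

lemma volume_preimage_le {X : Eu d → Eu d} {K : NNReal} (hX : AntilipschitzWith K X)
    (s : Set (Eu d)) : volume (X ⁻¹' s) ≤ (K : ℝ≥0∞) ^ d * volume s := by
  have h := Measure.isAddLeftInvariant_eq_smul (volume : Measure (Eu d))
    (Measure.hausdorffMeasure (d : ℝ))
  rw [h]
  have h1 := hX.hausdorffMeasure_preimage_le (d := d) (Nat.cast_nonneg d) s
  rw [ENNReal.rpow_natCast] at h1
  simp only [Measure.smul_apply, ENNReal.smul_def, smul_eq_mul]
  rw [mul_left_comm]
  gcongr

lemma map_restrict_le {X : Eu d → Eu d} {K : NNReal} (hX : AntilipschitzWith K X)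
    (hc : Continuous X) (hm : ∀ x ∈ Ω, X x ∈ Ω) :
    ((volume : Measure (Eu d)).restrict Ω).map X
      ≤ ((K : ℝ≥0∞) ^ d) • (volume : Measure (Eu d)).restrict Ω := by
  refine Measure.le_iff.2 fun s hs => ?_
  rw [Measure.map_apply hc.measurable hs, Measure.smul_apply, smul_eq_mul,
    Measure.restrict_apply hs, Measure.restrict_apply (hc.measurable hs)]
  calc volume (X ⁻¹' s ∩ Ω) ≤ volume (X ⁻¹' (s ∩ Ω)) :=
        measure_mono fun x hx => ⟨hx.1, hm x hx.2⟩
    _ ≤ _ := volume_preimage_le hX _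

lemma quasiMeasurePreserving_of_map_le {X : Eu d → Eu d} (hc : Continuous X) {c : ℝ≥0∞}
    (hX : ((volume : Measure (Eu d)).restrict Ω).map X
      ≤ c • (volume : Measure (Eu d)).restrict Ω) :
    Measure.QuasiMeasurePreserving X (volume.restrict Ω) (volume.restrict Ω) :=
  ⟨hc.measurable, (Measure.absolutelyContinuous_of_le hX).trans
    (Measure.smul_absolutelyContinuous)⟩

lemma lintegral_comp_le {X : Eu d → Eu d} (hc : Continuous X) {c : ℝ≥0∞}
    (hX : ((volume : Measure (Eu d)).restrict Ω).map X
      ≤ c • (volume : Measure (Eu d)).restrict Ω) {g : Eu d → ℝ≥0∞}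
    (hg : AEMeasurable g (volume.restrict Ω)) :
    ∫⁻ x in Ω, g (X x) ≤ c * ∫⁻ x in Ω, g x := by
  have hac := (quasiMeasurePreserving_of_map_le hc hX).absolutelyContinuous
  rw [← lintegral_map' (hg.mono_ac hac) hc.aemeasurable]
  refine (lintegral_mono' hX le_rfl).trans_eq ?_
  rw [lintegral_smul_measure, smul_eq_mul]

end

/-! ### Taylor expansion along the flow map -/

section
variable {F : Type} [NormedAddCommGroup F] [NormedSpace ℝ F] [CompleteSpace F]

lemma enorm_sub_le_lintegral_deriv {f f' : ℝ → F} (hf : ∀ σ ∈ Icc (0 : ℝ) 1, HasDerivAt f (f' σ) σ)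
    (hc : Continuous f') {τ : ℝ} (hτ : τ ∈ Icc (0 : ℝ) 1) :
    ‖f τ - f 0‖ₑ ≤ ∫⁻ σ in Icc (0 : ℝ) 1, ‖f' σ‖ₑ := by
  rw [← intervalIntegral.integral_eq_sub_of_hasDerivAt (f := f) (f' := f') (fun σ hσ => by
    rw [uIcc_of_le hτ.1] at hσ
    exact hf σ ⟨hσ.1, hσ.2.trans hτ.2⟩) (hc.intervalIntegrable _ _),
    intervalIntegral.integral_of_le hτ.1]
  exact (enorm_integral_le_lintegral_enorm _).trans
    (lintegral_mono_set (Ioc_subset_Icc_self.trans (Icc_subset_Icc_right hτ.2)))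

lemma enorm_taylor_le_lintegral_deriv {f f' f'' : ℝ → F}
    (hf : ∀ σ ∈ Icc (0 : ℝ) 1, HasDerivAt f (f' σ) σ)
    (hf' : ∀ σ ∈ Icc (0 : ℝ) 1, HasDerivAt f' (f'' σ) σ)
    (hc : Continuous f') (hc' : Continuous f'') :
    ‖f 1 - f 0 - f' 0‖ₑ ≤ ∫⁻ σ in Icc (0 : ℝ) 1, ‖f'' σ‖ₑ := by
  have h := enorm_sub_le_lintegral_deriv (f := fun σ => f σ - σ • f' 0)
    (f' := fun σ => f' σ - f' 0) (fun σ hσ => by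
      simpa using (hf σ hσ).fun_sub ((hasDerivAt_id' σ).smul_const (f' 0)))
    (hc.sub continuous_const) (τ := 1) (by simp)
  have h1 : f 1 - (1 : ℝ) • f' 0 - (f 0 - (0 : ℝ) • f' 0) = f 1 - f 0 - f' 0 := by
    simp only [one_smul, zero_smul, sub_zero]; abel
  rw [h1] at h
  refine h.trans ?_
  calc ∫⁻ σ in Icc (0 : ℝ) 1, ‖f' σ - f' 0‖ₑ
      ≤ ∫⁻ _ in Icc (0 : ℝ) 1, ∫⁻ σ in Icc (0 : ℝ) 1, ‖f'' σ‖ₑ :=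
        setLIntegral_mono' measurableSet_Icc fun σ hσ => enorm_sub_le_lintegral_deriv hf' hc' hσ
    _ = _ := by simp

/-- Fatou's lemma for bounds that hold eventually at almost every point. -/
lemma lintegral_le_of_tendsto {α : Type} [MeasurableSpace α] {μ : Measure α} {a : α → ℝ≥0∞}
    {b H : ℕ → α → ℝ≥0∞} {R : ℝ≥0∞} (hH : ∀ n, Measurable (H n))
    (hb : ∀ᵐ x ∂μ, Filter.Tendsto (fun n => b n x) Filter.atTop (nhds (a x)))
    (hbH : ∀ᵐ x ∂μ, ∀ᶠ n in Filter.atTop, b n x ≤ H n x) (hR : ∀ n, ∫⁻ x, H n x ∂μ ≤ R) :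
    ∫⁻ x, a x ∂μ ≤ R := by
  calc ∫⁻ x, a x ∂μ ≤ ∫⁻ x, Filter.liminf (fun n => H n x) Filter.atTop ∂μ := by
        refine lintegral_mono_ae ?_
        filter_upwards [hb, hbH] with x h1 h2
        rw [← h1.liminf_eq]
        exact Filter.liminf_le_liminf h2
    _ ≤ Filter.liminf (fun n => ∫⁻ x, H n x ∂μ) Filter.atTop := lintegral_liminf_le hH
    _ ≤ R := Filter.liminf_le_of_frequently_le' (Filter.Frequently.of_forall hR)

end

section
variable {d : ℕ} {Ω : Set (Eu d)} {F : Type} [NormedAddCommGroup F] [NormedSpace ℝ F]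
  [CompleteSpace F]

lemma lintegral_enorm_sq_Lp (f : LpΩ 2 Ω F) : ∫⁻ x in Ω, ‖f x‖ₑ ^ 2 = ‖f‖ₑ ^ 2 := by
  have h := eLpNorm_nnreal_pow_eq_lintegral (μ := (volume : Measure (Eu d)).restrict Ω)
    (f := f) (p := 2) two_ne_zero
  have e1 : ((2 : NNReal) : ℝ) = ((2 : ℕ) : ℝ) := by norm_num
  have e2 : ((2 : NNReal) : ℝ≥0∞) = 2 := rfl
  rw [e1, e2] at h
  simp only [ENNReal.rpow_natCast] at h
  rw [Lp.enorm_def, h]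

lemma lintegral_indicator_sq (hΩ : IsOpen Ω) (f : LpΩ 2 Ω F) :
    ∫⁻ x, ‖Ω.indicator f x‖ₑ ^ 2 = ‖f‖ₑ ^ 2 := by
  rw [← lintegral_enorm_sq_Lp, ← lintegral_indicator hΩ.measurableSet]
  refine lintegral_congr fun x => ?_
  by_cases h : x ∈ Ω <;> simp [h]

lemma aestronglyMeasurable_indicator_Lp (hΩ : IsOpen Ω) (f : LpΩ 2 Ω F) :
    AEStronglyMeasurable (Ω.indicator f) :=
  (aestronglyMeasurable_indicator_iff hΩ.measurableSet).2 (Lp.aestronglyMeasurable f)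

/-- Derivative of a mollified Sobolev function along a line. -/
lemma hasDerivAt_moll_line (hΩ : IsOpen Ω) (hb : Bornology.IsBounded Ω) (n : ℕ)
    (v : Sob 1 2 Ω F) (x a : Eu d) {σ : ℝ}
    (hx : Metric.closedBall (x - σ • a) ((n : ℝ) + 1)⁻¹ ⊆ Ω) :
    HasDerivAt (fun σ : ℝ => moll n (Ω.indicator (val v)) (x - σ • a))
      (∑ i, -a i • moll n (Ω.indicator (pd i v)) (x - σ • a)) σ := by
  have h1 : HasDerivAt (fun σ : ℝ => x - σ • a) (-a) σ := by
    simpa using ((hasDerivAt_id σ).smul_const a).const_sub x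
  have h2 := (hasFDerivAt_moll_interior hΩ hb n v hx).comp_hasDerivAt σ h1
  have h3 : (∑ i, (EuclideanSpace.proj i : Eu d →L[ℝ] ℝ).smulRight
      (moll n (Ω.indicator (pd i v)) (x - σ • a))) (-a)
      = ∑ i, -a i • moll n (Ω.indicator (pd i v)) (x - σ • a) := by
    simp [sum_apply]
  rw [h3] at h2
  exact h2

lemma continuous_moll_line (hΩ : IsOpen Ω) (hb : Bornology.IsBounded Ω) (n : ℕ)
    (f : LpΩ 2 Ω F) (x a : Eu d) :
    Continuous fun σ : ℝ => moll n (Ω.indicator f) (x - σ • a) :=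
  (continuous_moll n (locallyIntegrable_indicator hΩ hb f)).comp (by fun_prop)

/-- A Lipschitz vector field `W` that vanishes outside `Ω` and is bounded by `B` in `Ω`, and a step
size `δ` so small that the maps `x ↦ x - σ δ W(x)`, `0 ≤ σ ≤ 1`, are injective, take `Ω` to itself
and compress volumes by at most the factor `2 ^ d`. -/
structure IsTransport (Ω : Set (Eu d)) (W : Eu d → Eu d) (L : NNReal) (B δ : ℝ) : Prop where
  lip : LipschitzWith L W
  zero : ∀ x ∉ Ω, W x = 0
  bound : ∀ᵐ x ∂((volume : Measure (Eu d)).restrict Ω), ‖W x‖ ≤ B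
  nonneg : 0 ≤ δ
  small : δ * L ≤ 1 / 4

lemma IsTransport.mul_lt_one {W : Eu d → Eu d} {L : NNReal} {B δ : ℝ} (h : IsTransport Ω W L B δ)
    {σ : ℝ} (hσ : σ ∈ Icc (0 : ℝ) 1) : 0 ≤ σ * δ ∧ σ * δ * L ≤ 1 / 4 := by
  refine ⟨mul_nonneg hσ.1 h.nonneg, ?_⟩
  have h1 : 0 ≤ δ * L := mul_nonneg h.nonneg L.2
  rw [mul_assoc]
  exact (mul_le_of_le_one_left h1 hσ.2).trans h.small

lemma IsTransport.mem {W : Eu d → Eu d} {L : NNReal} {B δ : ℝ} (h : IsTransport Ω W L B δ)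
    {σ : ℝ} (hσ : σ ∈ Icc (0 : ℝ) 1) {x : Eu d} (hx : x ∈ Ω) : shift W (σ * δ) x ∈ Ω :=
  shift_mem h.lip h.zero (h.mul_lt_one hσ).1 (by linarith [(h.mul_lt_one hσ).2]) hx

lemma IsTransport.map_le {W : Eu d → Eu d} {L : NNReal} {B δ : ℝ} (h : IsTransport Ω W L B δ)
    {σ : ℝ} (hσ : σ ∈ Icc (0 : ℝ) 1) :
    ((volume : Measure (Eu d)).restrict Ω).map (shift W (σ * δ))
      ≤ (ENNReal.ofReal (1 - σ * δ * L)⁻¹ ^ d) • (volume : Measure (Eu d)).restrict Ω :=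
  map_restrict_le (antilipschitz_shift h.lip (h.mul_lt_one hσ).1
    (by linarith [(h.mul_lt_one hσ).2])) (continuous_shift h.lip.continuous _) fun _ hx => h.mem hσ hx

lemma IsTransport.lintegral_le {W : Eu d → Eu d} {L : NNReal} {B δ : ℝ}
    (h : IsTransport Ω W L B δ) {σ : ℝ} (hσ : σ ∈ Icc (0 : ℝ) 1) {g : Eu d → ℝ≥0∞}
    (hg : AEMeasurable g (volume.restrict Ω)) :
    ∫⁻ x in Ω, g (shift W (σ * δ) x) ≤ 2 ^ d * ∫⁻ x in Ω, g x := by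
  refine (lintegral_comp_le (continuous_shift h.lip.continuous _) (h.map_le hσ) hg).trans ?_
  gcongr
  rw [← ENNReal.ofReal_ofNat 2]
  refine ENNReal.ofReal_le_ofReal ?_
  have := (h.mul_lt_one hσ).2
  rw [inv_le_comm₀ (by linarith) (by norm_num)]
  linarith

/-- The integral of `‖ρ_n * f‖²` along the segments from `x` to `x - δ W(x)`. -/
def lineSq (n : ℕ) (W : Eu d → Eu d) (δ : ℝ) (f : Eu d → F) (x : Eu d) : ℝ≥0∞ :=
  ∫⁻ σ in Icc (0 : ℝ) 1, ‖moll n f (shift W (σ * δ) x)‖ₑ ^ 2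

lemma measurable_line {W : Eu d → Eu d} (hW : Continuous W) (δ : ℝ) {g : Eu d → F}
    (hg : Continuous g) :
    Measurable fun z : Eu d × ℝ => ‖g (shift W (z.2 * δ) z.1)‖ₑ ^ 2 := by
  have : Continuous fun z : Eu d × ℝ => g (shift W (z.2 * δ) z.1) := by
    unfold shift; fun_prop
  exact this.enorm.measurable.pow_const 2

lemma measurable_lineSq (hΩ : IsOpen Ω) (hb : Bornology.IsBounded Ω) (n : ℕ) {W : Eu d → Eu d}
    (hW : Continuous W) (δ : ℝ) (f : LpΩ 2 Ω F) :
    Measurable (lineSq n W δ (Ω.indicator f)) :=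
  (measurable_line hW δ (continuous_moll n (locallyIntegrable_indicator hΩ hb f))).lintegral_prod_right'

lemma IsTransport.lintegral_lineSq_le (hΩ : IsOpen Ω) (hb : Bornology.IsBounded Ω)
    {W : Eu d → Eu d} {L : NNReal} {B δ : ℝ} (h : IsTransport Ω W L B δ) (n : ℕ) (f : LpΩ 2 Ω F) :
    ∫⁻ x in Ω, lineSq n W δ (Ω.indicator f) x ≤ 2 ^ d * ‖f‖ₑ ^ 2 := by
  have hc := continuous_moll n (locallyIntegrable_indicator hΩ hb f)
  unfold lineSq
  rw [lintegral_lintegral_swap (measurable_line h.lip.continuous δ hc).aemeasurable]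
  calc _ ≤ ∫⁻ _ in Icc (0 : ℝ) 1, 2 ^ d * ‖f‖ₑ ^ 2 := by
        refine setLIntegral_mono' measurableSet_Icc fun σ hσ => ?_
        refine (h.lintegral_le hσ (g := fun x => ‖moll n (Ω.indicator f) x‖ₑ ^ 2)
          (hc.enorm.measurable.pow_const 2).aemeasurable).trans ?_
        gcongr
        rw [← lintegral_indicator_sq hΩ f]
        exact (setLIntegral_le_lintegral _ _).trans
          (lintegral_moll_sq_le n (aestronglyMeasurable_indicator_Lp hΩ f))
    _ = _ := by simp

lemma enorm_sum_smul_sq_le (a : Eu d) (g : Fin d → F) :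
    ‖∑ i, -a i • g i‖ₑ ^ 2 ≤ ‖a‖ₑ ^ 2 * ∑ i, ‖g i‖ₑ ^ 2 := by
  have h1 : ‖∑ i, -a i • g i‖ ^ 2 ≤ ‖a‖ ^ 2 * ∑ i, ‖g i‖ ^ 2 := by
    calc ‖∑ i, -a i • g i‖ ^ 2 ≤ (∑ i, ‖a i‖ * ‖g i‖) ^ 2 := by
          gcongr
          exact (norm_sum_le _ _).trans (Finset.sum_le_sum fun i _ => by rw [norm_smul, norm_neg])
      _ ≤ (∑ i, ‖a i‖ ^ 2) * ∑ i, ‖g i‖ ^ 2 := Finset.sum_mul_sq_le_sq_mul_sq _ _ _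
      _ = _ := by rw [EuclideanSpace.norm_sq_eq]
  have h2 := ENNReal.ofReal_le_ofReal h1
  rw [ENNReal.ofReal_mul (by positivity), ENNReal.ofReal_sum_of_nonneg fun _ _ => by positivity] at h2
  simpa only [ENNReal.ofReal_pow (norm_nonneg _), ofReal_norm] using h2

/-- For large `n` the mollification near the segment from `x` to `x - δ W(x)` involves values in
`Ω` only. -/
lemma IsTransport.eventually_closedBall (hΩ : IsOpen Ω) {W : Eu d → Eu d} {L : NNReal} {B δ : ℝ}
    (h : IsTransport Ω W L B δ) {x : Eu d} (hx : x ∈ Ω) :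
    ∀ᶠ n : ℕ in Filter.atTop, ∀ σ ∈ Icc (0 : ℝ) 1,
      Metric.closedBall (x - σ • (δ • W x)) ((n : ℝ) + 1)⁻¹ ⊆ Ω := by
  set γ : ℝ → Eu d := fun σ => x - σ • (δ • W x) with hγ
  have hγc : Continuous γ := continuous_const.sub (continuous_id.smul continuous_const)
  have hγΩ : γ '' Icc 0 1 ⊆ Ω := by
    rintro _ ⟨σ, hσ, rfl⟩
    have h1 := h.mem hσ hx
    rwa [shift, mul_smul] at h1
  obtain ⟨ε, hε, hε'⟩ := (isCompact_Icc.image hγc).exists_cthickening_subset_open hΩ hγΩ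
  filter_upwards [tendsto_radius.eventually_lt_const hε] with n hn σ hσ
  refine subset_trans ?_ hε'
  refine (Metric.closedBall_subset_closedBall hn.le).trans ?_
  exact Metric.closedBall_subset_cthickening (mem_image_of_mem γ hσ) ε

/-- First order estimate for the transport by `W` of a function in `H^1`. It is the limit, by Fatou's
lemma, of the estimate for mollifications. The radius for which these are differentiable along the
segment from `x` to `x - δ W(x)` depends on `x`, but the integrable bounds `lineSq` do not need it
to be small. -/
lemma IsTransport.lintegral_sub_sq_le (hΩ : IsOpen Ω) (hb : Bornology.IsBounded Ω)
    {W : Eu d → Eu d} {L : NNReal} {B δ : ℝ} (h : IsTransport Ω W L B δ) (v : Sob 1 2 Ω F) :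
    ∫⁻ x in Ω, ‖val v (shift W δ x) - val v x‖ₑ ^ 2
      ≤ ENNReal.ofReal (δ * B) ^ 2 * (2 ^ d * ∑ i, ‖pd i v‖ₑ ^ 2) := by
  have h1 : (1 : ℝ) ∈ Icc (0 : ℝ) 1 := by simp
  have hlim := ae_tendsto_moll (locallyIntegrable_indicator hΩ hb (val v))
  have hq := quasiMeasurePreserving_of_map_le (continuous_shift h.lip.continuous _) (h.map_le h1)
  refine lintegral_le_of_tendsto
    (b := fun n x => ‖moll n (Ω.indicator (val v)) (shift W δ x)
      - moll n (Ω.indicator (val v)) x‖ₑ ^ 2)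
    (H := fun n x => ENNReal.ofReal (δ * B) ^ 2
      * ∑ i, lineSq n W δ (Ω.indicator (pd i v)) x) ?_ ?_ ?_ ?_
  · intro n
    exact (Finset.measurable_fun_sum _ fun i _ =>
      measurable_lineSq hΩ hb n h.lip.continuous δ (pd i v)).const_mul _
  · have hlim' := ae_restrict_of_ae (s := Ω) hlim
    have hlim2 := hq.ae hlim'
    simp only [one_mul] at hlim2
    filter_upwards [hlim', hlim2, ae_restrict_mem hΩ.measurableSet] with x hx hx2 hxΩ
    have hm := h.mem h1 hxΩ
    rw [one_mul] at hm
    rw [indicator_of_mem hxΩ] at hx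
    rw [indicator_of_mem hm] at hx2
    exact ((ENNReal.continuous_pow 2).tendsto _).comp
      (((continuous_enorm).tendsto _).comp (hx2.sub hx))
  · filter_upwards [h.bound, ae_restrict_mem hΩ.measurableSet] with x hx hxΩ
    filter_upwards [h.eventually_closedBall hΩ hxΩ] with n hn
    have ha : ‖δ • W x‖ₑ ≤ ENNReal.ofReal (δ * B) := by
      rw [← ofReal_norm, norm_smul, Real.norm_of_nonneg h.nonneg]
      exact ENNReal.ofReal_le_ofReal (mul_le_mul_of_nonneg_left hx h.nonneg)
    have hcont : Continuous fun σ : ℝ => ∑ i, -(δ • W x) i •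
        moll n (Ω.indicator (pd i v)) (x - σ • (δ • W x)) :=
      continuous_finsetSum _ fun i _ =>
        (continuous_moll_line hΩ hb n (pd i v) x (δ • W x)).const_smul _
    have hkey := enorm_sub_le_lintegral_deriv
      (fun σ hσ => hasDerivAt_moll_line hΩ hb n v x (δ • W x) (hn σ hσ)) hcont h1
    simp only [one_smul, zero_smul, sub_zero] at hkey
    calc _ ≤ (∫⁻ σ in Icc (0 : ℝ) 1, ‖∑ i, -(δ • W x) i •
            moll n (Ω.indicator (pd i v)) (x - σ • (δ • W x))‖ₑ) ^ 2 := by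
          gcongr
          exact hkey
      _ ≤ ∫⁻ σ in Icc (0 : ℝ) 1, ‖∑ i, -(δ • W x) i •
            moll n (Ω.indicator (pd i v)) (x - σ • (δ • W x))‖ₑ ^ 2 := by
          refine (sq_lintegral_le _ hcont.enorm.measurable.aemeasurable).trans_eq ?_
          simp
      _ ≤ ∫⁻ σ in Icc (0 : ℝ) 1, ENNReal.ofReal (δ * B) ^ 2 * ∑ i,
            ‖moll n (Ω.indicator (pd i v)) (x - σ • (δ • W x))‖ₑ ^ 2 := by
          refine lintegral_mono fun σ => ?_
          refine (enorm_sum_smul_sq_le _ _).trans ?_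
          gcongr
      _ = _ := by
          rw [lintegral_const_mul _ (Finset.measurable_fun_sum _ fun i _ =>
            (continuous_moll_line hΩ hb n (pd i v) x (δ • W x)).enorm.measurable.pow_const 2),
            lintegral_finsetSum _ fun i _ =>
            (continuous_moll_line hΩ hb n (pd i v) x (δ • W x)).enorm.measurable.pow_const 2]
          simp only [lineSq, shift, smul_smul]
  · intro n
    rw [lintegral_const_mul _ (Finset.measurable_fun_sum _ fun i _ =>
      measurable_lineSq hΩ hb n h.lip.continuous δ (pd i v)), lintegral_finsetSum _ fun i _ =>
      measurable_lineSq hΩ hb n h.lip.continuous δ (pd i v), Finset.mul_sum Finset.univ _ (2 ^ d)]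
    gcongr with i _
    exact h.lintegral_lineSq_le hΩ hb n (pd i v)

/-- Second order estimate for the transport by `W` of a function in `H^2`. -/
lemma IsTransport.lintegral_taylor_sq_le (hΩ : IsOpen Ω) (hb : Bornology.IsBounded Ω)
    {W : Eu d → Eu d} {L : NNReal} {B δ : ℝ} (h : IsTransport Ω W L B δ) (v : Sob 2 2 Ω F) :
    ∫⁻ x in Ω, ‖val v (shift W δ x) - val v x
        + ∑ i, (δ • W x) i • pd i (resSob one_le_two v) x‖ₑ ^ 2
      ≤ ENNReal.ofReal (δ * B) ^ 4 * (2 ^ d * ∑ i, ∑ j, ‖v.1 (idx2 i j)‖ₑ ^ 2) := by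
  have h1 : (1 : ℝ) ∈ Icc (0 : ℝ) 1 := by simp
  choose V hV hV' using exists_pd_Sob_two v
  have hlim := ae_tendsto_moll (locallyIntegrable_indicator hΩ hb (val v))
  have hlimV := ae_all_iff.2 fun i => ae_tendsto_moll (locallyIntegrable_indicator hΩ hb (val (V i)))
  have hq := quasiMeasurePreserving_of_map_le (continuous_shift h.lip.continuous _) (h.map_le h1)
  refine lintegral_le_of_tendsto
    (b := fun n x => ‖moll n (Ω.indicator (val v)) (shift W δ x)
      - moll n (Ω.indicator (val v)) x
      + ∑ i, (δ • W x) i • moll n (Ω.indicator (val (V i))) x‖ₑ ^ 2)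
    (H := fun n x => ENNReal.ofReal (δ * B) ^ 4
      * ∑ i, ∑ j, lineSq n W δ (Ω.indicator (v.1 (idx2 i j))) x) ?_ ?_ ?_ ?_
  · intro n
    exact (Finset.measurable_fun_sum _ fun i _ => Finset.measurable_fun_sum _ fun j _ =>
      measurable_lineSq hΩ hb n h.lip.continuous δ _).const_mul _
  · have hlim' := ae_restrict_of_ae (s := Ω) hlim
    have hlim2 := hq.ae hlim'
    simp only [one_mul] at hlim2
    filter_upwards [hlim', hlim2, ae_restrict_mem hΩ.measurableSet,
      ae_restrict_of_ae (s := Ω) hlimV] with x hx hx2 hxΩ hx3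
    have hm := h.mem h1 hxΩ
    rw [one_mul] at hm
    simp only [indicator_of_mem hxΩ, hV] at hx hx3
    rw [indicator_of_mem hm] at hx2
    have h3 := tendsto_finsetSum Finset.univ fun i _ => (hx3 i).const_smul ((δ • W x) i)
    exact ((ENNReal.continuous_pow 2).tendsto _).comp
      (((continuous_enorm).tendsto _).comp ((hx2.sub hx).add (by simpa only [hV] using h3)))
  · filter_upwards [h.bound, ae_restrict_mem hΩ.measurableSet] with x hx hxΩ
    filter_upwards [h.eventually_closedBall hΩ hxΩ] with n hn
    set a := δ • W x with ha_def
    have ha : ‖a‖ₑ ≤ ENNReal.ofReal (δ * B) := by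
      rw [← ofReal_norm, norm_smul, Real.norm_of_nonneg h.nonneg]
      exact ENNReal.ofReal_le_ofReal (mul_le_mul_of_nonneg_left hx h.nonneg)
    have hcont : Continuous fun σ : ℝ => ∑ i, -a i •
        moll n (Ω.indicator (val (V i))) (x - σ • a) :=
      continuous_finsetSum _ fun i _ =>
        (continuous_moll_line hΩ hb n (val (V i)) x a).const_smul _
    have hcont2 : Continuous fun σ : ℝ => ∑ i, -a i • ∑ j, -a j •
        moll n (Ω.indicator (v.1 (idx2 i j))) (x - σ • a) :=
      continuous_finsetSum _ fun i _ => (continuous_finsetSum _ fun j _ =>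
        (continuous_moll_line hΩ hb n (v.1 (idx2 i j)) x a).const_smul _).const_smul _
    have hkey := enorm_taylor_le_lintegral_deriv
      (f := fun σ : ℝ => moll n (Ω.indicator (val v)) (x - σ • a))
      (f' := fun σ : ℝ => ∑ i, -a i • moll n (Ω.indicator (val (V i))) (x - σ • a))
      (f'' := fun σ : ℝ => ∑ i, -a i • ∑ j, -a j •
        moll n (Ω.indicator (v.1 (idx2 i j))) (x - σ • a))
      (fun σ hσ => by
        have := hasDerivAt_moll_line hΩ hb n (resSob one_le_two v) x a (hn σ hσ)
        simpa only [val_resSob, ← hV] using this)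
      (fun σ hσ => by
        refine HasDerivAt.fun_sum fun i _ => ?_
        have := (hasDerivAt_moll_line hΩ hb n (V i) x a (hn σ hσ)).const_smul (-a i)
        simp only [hV'] at this
        exact this) hcont hcont2
    simp only [one_smul, zero_smul, sub_zero] at hkey
    have e1 : moll n (Ω.indicator (val v)) (x - a) - moll n (Ω.indicator (val v)) x
        - ∑ i, -a i • moll n (Ω.indicator (val (V i))) x
        = moll n (Ω.indicator (val v)) (shift W δ x) - moll n (Ω.indicator (val v)) x
        + ∑ i, a i • moll n (Ω.indicator (val (V i))) x := by
      simp only [neg_smul, Finset.sum_neg_distrib, sub_neg_eq_add]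
      rfl
    rw [e1] at hkey
    calc _ ≤ (∫⁻ σ in Icc (0 : ℝ) 1, ‖∑ i, -a i • ∑ j, -a j •
            moll n (Ω.indicator (v.1 (idx2 i j))) (x - σ • a)‖ₑ) ^ 2 := by
          gcongr
      _ ≤ ∫⁻ σ in Icc (0 : ℝ) 1, ‖∑ i, -a i • ∑ j, -a j •
            moll n (Ω.indicator (v.1 (idx2 i j))) (x - σ • a)‖ₑ ^ 2 := by
          refine (sq_lintegral_le _ hcont2.enorm.measurable.aemeasurable).trans_eq ?_
          simp
      _ ≤ ∫⁻ σ in Icc (0 : ℝ) 1, ENNReal.ofReal (δ * B) ^ 4 * ∑ i, ∑ j,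
            ‖moll n (Ω.indicator (v.1 (idx2 i j))) (x - σ • a)‖ₑ ^ 2 := by
          refine lintegral_mono fun σ => ?_
          calc _ ≤ ‖a‖ₑ ^ 2 * ∑ i, ‖∑ j, -a j •
                moll n (Ω.indicator (v.1 (idx2 i j))) (x - σ • a)‖ₑ ^ 2 :=
                enorm_sum_smul_sq_le _ _
            _ ≤ ‖a‖ₑ ^ 2 * ∑ i, ‖a‖ₑ ^ 2 * ∑ j,
                ‖moll n (Ω.indicator (v.1 (idx2 i j))) (x - σ • a)‖ₑ ^ 2 := by
                gcongr with i _
                exact enorm_sum_smul_sq_le _ _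
            _ = ‖a‖ₑ ^ 4 * ∑ i, ∑ j,
                ‖moll n (Ω.indicator (v.1 (idx2 i j))) (x - σ • a)‖ₑ ^ 2 := by
                rw [← Finset.mul_sum, ← mul_assoc, ← pow_add]
            _ ≤ _ := by gcongr
      _ = _ := by
          have hm : ∀ i j, Measurable fun σ : ℝ =>
              ‖moll n (Ω.indicator (v.1 (idx2 i j))) (x - σ • a)‖ₑ ^ 2 := fun i j =>
            (continuous_moll_line hΩ hb n (v.1 (idx2 i j)) x a).enorm.measurable.pow_const 2
          rw [lintegral_const_mul _ (Finset.measurable_fun_sum _ fun i _ =>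
            Finset.measurable_fun_sum _ fun j _ => hm i j),
            lintegral_finsetSum _ fun i _ => Finset.measurable_fun_sum _ fun j _ => hm i j]
          simp only [lintegral_finsetSum _ fun j _ => hm _ j]
          simp only [lineSq, shift, smul_smul, ha_def]
  · intro n
    have hm : ∀ i j, Measurable fun x => lineSq n W δ (Ω.indicator (v.1 (idx2 i j))) x :=
      fun i j => measurable_lineSq hΩ hb n h.lip.continuous δ _
    rw [lintegral_const_mul _ (Finset.measurable_fun_sum _ fun i _ =>
      Finset.measurable_fun_sum _ fun j _ => hm i j),
      lintegral_finsetSum _ fun i _ => Finset.measurable_fun_sum _ fun j _ => hm i j]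
    simp only [lintegral_finsetSum _ fun j _ => hm _ j, Finset.mul_sum]
    refine Finset.sum_le_sum fun i _ => Finset.sum_le_sum fun j _ => ?_
    gcongr
    exact h.lintegral_lineSq_le hΩ hb n _

end

/-! ### The transport operator and the convective term -/

section
variable {d : ℕ} {Ω : Set (Eu d)}

lemma norm_le_of_lintegral_sq_le {F : Type} [NormedAddCommGroup F] [NormedSpace ℝ F]
    [CompleteSpace F] {f : LpΩ 2 Ω F} {g : Eu d → F} (hfg : f =ᵐ[volume.restrict Ω] g) {R : ℝ}
    (hR : 0 ≤ R) (h : ∫⁻ x in Ω, ‖g x‖ₑ ^ 2 ≤ ENNReal.ofReal (R ^ 2)) : ‖f‖ ≤ R := by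
  have h1 : ‖f‖ₑ ^ 2 ≤ ENNReal.ofReal (R ^ 2) := by
    rw [← lintegral_enorm_sq_Lp]
    refine le_trans (le_of_eq (lintegral_congr_ae ?_)) h
    filter_upwards [hfg] with x hx
    rw [hx]
  rw [← ofReal_norm, ← ENNReal.ofReal_pow (norm_nonneg _),
    ENNReal.ofReal_le_ofReal_iff (by positivity)] at h1
  exact (sq_le_sq₀ (norm_nonneg _) hR).1 h1

lemma enorm_sq_eq_ofReal {X : Type} [NormedAddCommGroup X] (x : X) :
    ‖x‖ₑ ^ 2 = ENNReal.ofReal (‖x‖ ^ 2) := by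
  rw [← ofReal_norm, ENNReal.ofReal_pow (norm_nonneg _)]

lemma ae_norm_le_norm_top {F : Type} [NormedAddCommGroup F] (f : LpΩ ∞ Ω F) :
    ∀ᵐ x ∂((volume : Measure (Eu d)).restrict Ω), ‖f x‖ ≤ ‖f‖ := by
  filter_upwards [ae_le_eLpNormEssSup (f := f) (μ := (volume : Measure (Eu d)).restrict Ω)]
    with x hx
  rw [← eLpNorm_exponent_top, ← Lp.enorm_def] at hx
  exact enorm_le_iff_norm_le.1 hx

lemma ofReal_pow_mul {a b : ℝ} (ha : 0 ≤ a) (m n : ℕ) :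
    ENNReal.ofReal a ^ m * (2 ^ n * ENNReal.ofReal b) = ENNReal.ofReal (a ^ m * (2 ^ n * b)) := by
  rw [ENNReal.ofReal_mul (by positivity), ENNReal.ofReal_mul (by positivity),
    ENNReal.ofReal_pow ha, ENNReal.ofReal_pow zero_le_two, ENNReal.ofReal_ofNat]

/-! ### The composition operator -/

/-- Composition with a transport map as a linear operator on `L^2`. -/
lemma IsTransport.exists_comp {W : Eu d → Eu d} {L : NNReal} {B δ : ℝ}
    (h : IsTransport Ω W L B δ) :
    ∃ C : LpΩ 2 Ω (Eu d) →ₗ[ℝ] LpΩ 2 Ω (Eu d),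
      (∀ f, C f =ᵐ[volume.restrict Ω] fun x => f (shift W δ x)) ∧
      ∀ f, ‖C f‖ ^ 2 ≤ (1 - δ * L)⁻¹ ^ d * ‖f‖ ^ 2 := by
  have h1 : (1 : ℝ) ∈ Icc (0 : ℝ) 1 := by simp
  have hmap := h.map_le h1
  rw [one_mul] at hmap
  have hc := continuous_shift h.lip.continuous δ
  have hq := quasiMeasurePreserving_of_map_le hc hmap
  have hpos : 0 < 1 - δ * L := by linarith [h.small]
  have hle : ∀ f : LpΩ 2 Ω (Eu d), ∫⁻ x in Ω, ‖f (shift W δ x)‖ₑ ^ 2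
      ≤ ENNReal.ofReal ((1 - δ * L)⁻¹ ^ d * ‖f‖ ^ 2) := fun f => by
    rw [ENNReal.ofReal_mul (by positivity), ENNReal.ofReal_pow (by positivity),
      ← enorm_sq_eq_ofReal, ← lintegral_enorm_sq_Lp]
    exact lintegral_comp_le hc hmap (g := fun x => ‖f x‖ₑ ^ 2)
      ((Lp.aestronglyMeasurable f).enorm.pow_const 2)
  have hmem : ∀ f : LpΩ 2 Ω (Eu d), MemLp (fun x => f (shift W δ x)) 2 (volume.restrict Ω) := by
    intro f
    refine ⟨(Lp.aestronglyMeasurable f).comp_quasiMeasurePreserving hq, ?_⟩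
    have h2 := eLpNorm_nnreal_pow_eq_lintegral (μ := (volume : Measure (Eu d)).restrict Ω)
      (f := fun x => f (shift W δ x)) (p := 2) two_ne_zero
    have e1 : ((2 : NNReal) : ℝ) = ((2 : ℕ) : ℝ) := by norm_num
    have e2 : ((2 : NNReal) : ℝ≥0∞) = 2 := rfl
    rw [e1, e2] at h2
    simp only [ENNReal.rpow_natCast] at h2
    have h3 := (hle f).trans_lt ENNReal.ofReal_lt_top
    rw [← h2] at h3
    by_contra hcon
    rw [not_lt, top_le_iff] at hcon
    rw [hcon] at h3
    simp at h3
  have hcoe : ∀ f : LpΩ 2 Ω (Eu d),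
      (hmem f).toLp _ =ᵐ[volume.restrict Ω] fun x => f (shift W δ x) :=
    fun f => (hmem f).coeFn_toLp
  refine ⟨{ toFun := fun f => (hmem f).toLp _, map_add' := ?_, map_smul' := ?_ }, hcoe, ?_⟩
  · intro f g
    refine Lp.ext ?_
    filter_upwards [hcoe (f + g), hcoe f, hcoe g, Lp.coeFn_add ((hmem f).toLp _) ((hmem g).toLp _),
      hq.ae (Lp.coeFn_add f g)] with x h1 h2 h3 h4 h5
    rw [h1, h4, h5, Pi.add_apply, Pi.add_apply, h2, h3]
  · intro c f
    refine Lp.ext ?_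
    filter_upwards [hcoe (c • f), hcoe f, Lp.coeFn_smul c ((hmem f).toLp _),
      hq.ae (Lp.coeFn_smul c f)] with x h1 h2 h3 h4
    simp only [RingHom.id_apply]
    rw [h1, h3, h4, Pi.smul_apply, Pi.smul_apply, h2]
  · intro f
    have h3 := hle f
    rw [← Real.sq_sqrt (by positivity : 0 ≤ (1 - δ * L)⁻¹ ^ d * ‖f‖ ^ 2)] at h3
    have h2 := norm_le_of_lintegral_sq_le (hcoe f) (Real.sqrt_nonneg _) h3
    calc _ ≤ √((1 - δ * L)⁻¹ ^ d * ‖f‖ ^ 2) ^ 2 := by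
          gcongr
          exact h2
      _ = _ := Real.sq_sqrt (by positivity)

/-! ### The convective term -/

lemma memLp_conv (w : LpΩ ∞ Ω (Eu d)) (u : Sob 1 2 Ω (Eu d)) :
    MemLp (fun x => ∑ i, w x i • pd i u x) 2 (volume.restrict Ω) := by
  refine memLp_finsetSum _ fun i _ => ?_
  have hi : MemLp (fun x => w x i) ∞ (volume.restrict Ω) :=
    (Lp.memLp w).of_le ((EuclideanSpace.proj i : Eu d →L[ℝ] ℝ).continuous.comp_aestronglyMeasurable
      (Lp.aestronglyMeasurable w)) (Filter.Eventually.of_forall fun x => PiLp.norm_apply_le (w x) i)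
  exact (Lp.memLp (pd i u)).smul (r := 2) hi

/-- The convective term `(w·∇)u` as an element of `L^2`. -/
def conv (w : LpΩ ∞ Ω (Eu d)) (u : Sob 1 2 Ω (Eu d)) : LpΩ 2 Ω (Eu d) := (memLp_conv w u).toLp _

lemma conv_ae (w : LpΩ ∞ Ω (Eu d)) (u : Sob 1 2 Ω (Eu d)) :
    conv w u =ᵐ[volume.restrict Ω] fun x => ∑ i, w x i • pd i u x := (memLp_conv w u).coeFn_toLp

lemma convInner_eq (w : Sob 1 ∞ Ω (Eu d)) (u v : Sob 1 2 Ω (Eu d)) :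
    convInner w u v = inner ℝ (conv (val w) u) (val v) := by
  rw [L2.inner_def]
  refine integral_congr_ae ?_
  filter_upwards [conv_ae (val w) u] with x hx
  rw [hx]

lemma conv_sub (w w' : LpΩ ∞ Ω (Eu d)) (u u' : Sob 1 2 Ω (Eu d)) :
    conv w u - conv w' u' = conv (w - w') u + conv w' (u - u') := by
  refine Lp.ext ?_
  have hpd : ∀ᵐ x ∂((volume : Measure (Eu d)).restrict Ω), ∀ i,
      pd i (u - u') x = pd i u x - pd i u' x := ae_all_iff.2 fun i => by
    rw [map_sub]; exact Lp.coeFn_sub _ _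
  filter_upwards [conv_ae w u, conv_ae w' u', conv_ae (w - w') u, conv_ae w' (u - u'), hpd,
    Lp.coeFn_sub (conv w u) (conv w' u'), Lp.coeFn_add (conv (w - w') u) (conv w' (u - u')),
    Lp.coeFn_sub w w'] with x h1 h2 h3 h4 h5 h6 h7 h8
  rw [h6, h7, Pi.sub_apply, Pi.add_apply, h1, h2, h3, h4, ← Finset.sum_sub_distrib,
    ← Finset.sum_add_distrib]
  refine Finset.sum_congr rfl fun i _ => ?_
  rw [h5, h8, Pi.sub_apply, PiLp.sub_apply, sub_smul, smul_sub]
  abel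

lemma sum_pd_sq_le (u : Sob 1 2 Ω (Eu d)) : ∑ i, ‖pd i u‖ₑ ^ 2 ≤ ENNReal.ofReal (‖u‖ ^ 2) := by
  simp only [enorm_sq_eq_ofReal]
  rw [← ENNReal.ofReal_sum_of_nonneg fun _ _ => by positivity]
  refine ENNReal.ofReal_le_ofReal ?_
  refine le_trans (le_of_eq ?_) (gradInner_self_le u)
  exact Finset.sum_congr rfl fun i _ => (real_inner_self_eq_norm_sq _).symm

lemma norm_conv_le (w : LpΩ ∞ Ω (Eu d)) (u : Sob 1 2 Ω (Eu d)) :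
    ‖conv w u‖ ≤ ‖w‖ * ‖u‖ := by
  refine norm_le_of_lintegral_sq_le (conv_ae w u) (by positivity) ?_
  calc ∫⁻ x in Ω, ‖∑ i, w x i • pd i u x‖ₑ ^ 2
      ≤ ∫⁻ x in Ω, ENNReal.ofReal (‖w‖ ^ 2) * ∑ i, ‖pd i u x‖ₑ ^ 2 := by
        refine lintegral_mono_ae ?_
        filter_upwards [ae_norm_le_norm_top w] with x hx
        have := enorm_sum_smul_sq_le (-(w x)) fun i => pd i u x
        simp only [PiLp.neg_apply, neg_neg, enorm_neg] at this
        refine this.trans ?_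
        gcongr
        rw [enorm_sq_eq_ofReal]
        exact ENNReal.ofReal_le_ofReal (by gcongr)
    _ = ENNReal.ofReal (‖w‖ ^ 2) * ∑ i, ‖pd i u‖ₑ ^ 2 := by
        rw [lintegral_const_mul' _ _ ENNReal.ofReal_ne_top, lintegral_finsetSum' _ fun i _ =>
          (Lp.aestronglyMeasurable (pd i u)).enorm.pow_const 2]
        simp only [lintegral_enorm_sq_Lp]
    _ ≤ ENNReal.ofReal (‖w‖ ^ 2) * ENNReal.ofReal (‖u‖ ^ 2) := by
        gcongr
        exact sum_pd_sq_le u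
    _ = _ := by rw [← ENNReal.ofReal_mul (by positivity), mul_pow]

/-! ### The seminorm of `W^{1,∞}` -/

lemma norm_val_top_le (w : Sob 1 ∞ Ω (Eu d)) : ‖val w‖ ≤ ‖w‖ := norm_comp_le w _

lemma sqrt_sum_pd_le (w : Sob 1 ∞ Ω (Eu d)) :
    ∀ᵐ x ∂((volume : Measure (Eu d)).restrict Ω), √(∑ j, ‖pd j w x‖ ^ 2) ≤ √d * ‖w‖ := by
  have h : ∀ᵐ x ∂((volume : Measure (Eu d)).restrict Ω), ∀ j, ‖pd j w x‖ ≤ ‖w‖ :=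
    ae_all_iff.2 fun j => (ae_norm_le_norm_top (pd j w)).mono fun x hx =>
      hx.trans (norm_pd_le j w)
  filter_upwards [h] with x hx
  rw [← Real.sqrt_sq (norm_nonneg w), ← Real.sqrt_mul (Nat.cast_nonneg d)]
  refine Real.sqrt_le_sqrt ?_
  calc ∑ j, ‖pd j w x‖ ^ 2 ≤ ∑ _j : Fin d, ‖w‖ ^ 2 := by
        gcongr with j _
        exact hx j
    _ = _ := by simp

lemma semiW_nonneg (w : Sob 1 ∞ Ω (Eu d)) : 0 ≤ semiW w := ENNReal.toReal_nonneg

lemma eLpNorm_semiW_le (w : Sob 1 ∞ Ω (Eu d)) :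
    eLpNorm (fun x => √(∑ j, ‖pd j w x‖ ^ 2)) ∞ (volume.restrict Ω)
      ≤ ENNReal.ofReal (√d * ‖w‖) := by
  rw [eLpNorm_exponent_top]
  refine eLpNormEssSup_le_of_ae_bound ?_
  filter_upwards [sqrt_sum_pd_le w] with x hx
  rwa [Real.norm_of_nonneg (Real.sqrt_nonneg _)]

lemma semiW_le (w : Sob 1 ∞ Ω (Eu d)) : semiW w ≤ √d * ‖w‖ :=
  ENNReal.toReal_le_of_le_ofReal (by positivity) (eLpNorm_semiW_le w)

lemma ae_le_semiW (w : Sob 1 ∞ Ω (Eu d)) :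
    ∀ᵐ x ∂((volume : Measure (Eu d)).restrict Ω), √(∑ j, ‖pd j w x‖ ^ 2) ≤ semiW w := by
  have h1 := ae_le_eLpNormEssSup (f := fun x => √(∑ j, ‖pd j w x‖ ^ 2))
    (μ := (volume : Measure (Eu d)).restrict Ω)
  rw [← eLpNorm_exponent_top] at h1
  filter_upwards [h1] with x hx
  have h2 := ENNReal.toReal_mono (ne_top_of_le_ne_top ENNReal.ofReal_ne_top (eLpNorm_semiW_le w)) hx
  rwa [toReal_enorm, Real.norm_of_nonneg (Real.sqrt_nonneg _)] at h2

/-! ### The transport operator of the scheme -/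

lemma one_add_pow_le {y : ℝ} (hy : 0 ≤ y) (hy1 : y ≤ 1) (d : ℕ) :
    (1 + y) ^ d ≤ 1 + y * (2 ^ d - 1) := by
  induction d with
  | zero => simp
  | succ n ih =>
    have h1 : (1 : ℝ) ≤ 2 ^ n := one_le_pow₀ (by norm_num)
    calc (1 + y) ^ (n + 1) = (1 + y) ^ n * (1 + y) := pow_succ _ _
      _ ≤ (1 + y * (2 ^ n - 1)) * (1 + y) := by gcongr
      _ ≤ 1 + y * (2 ^ (n + 1) - 1) := by
        have : y * (y * (2 ^ n - 1)) ≤ 1 * (y * (2 ^ n - 1)) := by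
          gcongr
        rw [pow_succ]
        nlinarith

/-- The constant in the estimates for the transport operator. -/
def κ (d : ℕ) (M : ℝ) : ℝ := 2 ^ (d + 1) * (d + 1) * (1 + M) ^ 2

/-- The operator `z ↦ z ∘ X_1(w)` on `L^2`: its relation to the form in the scheme, its stability, and
its consistency of first order for functions in `H^1` and of second order for functions in `H^2`. -/
lemma exists_transport (hΩ : IsOpen Ω) (hb : Bornology.IsBounded Ω)
    (hi : interior (closure Ω) = Ω) {M : ℝ} (hM : 0 ≤ M) {w : Sob 1 ∞ Ω (Eu d)} (hw : IsW0 w)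
    (hwM : ‖w‖ ≤ M) {Δt : ℝ} (hΔ : 0 < Δt) (hΔw : Δt * (4 * semiW w) ≤ 1) :
    ∃ C : LpΩ 2 Ω (Eu d) →ₗ[ℝ] LpΩ 2 Ω (Eu d),
      (∀ z v : Sob 1 2 Ω (Eu d), compInner Δt w z v = inner ℝ (C (val z)) (val v)) ∧
      (∀ f, ‖C f‖ ^ 2 ≤ (1 + κ d M * Δt) * ‖f‖ ^ 2) ∧
      (∀ v : Sob 1 2 Ω (Eu d), ‖C (val v) - val v‖ ≤ Δt * κ d M * ‖v‖) ∧
      (∀ g : Sob 2 2 Ω (Eu d), ‖val g - C (val g) - Δt • conv (val w) (resSob one_le_two g)‖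
        ≤ Δt ^ 2 * κ d M * ‖g‖) := by
  set L : NNReal := ⟨semiW w, semiW_nonneg w⟩ with hLdef
  obtain ⟨W, hWL, hW0, hwW⟩ := exists_lipschitz_representative hΩ hb hi w hw L (ae_le_semiW w)
  have hT : IsTransport Ω W L M Δt := by
    refine ⟨hWL, hW0, ?_, hΔ.le, ?_⟩
    · filter_upwards [hwW, ae_norm_le_norm_top (val w)] with x h1 h2
      rw [← h1]
      exact h2.trans ((norm_val_top_le w).trans hwM)
    · change Δt * semiW w ≤ 1 / 4
      linarith
  obtain ⟨C, hC, hC2⟩ := hT.exists_comp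
  have hd1 : (1 : ℝ) ≤ 2 ^ d := one_le_pow₀ (by norm_num)
  have hdn : (0 : ℝ) ≤ d := Nat.cast_nonneg d
  have hdd : √(d : ℝ) ≤ d + 1 := Real.sqrt_le_iff.2 ⟨by linarith, by nlinarith⟩
  have hκ1 : 2 * M * (d + 1) * 2 ^ d ≤ κ d M := by
    unfold κ
    calc _ = 2 ^ (d + 1) * (d + 1) * M := by ring
      _ ≤ _ := by gcongr; nlinarith
  have hκ2 : 2 ^ d * M ≤ κ d M := by
    refine le_trans ?_ hκ1
    have : 0 ≤ 2 ^ d * M := by positivity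
    nlinarith
  have hκ3 : 2 ^ d * M ^ 2 ≤ κ d M := by
    unfold κ
    calc (2 : ℝ) ^ d * M ^ 2 = 2 ^ d * 1 * M ^ 2 := by ring
      _ ≤ _ := by gcongr <;> linarith
  refine ⟨C, ?_, ?_, ?_, ?_⟩
  · intro z v
    rw [L2.inner_def]
    refine integral_congr_ae ?_
    filter_upwards [hC (val z), hwW] with x h1 h2
    rw [h1, X1, h2, shift]
  · intro f
    refine (hC2 f).trans ?_
    gcongr
    -- the compression factor `(1 - Δt L)^{-d}` is at most `(1 + 2 Δt L)^d`
    have h1 : 0 ≤ Δt * L := mul_nonneg hΔ.le L.2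
    have h2 := hT.small
    calc (1 - Δt * L)⁻¹ ^ d ≤ (1 + 2 * (Δt * L)) ^ d := by
          refine pow_le_pow_left₀ (inv_nonneg.2 (by linarith)) ?_ d
          rw [inv_le_iff_one_le_mul₀ (by linarith)]
          nlinarith
      _ ≤ 1 + 2 * (Δt * L) * (2 ^ d - 1) := one_add_pow_le (by linarith) (by linarith) d
      _ ≤ 1 + 2 * (Δt * ((d + 1) * M)) * 2 ^ d := by
          have : (L : ℝ) ≤ (d + 1) * M := by
            change semiW w ≤ _
            refine (semiW_le w).trans ?_
            gcongr
          gcongr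
          linarith
      _ = 1 + 2 * M * (d + 1) * 2 ^ d * Δt := by ring
      _ ≤ _ := by gcongr
  · intro v
    have hae : C (val v) - val v =ᵐ[volume.restrict Ω]
        fun x => val v (shift W Δt x) - val v x := by
      filter_upwards [hC (val v), Lp.coeFn_sub (C (val v)) (val v)] with x h1 h2
      rw [h2, Pi.sub_apply, h1]
    refine (norm_le_of_lintegral_sq_le hae (R := Δt * (2 ^ d * M) * ‖v‖) (by positivity) ?_).trans
      (by gcongr)
    refine (hT.lintegral_sub_sq_le hΩ hb v).trans ?_
    calc _ ≤ ENNReal.ofReal (Δt * M) ^ 2 * (2 ^ d * ENNReal.ofReal (‖v‖ ^ 2)) := by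
          gcongr
          exact sum_pd_sq_le v
      _ = ENNReal.ofReal ((Δt * M) ^ 2 * (2 ^ d * ‖v‖ ^ 2)) :=
          ofReal_pow_mul (by positivity) _ _
      _ ≤ _ := by
          refine ENNReal.ofReal_le_ofReal ?_
          calc (Δt * M) ^ 2 * (2 ^ d * ‖v‖ ^ 2) = 2 ^ d * (Δt * M * ‖v‖) ^ 2 := by ring
            _ ≤ (2 ^ d * 2 ^ d) * (Δt * M * ‖v‖) ^ 2 := by
                gcongr
                nlinarith
            _ = _ := by ring
  · intro g
    have hae : -(val g - C (val g) - Δt • conv (val w) (resSob one_le_two g))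
        =ᵐ[volume.restrict Ω] fun x => val g (shift W Δt x) - val g x
        + ∑ i, (Δt • W x) i • pd i (resSob one_le_two g) x := by
      have e : -(val g - C (val g) - Δt • conv (val w) (resSob one_le_two g))
          = C (val g) - val g + Δt • conv (val w) (resSob one_le_two g) := by abel
      rw [e]
      filter_upwards [hC (val g), Lp.coeFn_sub (C (val g)) (val g), hwW,
        Lp.coeFn_add (C (val g) - val g) (Δt • conv (val w) (resSob one_le_two g)),
        Lp.coeFn_smul Δt (conv (val w) (resSob one_le_two g)),
        conv_ae (val w) (resSob one_le_two g)] with x h1 h2 h3 h4 h5 h6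
      rw [h4, Pi.add_apply, h2, Pi.sub_apply, h1, h5, Pi.smul_apply, h6, h3, Finset.smul_sum]
      simp only [PiLp.smul_apply, smul_assoc]
    rw [← norm_neg]
    refine (norm_le_of_lintegral_sq_le hae (R := Δt ^ 2 * (2 ^ d * M ^ 2) * ‖g‖)
      (by positivity) ?_).trans (by gcongr)
    refine (hT.lintegral_taylor_sq_le hΩ hb g).trans ?_
    have hsum : ∑ i, ∑ j, ‖g.1 (idx2 i j)‖ₑ ^ 2 ≤ ENNReal.ofReal (‖g‖ ^ 2) := by
      simp only [enorm_sq_eq_ofReal]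
      rw [norm_sq_Sob]
      simp only [← ENNReal.ofReal_sum_of_nonneg fun _ _ => sq_nonneg _]
      rw [← ENNReal.ofReal_sum_of_nonneg fun _ _ => by positivity]
      refine ENNReal.ofReal_le_ofReal ?_
      have hinj : Function.Injective fun p : Fin d × Fin d => (idx2 p.1 p.2 : DIdx d 2) := by
        rintro ⟨a, b⟩ ⟨a', b'⟩ h
        simp only [idx2, Sigma.mk.injEq, heq_eq_eq, true_and] at h
        have h0 := congrFun h 0
        have h1 := congrFun h 1
        simp at h0 h1
        simp [h0, h1]
      calc ∑ i, ∑ j, ‖g.1 (idx2 i j)‖ ^ 2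
          = ∑ p : Fin d × Fin d, ‖g.1 (idx2 p.1 p.2)‖ ^ 2 := by
            rw [← Finset.univ_product_univ, Finset.sum_product]
        _ = ∑ α ∈ Finset.univ.map ⟨_, hinj⟩, ‖g.1 α‖ ^ 2 := by
            rw [Finset.sum_map]; rfl
        _ ≤ _ := Finset.sum_le_sum_of_subset_of_nonneg (Finset.subset_univ _)
            fun _ _ _ => by positivity
    calc _ ≤ ENNReal.ofReal (Δt * M) ^ 4 * (2 ^ d * ENNReal.ofReal (‖g‖ ^ 2)) := by
          gcongr
      _ = ENNReal.ofReal ((Δt * M) ^ 4 * (2 ^ d * ‖g‖ ^ 2)) :=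
          ofReal_pow_mul (by positivity) _ _
      _ ≤ _ := by
          refine ENNReal.ofReal_le_ofReal ?_
          calc (Δt * M) ^ 4 * (2 ^ d * ‖g‖ ^ 2) = 2 ^ d * (Δt ^ 2 * M ^ 2 * ‖g‖) ^ 2 := by ring
            _ ≤ (2 ^ d * 2 ^ d) * (Δt ^ 2 * M ^ 2 * ‖g‖) ^ 2 := by
                gcongr
                nlinarith
            _ = _ := by ring

end

/-! ### Functions of time -/

section
variable {X : Type} [NormedAddCommGroup X] [NormedSpace ℝ X] [CompleteSpace X] {T : ℝ}

lemma ker_real_eq_zero {n : ℕ} {x : ℝ} (hx : ((n : ℝ) + 1)⁻¹ < |x|) : ker ℝ n x = 0 := by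
  refine image_eq_zero_of_notMem_tsupport fun h => ?_
  rw [tsupport_ker, mem_closedBall_zero_iff, Real.norm_eq_abs] at h
  linarith

/-- A smooth approximation of the indicator function of the interval `(a,b)`. -/
def smoothInd (n : ℕ) (a b t : ℝ) : ℝ := ∫ x in (t - b)..(t - a), ker ℝ n x

lemma hasDerivAt_smoothInd (n : ℕ) (a b t : ℝ) :
    HasDerivAt (smoothInd n a b) (ker ℝ n (t - a) - ker ℝ n (t - b)) t := by
  have hc : Continuous (ker ℝ n) := (contDiff_ker n).continuous
  have h1 : ∀ s, smoothInd n a b s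
      = (∫ x in (0 : ℝ)..(s - a), ker ℝ n x) - ∫ x in (0 : ℝ)..(s - b), ker ℝ n x := fun s =>
    (intervalIntegral.integral_interval_sub_left (hc.intervalIntegrable _ _)
      (hc.intervalIntegrable _ _)).symm
  have h2 : ∀ c, HasDerivAt (fun s => ∫ x in (0 : ℝ)..(s - c), ker ℝ n x) (ker ℝ n (t - c)) t := by
    intro c
    have h3 : HasDerivAt (fun s : ℝ => s - c) 1 t := (hasDerivAt_id' t).sub_const c
    have h4 := (hc.integral_hasStrictDerivAt 0 (t - c)).hasDerivAt.comp t h3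
    rwa [mul_one] at h4
  have h5 := (h2 a).fun_sub (h2 b)
  rwa [← funext h1] at h5

lemma contDiff_smoothInd (n : ℕ) (a b : ℝ) : ContDiff ℝ ∞ (smoothInd n a b) := by
  rw [contDiff_infty_iff_deriv]
  refine ⟨fun t => (hasDerivAt_smoothInd n a b t).differentiableAt, ?_⟩
  have : deriv (smoothInd n a b) = fun t => ker ℝ n (t - a) - ker ℝ n (t - b) :=
    funext fun t => (hasDerivAt_smoothInd n a b t).deriv
  rw [this]
  exact ((contDiff_ker n).comp (contDiff_id.sub contDiff_const)).sub
    ((contDiff_ker n).comp (contDiff_id.sub contDiff_const))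

lemma norm_smoothInd_le {n : ℕ} {a b : ℝ} (hab : a ≤ b) (t : ℝ) : ‖smoothInd n a b t‖ ≤ 1 := by
  have h1 : t - b ≤ t - a := by linarith
  have h2 : 0 ≤ smoothInd n a b t :=
    intervalIntegral.integral_nonneg h1 fun x _ => ker_nonneg n x
  rw [Real.norm_of_nonneg h2, smoothInd, intervalIntegral.integral_of_le h1, ← integral_ker (E := ℝ) n]
  exact setIntegral_le_integral (mollBump ℝ n).integrable_normed
    (Filter.Eventually.of_forall (ker_nonneg n))

lemma smoothInd_eq_zero {n : ℕ} {a b t : ℝ} (hab : a ≤ b)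
    (ht : t < a - ((n : ℝ) + 1)⁻¹ ∨ b + ((n : ℝ) + 1)⁻¹ < t) : smoothInd n a b t = 0 := by
  have h0 : (0 : ℝ) < ((n : ℝ) + 1)⁻¹ := by positivity
  unfold smoothInd
  rw [intervalIntegral.integral_congr (g := fun _ => (0 : ℝ))]
  · simp
  · intro x hx
    rw [uIcc_of_le (by linarith)] at hx
    refine ker_real_eq_zero ?_
    rcases ht with ht | ht
    · exact lt_of_lt_of_le (by linarith [hx.2]) (neg_le_abs x)
    · exact lt_of_lt_of_le (by linarith [hx.1]) (le_abs_self x)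

lemma smoothInd_eq_one {n : ℕ} {a b t : ℝ} (h1 : a + ((n : ℝ) + 1)⁻¹ < t)
    (h2 : t < b - ((n : ℝ) + 1)⁻¹) : smoothInd n a b t = 1 := by
  have h0 : (0 : ℝ) < ((n : ℝ) + 1)⁻¹ := by positivity
  unfold smoothInd
  rw [intervalIntegral.integral_of_le (by linarith), ← integral_ker (E := ℝ) n]
  refine setIntegral_eq_integral_of_forall_compl_eq_zero fun x hx => ker_real_eq_zero ?_
  rw [mem_Ioc, not_and_or, not_lt, not_le] at hx
  rcases hx with hx | hx
  · exact lt_of_lt_of_le (by linarith) (neg_le_abs x)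
  · exact lt_of_lt_of_le (by linarith) (le_abs_self x)

/-- A function of time with an integrable weak derivative is a primitive of it: the weak derivative
is tested with smooth approximations of indicator functions of intervals. -/
lemma IsWeakTimeD.ae_eq_primitive (hT : 0 < T) {g g' : ℝ → X} (h : IsWeakTimeD T g g')
    (hg : IntegrableOn g (Ioo 0 T)) (hg' : IntegrableOn g' (Ioo 0 T)) :
    ∃ c, ∀ᵐ t ∂(volume.restrict (Ioo 0 T)), g t = c + ∫ s in (0 : ℝ)..t, g' s := by
  set γ : ℝ → X := (Ioo 0 T).indicator g
  have hγ : LocallyIntegrable γ :=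
    ((integrable_indicator_iff measurableSet_Ioo).2 hg).locallyIntegrable
  have hint : ∀ {a b : ℝ}, a ∈ Icc 0 T → b ∈ Icc 0 T → IntervalIntegrable g' volume a b := by
    intro a b ha hb
    rw [intervalIntegrable_iff]
    have h1 : IntegrableOn g' (Icc 0 T) := (integrableOn_Icc_iff_integrableOn_Ioo (by simp) (by simp)).2 hg'
    exact h1.mono_set (uIoc_subset_uIcc.trans (uIcc_subset_Icc ha hb))
  -- the fundamental theorem of calculus for the limits of the mollified function
  have key : ∀ a ∈ Ioo 0 T, ∀ b ∈ Ioo 0 T, a < b →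
      Filter.Tendsto (fun n => moll n γ a) Filter.atTop (nhds (g a)) →
      Filter.Tendsto (fun n => moll n γ b) Filter.atTop (nhds (g b)) →
      g b - g a = ∫ s in a..b, g' s := by
    intro a ha b hb hab hta htb
    have e1 : ∀ᶠ n : ℕ in Filter.atTop,
        moll n γ a - moll n γ b = -∫ t in Ioo 0 T, smoothInd n a b t • g' t := by
      filter_upwards [tendsto_radius.eventually_lt_const (lt_min ha.1 (sub_pos.2 hb.2))] with n hn
      obtain ⟨hn1, hn2⟩ := lt_min_iff.1 hn
      have hsupp : tsupport (smoothInd n a b) ⊆ Icc (a - ((n : ℝ) + 1)⁻¹) (b + ((n : ℝ) + 1)⁻¹) := by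
        refine closure_minimal (fun t ht => ?_) isClosed_Icc
        by_contra hcon
        rw [mem_Icc, not_and_or, not_le, not_le] at hcon
        exact ht (smoothInd_eq_zero hab.le hcon)
      rw [← h (smoothInd n a b) ⟨contDiff_smoothInd n a b,
        isCompact_Icc.of_isClosed_subset (isClosed_tsupport _) hsupp,
        hsupp.trans fun t ht => ⟨by linarith [ht.1], by linarith [ht.2]⟩⟩]
      have e2 : ∀ c, moll n γ c = ∫ t in Ioo 0 T, ker ℝ n (t - c) • g t := by
        intro c
        rw [moll, ← integral_indicator measurableSet_Ioo]
        congr 1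
        ext t
        rw [← neg_sub t c, ker_neg]
        by_cases ht : t ∈ Ioo 0 T <;> simp [γ, ht]
      have e3 : ∀ c, IntegrableOn (fun t => ker ℝ n (t - c) • g t) (Ioo 0 T) := by
        intro c
        have hc : Continuous fun t => ker ℝ n (t - c) :=
          (contDiff_ker n).continuous.comp (by fun_prop)
        obtain ⟨C, hC⟩ := (contDiff_ker n).continuous.bounded_above_of_compact_support
          (hasCompactSupport_ker (E := ℝ) n)
        exact hg.bdd_smul C hc.aestronglyMeasurable (Filter.Eventually.of_forall fun t => hC _)
      rw [e2, e2, ← integral_sub (e3 a) (e3 b)]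
      refine integral_congr_ae (Filter.Eventually.of_forall fun t => ?_)
      simp only [(hasDerivAt_smoothInd n a b t).deriv, sub_smul]
    have e4 : Filter.Tendsto (fun n : ℕ => ∫ t in Ioo 0 T, smoothInd n a b t • g' t)
        Filter.atTop (nhds (∫ t in Ioo 0 T, (Ioo a b).indicator g' t)) := by
      refine tendsto_integral_of_dominated_convergence (fun t => ‖g' t‖) (fun n => ?_) hg'.norm
        (fun n => ?_) ?_
      · exact (contDiff_smoothInd n a b).continuous.aestronglyMeasurable.smul
          hg'.aestronglyMeasurable
      · refine Filter.Eventually.of_forall fun t => ?_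
        rw [norm_smul]
        exact mul_le_of_le_one_left (norm_nonneg _) (norm_smoothInd_le hab.le t)
      · have hne : ∀ᵐ t ∂((volume : Measure ℝ).restrict (Ioo 0 T)), t ≠ a ∧ t ≠ b :=
          ae_restrict_of_ae ((Measure.ae_ne volume a).and (Measure.ae_ne volume b))
        filter_upwards [hne] with t ht
        refine tendsto_const_nhds.congr' ?_
        by_cases htab : t ∈ Ioo a b
        · filter_upwards [tendsto_radius.eventually_lt_const
            (lt_min (sub_pos.2 htab.1) (sub_pos.2 htab.2))] with n hn
          obtain ⟨hn1, hn2⟩ := lt_min_iff.1 hn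
          rw [smoothInd_eq_one (by linarith) (by linarith), indicator_of_mem htab, one_smul]
        · rw [indicator_of_notMem htab]
          rw [mem_Ioo, not_and_or, not_lt, not_lt] at htab
          have hpos : 0 < max (a - t) (t - b) := by
            rcases htab with h1 | h1
            · exact lt_max_of_lt_left (sub_pos.2 (lt_of_le_of_ne h1 ht.1))
            · exact lt_max_of_lt_right (sub_pos.2 (lt_of_le_of_ne h1 ht.2.symm))
          filter_upwards [tendsto_radius.eventually_lt_const hpos] with n hn
          rw [smoothInd_eq_zero hab.le, zero_smul]
          rcases lt_max_iff.1 hn with h1 | h1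
          · left; linarith
          · right; linarith
    have e5 : ∫ t in Ioo 0 T, (Ioo a b).indicator g' t = ∫ s in a..b, g' s := by
      rw [setIntegral_indicator measurableSet_Ioo, intervalIntegral.integral_of_le hab.le,
        integral_Ioc_eq_integral_Ioo,
        inter_eq_right.2 (Ioo_subset_Ioo ha.1.le hb.2.le)]
    have e6 := tendsto_nhds_unique ((hta.sub htb).congr' e1) e4.neg
    rw [← e5, ← neg_sub, e6, neg_neg]
  have hae : ∀ᵐ t ∂((volume : Measure ℝ).restrict (Ioo 0 T)), t ∈ Ioo 0 T ∧
      Filter.Tendsto (fun n => moll n γ t) Filter.atTop (nhds (g t)) := by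
    filter_upwards [ae_restrict_of_ae (ae_tendsto_moll hγ), ae_restrict_mem measurableSet_Ioo]
      with t h1 h2
    refine ⟨h2, ?_⟩
    have h3 : γ t = g t := indicator_of_mem h2 _
    rwa [h3] at h1
  have hne : NeZero ((volume : Measure ℝ).restrict (Ioo 0 T)) := ⟨by
    intro h0
    have := congrArg (fun μ : Measure ℝ => μ univ) h0
    simp [hT.not_ge] at this⟩
  obtain ⟨a, ha, hta⟩ := hae.exists
  refine ⟨g a - ∫ s in (0 : ℝ)..a, g' s, ?_⟩
  have h0T : (0 : ℝ) ∈ Icc 0 T := ⟨le_rfl, hT.le⟩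
  filter_upwards [hae] with t ht
  obtain ⟨ht, htt⟩ := ht
  have ha' := Ioo_subset_Icc_self ha
  have ht' := Ioo_subset_Icc_self ht
  have e : ∫ s in (0 : ℝ)..t, g' s = (∫ s in (0 : ℝ)..a, g' s) + ∫ s in a..t, g' s :=
    (intervalIntegral.integral_add_adjacent_intervals (hint h0T ha') (hint ha' ht')).symm
  have e2 : ∫ s in a..t, g' s = g t - g a := by
    rcases lt_trichotomy a t with hlt | heq | hgt
    · exact (key a ha t ht hlt hta htt).symm
    · rw [heq]; simp
    · rw [intervalIntegral.integral_symm, ← key t ht a ha hgt htt hta, neg_sub]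
  rw [e, e2]
  abel

lemma continuousOn_primitive (hT : 0 < T) {g' : ℝ → X} (hg' : IntegrableOn g' (Ioo 0 T)) (c : X) :
    ContinuousOn (fun t => c + ∫ s in (0 : ℝ)..t, g' s) (Icc 0 T) := by
  have h1 : IntegrableOn g' (uIcc 0 T) := by
    rw [uIcc_of_le hT.le]
    exact (integrableOn_Icc_iff_integrableOn_Ioo (by simp) (by simp)).2 hg'
  have := intervalIntegral.continuousOn_primitive_interval h1
  rw [uIcc_of_le hT.le] at this
  exact continuousOn_const.add this

lemma eqOn_Icc_of_ae_eq (hT : 0 < T) {g h : ℝ → X} (hg : ContinuousOn g (Icc 0 T))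
    (hh : ContinuousOn h (Icc 0 T)) (he : ∀ᵐ t ∂(volume.restrict (Ioo 0 T)), g t = h t) :
    EqOn g h (Icc 0 T) := by
  have h1 : EqOn g h (Ioo 0 T) := Measure.eqOn_open_of_ae_eq he isOpen_Ioo
    (hg.mono Ioo_subset_Icc_self) (hh.mono Ioo_subset_Icc_self)
  exact h1.of_subset_closure hg hh Ioo_subset_Icc_self (by rw [closure_Ioo hT.ne])

lemma intervalIntegrable_of_Ioo {g' : ℝ → X} (hg' : IntegrableOn g' (Ioo 0 T)) {a b : ℝ}
    (ha : a ∈ Icc 0 T) (hb : b ∈ Icc 0 T) : IntervalIntegrable g' volume a b := by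
  rw [intervalIntegrable_iff]
  exact ((integrableOn_Icc_iff_integrableOn_Ioo (by simp) (by simp)).2 hg').mono_set
    (uIoc_subset_uIcc.trans (uIcc_subset_Icc ha hb))

/-- The fundamental theorem of calculus for a continuous function with an integrable weak
derivative. -/
lemma IsWeakTimeD.sub_eq_integral (hT : 0 < T) {g g' h : ℝ → X} (hgg' : IsWeakTimeD T g g')
    (hg : IntegrableOn g (Ioo 0 T)) (hg' : IntegrableOn g' (Ioo 0 T))
    (hh : ContinuousOn h (Icc 0 T)) (he : ∀ᵐ t ∂(volume.restrict (Ioo 0 T)), g t = h t)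
    {a b : ℝ} (ha : a ∈ Icc 0 T) (hb : b ∈ Icc 0 T) : h b - h a = ∫ s in a..b, g' s := by
  obtain ⟨c, hc⟩ := hgg'.ae_eq_primitive hT hg hg'
  have h1 := eqOn_Icc_of_ae_eq hT hh (continuousOn_primitive hT hg' c) (by
    filter_upwards [he, hc] with t h1 h2
    rw [← h1, h2])
  have h0 : (0 : ℝ) ∈ Icc 0 T := ⟨le_rfl, hT.le⟩
  rw [h1 ha, h1 hb, ← intervalIntegral.integral_interval_sub_left
    (intervalIntegrable_of_Ioo hg' h0 hb) (intervalIntegrable_of_Ioo hg' h0 ha)]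
  exact add_sub_add_left_eq_sub _ _ _

lemma IsWeakTimeD.clm {Y : Type} [NormedAddCommGroup Y] [NormedSpace ℝ Y] [CompleteSpace Y]
    {g g' : ℝ → X} (h : IsWeakTimeD T g g') (hg : IntegrableOn g (Ioo 0 T))
    (hg' : IntegrableOn g' (Ioo 0 T)) (A : X →L[ℝ] Y) :
    IsWeakTimeD T (fun t => A (g t)) (fun t => A (g' t)) := by
  intro φ hφ
  have hi : ∀ {f : ℝ → X} {ψ : ℝ → ℝ}, Continuous ψ → HasCompactSupport ψ →
      IntegrableOn f (Ioo 0 T) → IntegrableOn (fun t => ψ t • f t) (Ioo 0 T) := by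
    intro f ψ h1 h2 hf
    obtain ⟨C, hC⟩ := h1.bounded_above_of_compact_support h2
    exact hf.bdd_smul C h1.aestronglyMeasurable (Filter.Eventually.of_forall hC)
  have h1 := A.integral_comp_comm (hi (hφ.1.continuous_deriv (by simp)) hφ.2.1.deriv hg)
  have h2 := A.integral_comp_comm (hi hφ.1.continuous hφ.2.1 hg')
  simp only [map_smul] at h1 h2
  rw [h1, h2, h φ hφ, map_neg]

end

/-! ### Moduli of continuity in time -/

/-- `φ` is a nonnegative function in `L^2(0,T)` with norm at most `M`. -/
structure TimeBound (T M : ℝ) (φ : ℝ → ℝ) : Prop where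
  nonneg : ∀ t, 0 ≤ φ t
  memLp : MemLp φ 2 (volume.restrict (Ioo 0 T))
  le : ∫ t in Ioo 0 T, φ t ^ 2 ≤ M ^ 2

namespace TimeBound
variable {T M : ℝ} {φ : ℝ → ℝ}

lemma integrableOn (h : TimeBound T M φ) : IntegrableOn φ (Ioo 0 T) :=
  h.memLp.integrable (by norm_num)

lemma integrableOn_sq (h : TimeBound T M φ) : IntegrableOn (fun t => φ t ^ 2) (Ioo 0 T) :=
  h.memLp.integrable_sq

lemma integral_nonneg (h : TimeBound T M φ) {a b : ℝ} (hab : a ≤ b) : 0 ≤ ∫ t in a..b, φ t :=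
  intervalIntegral.integral_nonneg hab fun t _ => h.nonneg t

lemma sq_integral_le (h : TimeBound T M φ) {a b : ℝ} (ha : a ∈ Icc 0 T) (hb : b ∈ Icc 0 T)
    (hab : a ≤ b) : (∫ t in a..b, φ t) ^ 2 ≤ (b - a) * ∫ t in a..b, φ t ^ 2 := by
  rcases hab.eq_or_lt with rfl | hlt
  · simp
  have h1 := intervalIntegrable_of_Ioo h.integrableOn ha hb
  have h2 := intervalIntegrable_of_Ioo h.integrableOn_sq ha hb
  set I := ∫ t in a..b, φ t
  have h3 : ∫ t in a..b, 2 * (I / (b - a)) * φ t ≤ ∫ t in a..b, (φ t ^ 2 + (I / (b - a)) ^ 2) := by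
    refine intervalIntegral.integral_mono_on hab (h1.const_mul _)
      (h2.add intervalIntegrable_const) fun t _ => ?_
    nlinarith [sq_nonneg (φ t - I / (b - a))]
  rw [intervalIntegral.integral_const_mul, intervalIntegral.integral_add h2
    intervalIntegrable_const, intervalIntegral.integral_const, smul_eq_mul] at h3
  have h4 : 0 < b - a := sub_pos.2 hlt
  have h5 : 2 * (I / (b - a)) * I = 2 * (I ^ 2 / (b - a)) := by ring
  have h6 : (b - a) * (I / (b - a)) ^ 2 = I ^ 2 / (b - a) := by field_simp
  rw [h5, h6] at h3
  have h7 : I ^ 2 / (b - a) ≤ ∫ t in a..b, φ t ^ 2 := by linarith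
  rw [div_le_iff₀ h4] at h7
  linarith

lemma integral_sq_le (h : TimeBound T M φ) {a b : ℝ} (ha : a ∈ Icc 0 T) (hb : b ∈ Icc 0 T)
    (hab : a ≤ b) : ∫ t in a..b, φ t ^ 2 ≤ M ^ 2 := by
  rw [intervalIntegral.integral_of_le hab, integral_Ioc_eq_integral_Ioo]
  exact (setIntegral_mono_set h.integrableOn_sq (Filter.Eventually.of_forall fun t => sq_nonneg _)
    (Ioo_subset_Ioo ha.1 hb.2).eventuallyLE).trans h.le

lemma integral_le (h : TimeBound T M φ) (hM : 0 ≤ M) {a b : ℝ} (ha : a ∈ Icc 0 T)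
    (hb : b ∈ Icc 0 T) (hab : a ≤ b) : ∫ t in a..b, φ t ≤ √T * M := by
  have hT : 0 ≤ T := ha.1.trans ha.2
  refine (sq_le_sq₀ (h.integral_nonneg hab) (by positivity)).1 ?_
  rw [mul_pow, Real.sq_sqrt hT]
  refine (h.sq_integral_le ha hb hab).trans ?_
  have h1 := h.integral_sq_le ha hb hab
  have h2 : b - a ≤ T := by linarith [ha.1, hb.2]
  have h3 : 0 ≤ ∫ t in a..b, φ t ^ 2 :=
    intervalIntegral.integral_nonneg hab fun t _ => sq_nonneg _
  gcongr

variable {Δt : ℝ} {N : ℕ}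

lemma mem_Icc {n : ℕ} (hΔ : 0 < Δt) (hN : N * Δt ≤ T) (hn : n ≤ N) : (n : ℝ) * Δt ∈ Icc 0 T := by
  refine ⟨by positivity, le_trans ?_ hN⟩
  have : (n : ℝ) ≤ N := Nat.cast_le.2 hn
  gcongr

/-- The integral of `φ` over the time step `(t_n, t_{n+1})`. -/
def step (φ : ℝ → ℝ) (Δt : ℝ) (n : ℕ) : ℝ := ∫ t in (n * Δt)..((n + 1 : ℕ) * Δt), φ t

lemma step_nonneg (h : TimeBound T M φ) (hΔ : 0 < Δt) (n : ℕ) : 0 ≤ step φ Δt n :=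
  h.integral_nonneg (by push_cast; nlinarith)

lemma sum_step (h : TimeBound T M φ) (hM : 0 ≤ M) (hΔ : 0 < Δt) (hN : N * Δt ≤ T) :
    ∑ n ∈ Finset.range N, step φ Δt n ≤ √T * M := by
  unfold step
  rw [intervalIntegral.sum_integral_adjacent_intervals (a := fun n : ℕ => (n : ℝ) * Δt)]
  · exact h.integral_le hM (mem_Icc hΔ hN (Nat.zero_le N)) (mem_Icc hΔ hN le_rfl)
      (by simp; positivity)
  · intro n hn
    exact intervalIntegrable_of_Ioo h.integrableOn (mem_Icc hΔ hN hn.le) (mem_Icc hΔ hN hn)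

lemma sum_step_sq (h : TimeBound T M φ) (hΔ : 0 < Δt) (hN : N * Δt ≤ T) :
    ∑ n ∈ Finset.range N, step φ Δt n ^ 2 ≤ Δt * M ^ 2 := by
  calc ∑ n ∈ Finset.range N, step φ Δt n ^ 2
      ≤ ∑ n ∈ Finset.range N, Δt * ∫ t in (n * Δt)..((n + 1 : ℕ) * Δt), φ t ^ 2 := by
        refine Finset.sum_le_sum fun n hn => ?_
        have hn' := Finset.mem_range.1 hn
        refine (h.sq_integral_le (mem_Icc hΔ hN hn'.le) (mem_Icc hΔ hN hn')
          (by push_cast; nlinarith)).trans_eq ?_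
        push_cast
        ring
    _ ≤ _ := by
        rw [← Finset.mul_sum, intervalIntegral.sum_integral_adjacent_intervals
          (a := fun n : ℕ => (n : ℝ) * Δt)]
        · gcongr
          exact h.integral_sq_le (mem_Icc hΔ hN (Nat.zero_le N)) (mem_Icc hΔ hN le_rfl)
            (by simp; positivity)
        · intro n hn
          exact intervalIntegrable_of_Ioo h.integrableOn_sq (mem_Icc hΔ hN hn.le) (mem_Icc hΔ hN hn)

end TimeBound

section
variable {X : Type} [NormedAddCommGroup X] [NormedSpace ℝ X] [CompleteSpace X] {T M : ℝ}

lemma timeBound_of_HTimeLe {j : ℕ} {G : ℕ → ℝ → X}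
    (hG : ∀ i ≤ j, MemLp (G i) 2 (volume.restrict (Ioo 0 T)))
    (hM : √(∑ i ∈ Finset.range (j + 1), ∫ t in Ioo 0 T, ‖G i t‖ ^ 2) ≤ M) {i : ℕ} (hi : i ≤ j) :
    TimeBound T M (fun t => ‖G i t‖) := by
  refine ⟨fun t => norm_nonneg _, (hG i hi).norm, ?_⟩
  have h1 : ∫ t in Ioo 0 T, ‖G i t‖ ^ 2
      ≤ ∑ i ∈ Finset.range (j + 1), ∫ t in Ioo 0 T, ‖G i t‖ ^ 2 :=
    Finset.single_le_sum (f := fun i => ∫ t in Ioo 0 T, ‖G i t‖ ^ 2)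
      (fun i _ => integral_nonneg fun t => sq_nonneg _) (Finset.mem_range.2 (by omega))
  refine h1.trans ((Real.sqrt_le_left ((Real.sqrt_nonneg _).trans hM)).1 hM)

lemma integrableOn_of_memLp_two {g : ℝ → X} (h : MemLp g 2 (volume.restrict (Ioo 0 T))) :
    IntegrableOn g (Ioo 0 T) := h.integrable (by norm_num)

/-- Increments of a continuous function in `H^1(0,T; X)`. -/
lemma HTimeLe.exists_increment (hT : 0 < T) {g : ℝ → X} (hc : ContinuousOn g (Icc 0 T))
    (h : HTimeLe T 1 M g) : ∃ φ, TimeBound T M φ ∧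
      ∀ a ∈ Icc 0 T, ∀ b ∈ Icc 0 T, a ≤ b → ‖g b - g a‖ ≤ ∫ t in a..b, φ t := by
  obtain ⟨G, h0, hG, hw, hM⟩ := h
  refine ⟨_, timeBound_of_HTimeLe hG hM le_rfl, fun a ha b hb hab => ?_⟩
  rw [(hw 0 one_pos).sub_eq_integral hT (integrableOn_of_memLp_two (hG 0 zero_le_one))
    (integrableOn_of_memLp_two (hG 1 le_rfl)) hc h0 ha hb]
  exact intervalIntegral.norm_integral_le_integral_norm hab

variable {Y : Type} [NormedAddCommGroup Y] [NormedSpace ℝ Y] [CompleteSpace Y]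

/-- Increments of a function in `H^1(0,T; X)` that is continuous in the larger space `Y`. -/
lemma HTimeLe.exists_increment_map (hT : 0 < T) (V : X →L[ℝ] Y) {U : ℝ → X} {g : ℝ → Y}
    (hc : ContinuousOn g (Icc 0 T)) (hU : ∀ᵐ t ∂(volume.restrict (Ioo 0 T)), V (U t) = g t)
    (h : HTimeLe T 1 M U) : ∃ φ, TimeBound T M φ ∧
      ∀ a ∈ Icc 0 T, ∀ b ∈ Icc 0 T, a ≤ b → ∃ v : X, V v = g b - g a ∧
        ‖v‖ ≤ ∫ t in a..b, φ t := by
  obtain ⟨G, h0, hG, hw, hM⟩ := h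
  refine ⟨_, timeBound_of_HTimeLe hG hM le_rfl, fun a ha b hb hab =>
    ⟨∫ t in a..b, G 1 t, ?_, intervalIntegral.norm_integral_le_integral_norm hab⟩⟩
  have i0 := integrableOn_of_memLp_two (hG 0 zero_le_one)
  have i1 := integrableOn_of_memLp_two (hG 1 le_rfl)
  have h1 := ((hw 0 one_pos).clm i0 i1 V).sub_eq_integral hT
    (V.integrable_comp i0) (V.integrable_comp i1) hc (by
      filter_upwards [hU, h0] with t h1 h2
      rw [← h1, h2]) ha hb
  rw [h1]
  exact (ContinuousLinearMap.intervalIntegral_comp_comm _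
    (intervalIntegrable_of_Ioo i1 ha hb)).symm

/-- The time derivative of a function in `H^2(0,T; X)`: it is continuous, and it has itself a
modulus of continuity in time. -/
lemma HTimeLe.exists_deriv_map (hT : 0 < T) (V : X →L[ℝ] Y) (hV : ∀ x, ‖V x‖ ≤ ‖x‖) {U : ℝ → X}
    {g : ℝ → Y} (hc : ContinuousOn g (Icc 0 T))
    (hU : ∀ᵐ t ∂(volume.restrict (Ioo 0 T)), V (U t) = g t) (h : HTimeLe T 2 M U) :
    ∃ D : ℝ → Y, ContinuousOn D (Icc 0 T) ∧ (∀ t ∈ Ioo 0 T, HasDerivAt g (D t) t) ∧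
      (∀ a ∈ Icc 0 T, ∀ b ∈ Icc 0 T, g b - g a = ∫ t in a..b, D t) ∧
      (∃ φ, TimeBound T M φ ∧
        ∀ a ∈ Icc 0 T, ∀ b ∈ Icc 0 T, a ≤ b → ‖D b - D a‖ ≤ ∫ t in a..b, φ t) ∧
      (∃ φ, TimeBound T M φ ∧ ∀ a ∈ Icc 0 T, ∀ b ∈ Icc 0 T, a ≤ b →
        ∫ t in a..b, ‖D t‖ ≤ ∫ t in a..b, φ t) := by
  obtain ⟨G, h0, hG, hw, hM⟩ := h
  have i0 := integrableOn_of_memLp_two (hG 0 (by norm_num))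
  have i1 := integrableOn_of_memLp_two (hG 1 (by norm_num))
  have i2 := integrableOn_of_memLp_two (hG 2 le_rfl)
  have j0 := V.integrable_comp i0
  have j1 := V.integrable_comp i1
  have j2 := V.integrable_comp i2
  have w1 := (hw 0 (by norm_num)).clm i0 i1 V
  have w2 := (hw 1 (by norm_num)).clm i1 i2 V
  obtain ⟨c, hc2⟩ := w2.ae_eq_primitive hT j1 j2
  set D : ℝ → Y := fun t => c + ∫ s in (0 : ℝ)..t, V (G 2 s)
  have hD : ContinuousOn D (Icc 0 T) := continuousOn_primitive hT j2 c
  have e1 : ∀ a ∈ Icc 0 T, ∀ b ∈ Icc 0 T, g b - g a = ∫ t in a..b, D t := by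
    intro a ha b hb
    rw [w1.sub_eq_integral hT j0 j1 hc (by
      filter_upwards [hU, h0] with t h1 h2
      rw [← h1, h2]) ha hb]
    refine intervalIntegral.integral_congr_ae ?_
    have h1 := (ae_restrict_iff' measurableSet_Ioo).1 hc2
    filter_upwards [h1, Measure.ae_ne volume 0, Measure.ae_ne volume T] with t h2 h3 h4 ht
    have h5 := uIcc_subset_Icc ha hb (uIoc_subset_uIcc ht)
    exact h2 ⟨lt_of_le_of_ne h5.1 h3.symm, lt_of_le_of_ne h5.2 h4⟩
  have h0T : (0 : ℝ) ∈ Icc 0 T := ⟨le_rfl, hT.le⟩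
  refine ⟨D, hD, ?_, e1, ⟨_, timeBound_of_HTimeLe hG hM le_rfl, ?_⟩,
    ⟨_, timeBound_of_HTimeLe hG hM (i := 1) (by norm_num), ?_⟩⟩
  · intro t ht
    have hDt : ContinuousAt D t := hD.continuousAt (Icc_mem_nhds ht.1 ht.2)
    have h1 : HasDerivAt (fun r => g 0 + ∫ s in (0 : ℝ)..r, D s) (D t) t := by
      refine HasDerivAt.const_add _ (intervalIntegral.integral_hasDerivAt_right ?_ ?_ hDt)
      · exact (hD.mono (uIcc_subset_Icc h0T (Ioo_subset_Icc_self ht))).intervalIntegrable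
      · exact (hD.mono Ioo_subset_Icc_self).stronglyMeasurableAtFilter isOpen_Ioo t ht
    refine h1.congr_of_eventuallyEq ?_
    filter_upwards [Ioo_mem_nhds ht.1 ht.2] with r hr
    rw [← e1 0 h0T r (Ioo_subset_Icc_self hr)]
    abel
  · intro a ha b hb hab
    have h1 : D b - D a = V (∫ s in a..b, G 2 s) := by
      rw [← ContinuousLinearMap.intervalIntegral_comp_comm _ (intervalIntegrable_of_Ioo i2 ha hb),
        ← intervalIntegral.integral_interval_sub_left (intervalIntegrable_of_Ioo j2 h0T hb)
          (intervalIntegrable_of_Ioo j2 h0T ha)]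
      simp only [D]
      abel
    rw [h1]
    exact (hV _).trans (intervalIntegral.norm_integral_le_integral_norm hab)
  · intro a ha b hb hab
    refine intervalIntegral.integral_mono_ae_restrict hab
      (hD.mono (uIcc_subset_Icc ha hb)).norm.intervalIntegrable
      (intervalIntegrable_of_Ioo i1.norm ha hb) ?_
    have h1 : ∀ᵐ t ∂(volume.restrict (Icc a b)), V (G 1 t) = D t := by
      have h1 := (ae_restrict_iff' measurableSet_Ioo).1 hc2
      rw [ae_restrict_iff' measurableSet_Icc]
      filter_upwards [h1, Measure.ae_ne volume 0, Measure.ae_ne volume T] with t h2 h3 h4 ht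
      exact h2 ⟨lt_of_le_of_ne (ha.1.trans ht.1) h3.symm, lt_of_le_of_ne (ht.2.trans hb.2) h4⟩
    filter_upwards [h1] with t ht
    rw [← ht]
    exact hV _

variable {d m : ℕ} {Ω : Set (Eu d)} {F : Type} [NormedAddCommGroup F] [NormedSpace ℝ F]
  [CompleteSpace F]

lemma HTimeSobLe.exists_increment (hT : 0 < T) {g : ℝ → LpΩ 2 Ω F}
    (hc : ContinuousOn g (Icc 0 T)) (h : HTimeSobLe T 1 m M g) : ∃ φ, TimeBound T M φ ∧
      ∀ a ∈ Icc 0 T, ∀ b ∈ Icc 0 T, a ≤ b → ∃ v : Sob m 2 Ω F, val v = g b - g a ∧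
        ‖v‖ ≤ ∫ t in a..b, φ t := by
  obtain ⟨U, hU, h⟩ := h
  have key := @HTimeLe.exists_increment_map (Sob m 2 Ω F) _ _ _ T M (LpΩ 2 Ω F) _ _ _ hT val U g
  have key' := key hc hU h
  exact key'

lemma HTimeSobLe.exists_deriv (hT : 0 < T) {g : ℝ → LpΩ 2 Ω F}
    (hc : ContinuousOn g (Icc 0 T)) (h : HTimeSobLe T 2 m M g) :
    ∃ D : ℝ → LpΩ 2 Ω F, ContinuousOn D (Icc 0 T) ∧ (∀ t ∈ Ioo 0 T, HasDerivAt g (D t) t) ∧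
      (∀ a ∈ Icc 0 T, ∀ b ∈ Icc 0 T, g b - g a = ∫ t in a..b, D t) ∧
      (∃ φ, TimeBound T M φ ∧
        ∀ a ∈ Icc 0 T, ∀ b ∈ Icc 0 T, a ≤ b → ‖D b - D a‖ ≤ ∫ t in a..b, φ t) ∧
      (∃ φ, TimeBound T M φ ∧ ∀ a ∈ Icc 0 T, ∀ b ∈ Icc 0 T, a ≤ b →
        ∫ t in a..b, ‖D t‖ ≤ ∫ t in a..b, φ t) := by
  obtain ⟨U, hU, h⟩ := h
  have key := @HTimeLe.exists_deriv_map (Sob m 2 Ω F) _ _ _ T M (LpΩ 2 Ω F) _ _ _ hT val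
    norm_val_le U g
  have key' := key hc hU h
  exact key'

end

/-! ### Discrete energy and averaging estimates -/

/-- Summability of exponentially weighted averages. -/
lemma sum_average_le {θ : ℝ} (hθ0 : 0 ≤ θ) (hθ1 : θ ≤ 1) {x b : ℕ → ℝ} (hx : ∀ n, 0 ≤ x n)
    (hb : ∀ n, 0 ≤ b n) {N : ℕ} (h : ∀ n < N, x (n + 1) ≤ (1 - θ) * (x n + b n)) :
    θ * ∑ n ∈ Finset.range (N + 1), x n ≤ x 0 + ∑ n ∈ Finset.range N, b n := by
  have key : ∀ m ≤ N, θ * ∑ n ∈ Finset.range m, x n + x m ≤ x 0 + ∑ n ∈ Finset.range m, b n := by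
    intro m
    induction m with
    | zero => intro _; simp
    | succ m ih =>
      intro hm
      rw [Finset.sum_range_succ, Finset.sum_range_succ]
      have h1 := ih (by omega)
      have h2 := h m (by omega)
      nlinarith [hb m]
  have h1 := key N le_rfl
  rw [Finset.sum_range_succ]
  nlinarith [hx N]

/-- Square summability of exponentially weighted averages. -/
lemma sum_sq_average_le {θ : ℝ} (hθ0 : 0 < θ) (hθ1 : θ ≤ 1) {y γ : ℕ → ℝ} (h0 : y 0 = 0) {N : ℕ}
    (h : ∀ n < N, y (n + 1) = (1 - θ) * (y n + γ n)) :
    θ ^ 2 * ∑ n ∈ Finset.range (N + 1), y n ^ 2 ≤ ∑ n ∈ Finset.range N, γ n ^ 2 := by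
  have key := sum_average_le hθ0.le hθ1 (x := fun n => y n ^ 2) (b := fun n => γ n ^ 2 / θ)
    (fun n => sq_nonneg _) (fun n => by positivity) (N := N) (fun n hn => by
      rw [h n hn]
      -- convexity of the square, `(1-θ)(y+γ) = (1-θ) y + θ ((1-θ) γ / θ)`
      have h1 : (1 - θ) * (y n ^ 2 + γ n ^ 2 / θ) - ((1 - θ) * (y n + γ n)) ^ 2
          = (1 - θ) / θ * (θ * y n - (1 - θ) * γ n) ^ 2 + (1 - θ) * γ n ^ 2 := by
        field_simp
        ring
      have h2 : 0 ≤ (1 - θ) / θ * (θ * y n - (1 - θ) * γ n) ^ 2 + (1 - θ) * γ n ^ 2 := by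
        have : 0 ≤ 1 - θ := by linarith
        positivity
      linarith)
  rw [h0, ← Finset.sum_div] at key
  have h2 := mul_le_mul_of_nonneg_left key hθ0.le
  have h3 : θ * ((0 : ℝ) ^ 2 + (∑ n ∈ Finset.range N, γ n ^ 2) / θ)
      = ∑ n ∈ Finset.range N, γ n ^ 2 := by field_simp; ring
  rw [h3] at h2
  calc _ = θ * (θ * ∑ n ∈ Finset.range (N + 1), y n ^ 2) := by ring
    _ ≤ _ := h2

/-- Discrete Gronwall inequality. -/
lemma discrete_gronwall {E D β c : ℕ → ℝ} {N : ℕ} (hE : ∀ n, 0 ≤ E n) (hD : ∀ n, 0 ≤ D n)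
    (hβ : ∀ n, 0 ≤ β n) (hc : ∀ n, 0 ≤ c n)
    (h : ∀ n < N, E (n + 1) + D n ≤ Real.exp (c n) * E n + β n) {m : ℕ} (hm : m ≤ N) :
    E m + ∑ n ∈ Finset.range m, D n ≤ Real.exp (∑ n ∈ Finset.range N, c n)
      * (E 0 + ∑ n ∈ Finset.range N, β n) := by
  have key : ∀ m ≤ N, E m + ∑ n ∈ Finset.range m, D n
      ≤ Real.exp (∑ n ∈ Finset.range m, c n) * (E 0 + ∑ n ∈ Finset.range m, β n) := by
    intro m
    induction m with
    | zero => intro _; simp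
    | succ m ih =>
      intro hm
      simp only [Finset.sum_range_succ]
      have h1 := ih (by omega)
      have h2 := h m (by omega)
      have h3 : 1 ≤ Real.exp (c m) := Real.one_le_exp (hc m)
      have h4 : 1 ≤ Real.exp (∑ n ∈ Finset.range m, c n) :=
        Real.one_le_exp (Finset.sum_nonneg fun n _ => hc n)
      have h5 : 0 ≤ ∑ n ∈ Finset.range m, D n := Finset.sum_nonneg fun n _ => hD n
      rw [Real.exp_add]
      calc _ ≤ Real.exp (c m) * (E m + ∑ n ∈ Finset.range m, D n) + β m := by
            nlinarith
        _ ≤ Real.exp (c m) * (Real.exp (∑ n ∈ Finset.range m, c n)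
            * (E 0 + ∑ n ∈ Finset.range m, β n)) + β m := by gcongr
        _ ≤ _ := by
            have h6 : β m ≤ Real.exp (∑ n ∈ Finset.range m, c n) * Real.exp (c m) * β m :=
              le_mul_of_one_le_left (hβ m) (one_le_mul_of_one_le_of_one_le h4 h3)
            linarith
  refine (key m hm).trans ?_
  have h1 : ∑ n ∈ Finset.range m, c n ≤ ∑ n ∈ Finset.range N, c n :=
    Finset.sum_le_sum_of_subset_of_nonneg (Finset.range_mono hm) fun n _ _ => hc n
  have h2 : ∑ n ∈ Finset.range m, β n ≤ ∑ n ∈ Finset.range N, β n :=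
    Finset.sum_le_sum_of_subset_of_nonneg (Finset.range_mono hm) fun n _ _ => hβ n
  have h3 : 0 ≤ ∑ n ∈ Finset.range m, β n := Finset.sum_nonneg fun n _ => hβ n
  have h4 := hE 0
  gcongr

section
variable {H : Type} [NormedAddCommGroup H] [InnerProductSpace ℝ H]

/-- One step of the pressure correction scheme in the energy norm. Here `e`, `et'` are the errors of
the velocity and of the intermediate velocity, `g` the transported error, `G` and `π` the gradients
of the pressure error and of the increment of the approximation of the pressure, `A` and `S` the
gradient norm of `et'` and the stabilization seminorm of the pressure error, `r`, `a`, `b` the data.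
The bound `S0` for the sum of the residuals `r` over all steps balances the terms in Young's
inequality. -/
lemma energy_step {e e' et' G G' π g : H} {Δt κ ν δ₀ A a S b r S0 : ℝ} (hΔ : 0 < Δt) (hκ : 0 ≤ κ)
    (hν : 0 < ν) (hδ : 0 < δ₀) (hr : 0 ≤ r) (hS0 : 0 < S0)
    (h1 : inner ℝ (et' - g) et' + Δt * ν * A ^ 2 + Δt * inner ℝ (G - π) et'
      ≤ r * ‖et'‖ + Δt * ν * (a * A))
    (h2 : e' + Δt • G' = et' + Δt • (G - π))
    (h3 : δ₀ * S ^ 2 - (δ₀ + 1) * (b * S) ≤ inner ℝ e' G')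
    (h4 : ‖g‖ ^ 2 ≤ (1 + κ * Δt) * ‖e‖ ^ 2) :
    (‖e'‖ ^ 2 + Δt ^ 2 * ‖G'‖ ^ 2)
        + (1 / 2 * ‖et' - g‖ ^ 2 + Δt * ν * A ^ 2 + Δt * δ₀ * S ^ 2)
      ≤ Real.exp ((κ + 1) * Δt + r / S0) * (‖e‖ ^ 2 + Δt ^ 2 * ‖G‖ ^ 2)
        + (2 * r ^ 2 + r * S0 + Δt * ν * a ^ 2 + Δt * (1 + Δt) * ‖π‖ ^ 2
          + Δt * ((δ₀ + 1) ^ 2 / δ₀) * b ^ 2) := by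
  -- the square of the projection step
  have e1 : ‖e'‖ ^ 2 + 2 * (Δt * inner ℝ e' G') + Δt ^ 2 * ‖G'‖ ^ 2
      = ‖et'‖ ^ 2 + 2 * (Δt * inner ℝ (G - π) et') + Δt ^ 2 * ‖G - π‖ ^ 2 := by
    have := congrArg (fun z => ‖z‖ ^ 2) h2
    simp only [norm_add_sq_real, real_inner_smul_right, norm_smul, mul_pow, Real.norm_eq_abs,
      sq_abs] at this
    rw [real_inner_comm et' (G - π)]
    linarith
  have e2 : 2 * inner ℝ (et' - g) et' = ‖et'‖ ^ 2 - ‖g‖ ^ 2 + ‖et' - g‖ ^ 2 := by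
    rw [norm_sub_sq_real, inner_sub_left, real_inner_self_eq_norm_sq, real_inner_comm]
    ring
  -- the weight `Δt` keeps the growth of the pressure part of the energy within `1 + Δt`
  have e3 : ‖G - π‖ ^ 2 ≤ (1 + Δt) * ‖G‖ ^ 2 + (1 + 1 / Δt) * ‖π‖ ^ 2 := by
    have h5 : ‖G - π‖ ^ 2 ≤ (‖G‖ + ‖π‖) ^ 2 := by
      gcongr
      exact norm_sub_le _ _
    have h6 : (1 + Δt) * ‖G‖ ^ 2 + (1 + 1 / Δt) * ‖π‖ ^ 2 - (‖G‖ + ‖π‖) ^ 2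
        = (Δt * ‖G‖ - ‖π‖) ^ 2 / Δt := by
      field_simp
      ring
    have h7 : 0 ≤ (Δt * ‖G‖ - ‖π‖) ^ 2 / Δt := by positivity
    linarith
  have e3' : Δt ^ 2 * ‖G - π‖ ^ 2
      ≤ (1 + Δt) * (Δt ^ 2 * ‖G‖ ^ 2) + Δt * (1 + Δt) * ‖π‖ ^ 2 := by
    have := mul_le_mul_of_nonneg_left e3 (sq_nonneg Δt)
    have h5 : Δt ^ 2 * ((1 + Δt) * ‖G‖ ^ 2 + (1 + 1 / Δt) * ‖π‖ ^ 2)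
        = (1 + Δt) * (Δt ^ 2 * ‖G‖ ^ 2) + Δt * (1 + Δt) * ‖π‖ ^ 2 := by
      field_simp
      ring
    linarith
  -- Young's inequality with the weight `r / S0`, which is summable over the steps
  have e4 : 2 * (r * ‖et'‖) ≤ 1 / 2 * ‖et' - g‖ ^ 2 + 2 * r ^ 2 + r * S0 + r / S0 * ‖g‖ ^ 2 := by
    have h5 : ‖et'‖ ≤ ‖et' - g‖ + ‖g‖ := by
      calc ‖et'‖ = ‖(et' - g) + g‖ := by rw [sub_add_cancel]
        _ ≤ _ := norm_add_le _ _
    have h6 : 2 * (r * ‖g‖) ≤ r * S0 + r / S0 * ‖g‖ ^ 2 := by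
      have h7 : r * S0 + r / S0 * ‖g‖ ^ 2 - 2 * (r * ‖g‖) = r / S0 * (S0 - ‖g‖) ^ 2 := by
        field_simp
        ring
      have h8 : 0 ≤ r / S0 * (S0 - ‖g‖) ^ 2 := by positivity
      linarith
    nlinarith [mul_le_mul_of_nonneg_left h5 hr, sq_nonneg (‖et' - g‖ - 2 * r)]
  have e5 : 2 * ((δ₀ + 1) * (b * S)) ≤ δ₀ * S ^ 2 + (δ₀ + 1) ^ 2 / δ₀ * b ^ 2 := by
    have h7 : δ₀ * S ^ 2 + (δ₀ + 1) ^ 2 / δ₀ * b ^ 2 - 2 * ((δ₀ + 1) * (b * S))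
        = (δ₀ * S - (δ₀ + 1) * b) ^ 2 / δ₀ := by
      field_simp
      ring
    have h8 : 0 ≤ (δ₀ * S - (δ₀ + 1) * b) ^ 2 / δ₀ := by positivity
    linarith
  have e6 : Δt * (δ₀ * S ^ 2 - (δ₀ + 1) ^ 2 / δ₀ * b ^ 2) ≤ 2 * (Δt * inner ℝ e' G') := by
    have h5 := mul_le_mul_of_nonneg_left h3 hΔ.le
    have h6 := mul_le_mul_of_nonneg_left e5 hΔ.le
    linarith
  have e7 : 2 * (Δt * ν * (a * A)) ≤ Δt * ν * A ^ 2 + Δt * ν * a ^ 2 := by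
    have h5 : 0 ≤ Δt * ν * (A - a) ^ 2 := by positivity
    linarith
  have hx : 0 ≤ r / S0 := by positivity
  have e8 : (1 + r / S0) * ‖g‖ ^ 2 + (1 + Δt) * (Δt ^ 2 * ‖G‖ ^ 2)
      ≤ Real.exp ((κ + 1) * Δt + r / S0) * (‖e‖ ^ 2 + Δt ^ 2 * ‖G‖ ^ 2) := by
    have h5 : (1 + r / S0) * (1 + (κ + 1) * Δt) ≤ Real.exp ((κ + 1) * Δt + r / S0) := by
      rw [add_comm ((κ + 1) * Δt), Real.exp_add]
      have h6 := Real.add_one_le_exp (r / S0)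
      have h7 := Real.add_one_le_exp ((κ + 1) * Δt)
      have h8 : 0 ≤ (κ + 1) * Δt := by positivity
      gcongr <;> linarith
    have h6 : (1 + r / S0) * ‖g‖ ^ 2 ≤ (1 + r / S0) * (1 + (κ + 1) * Δt) * ‖e‖ ^ 2 := by
      rw [mul_assoc]
      gcongr
      refine h4.trans ?_
      gcongr
      linarith
    have h7 : (1 + Δt) * (Δt ^ 2 * ‖G‖ ^ 2)
        ≤ (1 + r / S0) * (1 + (κ + 1) * Δt) * (Δt ^ 2 * ‖G‖ ^ 2) := by
      have h9 : 0 ≤ κ * Δt := by positivity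
      have h10 : 1 + Δt ≤ 1 + (κ + 1) * Δt := by linarith
      have h11 : 1 + (κ + 1) * Δt ≤ (1 + r / S0) * (1 + (κ + 1) * Δt) :=
        le_mul_of_one_le_left (by linarith) (by linarith)
      exact mul_le_mul_of_nonneg_right (h10.trans h11) (by positivity)
    have h8 : 0 ≤ ‖e‖ ^ 2 + Δt ^ 2 * ‖G‖ ^ 2 := by positivity
    refine le_trans ?_ (mul_le_mul_of_nonneg_right h5 h8)
    rw [mul_add]
    exact add_le_add h6 h7
  linarith

/-- Stability of the pressure correction scheme in abstract form, with the notation of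
`energy_step`. -/
lemma energy_estimate {N : ℕ} {e et G π g : ℕ → H} {A a S b r : ℕ → ℝ} {T Δt κ ν δ₀ S0 : ℝ}
    (hΔ : 0 < Δt) (hN : N * Δt ≤ T) (hκ : 0 ≤ κ) (hν : 0 < ν) (hδ : 0 < δ₀) (hr : ∀ n, 0 ≤ r n)
    (hS0 : 0 < S0) (hrS : ∑ n ∈ Finset.range N, r n ≤ S0)
    (h1 : ∀ n < N, inner ℝ (et (n + 1) - g n) (et (n + 1)) + Δt * ν * A (n + 1) ^ 2
      + Δt * inner ℝ (G n - π n) (et (n + 1))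
      ≤ r n * ‖et (n + 1)‖ + Δt * ν * (a (n + 1) * A (n + 1)))
    (h2 : ∀ n < N, e (n + 1) + Δt • G (n + 1) = et (n + 1) + Δt • (G n - π n))
    (h3 : ∀ n < N, δ₀ * S (n + 1) ^ 2 - (δ₀ + 1) * (b (n + 1) * S (n + 1))
      ≤ inner ℝ (e (n + 1)) (G (n + 1)))
    (h4 : ∀ n < N, ‖g n‖ ^ 2 ≤ (1 + κ * Δt) * ‖e n‖ ^ 2) {B : ℝ}
    (hB : Real.exp ((κ + 1) * T + 1) * (‖e 0‖ ^ 2 + Δt ^ 2 * ‖G 0‖ ^ 2 + (3 * S0 ^ 2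
      + ν * (Δt * ∑ n ∈ Finset.range N, a (n + 1) ^ 2)
      + (1 + Δt) * (Δt * ∑ n ∈ Finset.range N, ‖π n‖ ^ 2)
      + (δ₀ + 1) ^ 2 / δ₀ * (Δt * ∑ n ∈ Finset.range N, b (n + 1) ^ 2))) ≤ B) :
    (∀ n ≤ N, ‖e n‖ ^ 2 ≤ B) ∧ (∀ n < N, ‖et (n + 1)‖ ^ 2 ≤ (6 + 2 * κ * T) * B) ∧
      ν * (Δt * ∑ n ∈ Finset.range N, A (n + 1) ^ 2) ≤ B ∧
      δ₀ * (Δt * ∑ n ∈ Finset.range N, S (n + 1) ^ 2) ≤ B := by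
  set E : ℕ → ℝ := fun n => ‖e n‖ ^ 2 + Δt ^ 2 * ‖G n‖ ^ 2
  set D : ℕ → ℝ := fun n => 1 / 2 * ‖et (n + 1) - g n‖ ^ 2 + Δt * ν * A (n + 1) ^ 2
    + Δt * δ₀ * S (n + 1) ^ 2
  set β : ℕ → ℝ := fun n => 2 * r n ^ 2 + r n * S0 + Δt * ν * a (n + 1) ^ 2
    + Δt * (1 + Δt) * ‖π n‖ ^ 2 + Δt * ((δ₀ + 1) ^ 2 / δ₀) * b (n + 1) ^ 2
  have hD : ∀ n, 0 ≤ D n := fun n => by positivity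
  have hE : ∀ n, 0 ≤ E n := fun n => by positivity
  have hβ : ∀ n, 0 ≤ β n := fun n => by have := hr n; positivity
  have hr2 : ∑ n ∈ Finset.range N, r n ^ 2 ≤ S0 ^ 2 := by
    refine (Finset.sum_sq_le_sq_sum_of_nonneg fun n _ => hr n).trans ?_
    have : 0 ≤ ∑ n ∈ Finset.range N, r n := Finset.sum_nonneg fun n _ => hr n
    gcongr
  have hβs : ∑ n ∈ Finset.range N, β n ≤ 3 * S0 ^ 2
      + ν * (Δt * ∑ n ∈ Finset.range N, a (n + 1) ^ 2)
      + (1 + Δt) * (Δt * ∑ n ∈ Finset.range N, ‖π n‖ ^ 2)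
      + (δ₀ + 1) ^ 2 / δ₀ * (Δt * ∑ n ∈ Finset.range N, b (n + 1) ^ 2) := by
    simp only [β, Finset.sum_add_distrib, ← Finset.mul_sum, ← Finset.sum_mul]
    have := mul_le_mul_of_nonneg_right hrS hS0.le
    nlinarith
  have hc : ∑ n ∈ Finset.range N, ((κ + 1) * Δt + r n / S0) ≤ (κ + 1) * T + 1 := by
    rw [Finset.sum_add_distrib, Finset.sum_const, Finset.card_range, nsmul_eq_mul,
      ← Finset.sum_div]
    have e1 : (∑ n ∈ Finset.range N, r n) / S0 ≤ 1 := (div_le_one hS0).2 hrS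
    nlinarith
  have main : ∀ m ≤ N, E m + ∑ n ∈ Finset.range m, D n ≤ B := by
    intro m hm
    refine (discrete_gronwall hE hD hβ (c := fun n => (κ + 1) * Δt + r n / S0)
      (fun n => by have := hr n; positivity) (fun n hn => energy_step hΔ hκ hν hδ (hr n) hS0
        (h1 n hn) (h2 n hn) (h3 n hn) (h4 n hn)) hm).trans (le_trans ?_ hB)
    have e1 := hE 0
    have e2 : 0 ≤ ∑ n ∈ Finset.range N, β n := Finset.sum_nonneg fun n _ => hβ n
    gcongr
  have he : ∀ n ≤ N, ‖e n‖ ^ 2 ≤ B := by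
    intro n hn
    have e1 := main n hn
    have e2 : 0 ≤ ∑ n ∈ Finset.range n, D n := Finset.sum_nonneg fun n _ => hD n
    have e3 : 0 ≤ Δt ^ 2 * ‖G n‖ ^ 2 := by positivity
    simp only [E] at e1
    linarith
  have hDs : ∑ n ∈ Finset.range N, D n ≤ B := by linarith [main N le_rfl, hE N]
  refine ⟨he, ?_, ?_, ?_⟩
  · intro n hn
    have e1 : D n ≤ B := (Finset.single_le_sum (f := D) (fun n _ => hD n)
      (Finset.mem_range.2 hn)).trans hDs
    have e2 : 1 / 2 * ‖et (n + 1) - g n‖ ^ 2 ≤ D n := by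
      have : 0 ≤ Δt * ν * A (n + 1) ^ 2 + Δt * δ₀ * S (n + 1) ^ 2 := by positivity
      simp only [D]
      linarith
    have e3 : ‖et (n + 1)‖ ≤ ‖et (n + 1) - g n‖ + ‖g n‖ := by
      calc ‖et (n + 1)‖ = ‖(et (n + 1) - g n) + g n‖ := by rw [sub_add_cancel]
        _ ≤ _ := norm_add_le _ _
    have e4 : ‖et (n + 1)‖ ^ 2 ≤ 2 * ‖et (n + 1) - g n‖ ^ 2 + 2 * ‖g n‖ ^ 2 := by
      have := pow_le_pow_left₀ (norm_nonneg _) e3 2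
      nlinarith [sq_nonneg (‖et (n + 1) - g n‖ - ‖g n‖)]
    have e5 : Δt ≤ T := by
      have : (1 : ℝ) ≤ N := by exact_mod_cast (by omega : 1 ≤ N)
      nlinarith
    have e6 : ‖g n‖ ^ 2 ≤ (1 + κ * T) * B := by
      refine (h4 n hn).trans ?_
      have h7 := he n hn.le
      have h8 : 0 ≤ 1 + κ * T := by
        have := hΔ.le.trans e5
        positivity
      gcongr
    linarith
  · refine le_trans ?_ hDs
    rw [Finset.mul_sum, Finset.mul_sum]
    refine Finset.sum_le_sum fun n _ => ?_
    have : 0 ≤ 1 / 2 * ‖et (n + 1) - g n‖ ^ 2 + Δt * δ₀ * S (n + 1) ^ 2 := by positivity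
    simp only [D]
    linarith
  · refine le_trans ?_ hDs
    rw [Finset.mul_sum, Finset.mul_sum]
    refine Finset.sum_le_sum fun n _ => ?_
    have : 0 ≤ 1 / 2 * ‖et (n + 1) - g n‖ ^ 2 + Δt * ν * A (n + 1) ^ 2 := by positivity
    simp only [D]
    linarith

end

section
variable {X : Type} [NormedAddCommGroup X] [NormedSpace ℝ X]

/-- Increments of exponentially weighted averages of small quantities. -/
lemma sum_norm_increment_le {θ : ℝ} (hθ0 : 0 ≤ θ) (hθ1 : θ ≤ 1) {ψ g : ℕ → X} (h0 : ψ 0 = 0)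
    (h : ∀ n, ψ (n + 1) = (1 - θ) • (ψ n + g n)) (N : ℕ) :
    ∑ n ∈ Finset.range N, ‖ψ (n + 1) - ψ n‖ ≤ 2 * ∑ n ∈ Finset.range N, ‖g n‖ := by
  have h1 := sum_average_le hθ0 hθ1 (x := fun n => ‖ψ n‖) (b := fun n => ‖g n‖)
    (fun n => norm_nonneg _) (fun n => norm_nonneg _) (N := N) (fun n _ => by
      rw [h n, norm_smul, Real.norm_of_nonneg (by linarith)]
      have := norm_add_le (ψ n) (g n)
      have : 0 ≤ 1 - θ := by linarith
      gcongr)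
  rw [h0, norm_zero, zero_add, Finset.sum_range_succ] at h1
  have h2 : ∑ n ∈ Finset.range N, ‖ψ (n + 1) - ψ n‖
      ≤ ∑ n ∈ Finset.range N, (θ * ‖ψ n‖ + ‖g n‖) := by
    refine Finset.sum_le_sum fun n _ => ?_
    have e : ψ (n + 1) - ψ n = -(θ • ψ n) + (1 - θ) • g n := by
      rw [h n]
      module
    rw [e]
    refine (norm_add_le _ _).trans ?_
    rw [norm_neg, norm_smul, norm_smul, Real.norm_of_nonneg hθ0,
      Real.norm_of_nonneg (by linarith)]
    have := mul_nonneg hθ0 (norm_nonneg (g n))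
    linarith
  rw [Finset.sum_add_distrib, ← Finset.mul_sum] at h2
  have := mul_nonneg hθ0 (norm_nonneg (ψ N))
  linarith

/-- Increments of exponentially weighted averages of slowly varying quantities. -/
lemma sum_norm_increment_le_of_increment {θ : ℝ} (hθ0 : 0 ≤ θ) (hθ1 : θ ≤ 1) {ψ g : ℕ → X}
    (h0 : ψ 0 = 0) (h : ∀ n, ψ (n + 1) = (1 - θ) • (ψ n + g n)) (N : ℕ) :
    θ * ∑ n ∈ Finset.range (N + 1), ‖ψ (n + 1) - ψ n‖
      ≤ ‖g 0‖ + ∑ n ∈ Finset.range N, ‖g (n + 1) - g n‖ := by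
  refine (sum_average_le hθ0 hθ1 (x := fun n => ‖ψ (n + 1) - ψ n‖)
    (b := fun n => ‖g (n + 1) - g n‖) (fun n => norm_nonneg _) (fun n => norm_nonneg _)
    (N := N) (fun n _ => ?_)).trans ?_
  · have e : ψ (n + 1 + 1) - ψ (n + 1)
        = (1 - θ) • ((ψ (n + 1) - ψ n) + (g (n + 1) - g n)) := by
      rw [h (n + 1), ← sub_eq_zero]
      nth_rewrite 2 [h n]
      module
    rw [e, norm_smul, Real.norm_of_nonneg (by linarith)]
    have := norm_add_le (ψ (n + 1) - ψ n) (g (n + 1) - g n)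
    have : 0 ≤ 1 - θ := by linarith
    gcongr
  · have e : ψ (0 + 1) - ψ 0 = (1 - θ) • g 0 := by rw [h 0, h0, sub_zero, zero_add]
    rw [e, norm_smul, Real.norm_of_nonneg (by linarith)]
    have := mul_nonneg hθ0 (norm_nonneg (g 0))
    linarith

/-- Increments of exponentially weighted averages of bounded quantities. -/
lemma norm_increment_le {θ R : ℝ} (hθ0 : 0 ≤ θ) (hθ1 : θ ≤ 1) {ρ r : ℕ → X} {N : ℕ}
    (h0 : ρ 0 = r 0) (h : ∀ n, ρ (n + 1) = (1 - θ) • ρ n + θ • r (n + 1))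
    (hr : ∀ n ≤ N, ‖r n‖ ≤ R) : ∀ n < N, ‖ρ (n + 1) - ρ n‖ ≤ 2 * θ * R := by
  have key : ∀ n ≤ N, ‖ρ n‖ ≤ R := by
    intro n
    induction n with
    | zero => intro h1; rw [h0]; exact hr 0 h1
    | succ n ih =>
      intro h1
      rw [h n]
      refine (norm_add_le _ _).trans ?_
      rw [norm_smul, norm_smul, Real.norm_of_nonneg hθ0, Real.norm_of_nonneg (by linarith)]
      nlinarith [mul_le_mul_of_nonneg_left (ih (by omega)) (by linarith : 0 ≤ 1 - θ),
        mul_le_mul_of_nonneg_left (hr _ h1) hθ0]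
  intro n hn
  have e : ρ (n + 1) - ρ n = θ • (r (n + 1) - ρ n) := by
    rw [h n]
    module
  rw [e, norm_smul, Real.norm_of_nonneg hθ0]
  have h1 := norm_sub_le (r (n + 1)) (ρ n)
  have h2 := hr (n + 1) hn
  have h3 := key n hn.le
  nlinarith

end

/-! ### The exact solution: continuity in time -/

lemma TimeBound.integral_mono_interval {T M : ℝ} {φ : ℝ → ℝ} (h : TimeBound T M φ) {a b a' b' : ℝ}
    (ha : a ∈ Icc 0 T) (hb : b ∈ Icc 0 T) (h1 : a ≤ a') (h2 : a' ≤ b') (h3 : b' ≤ b) :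
    ∫ t in a'..b', φ t ≤ ∫ t in a..b, φ t :=
  intervalIntegral.integral_mono_interval h1 h2 h3
    (Filter.Eventually.of_forall fun t => h.nonneg t) (intervalIntegrable_of_Ioo h.integrableOn ha hb)

section
variable {X : Type} [NormedAddCommGroup X] [NormedSpace ℝ X] [CompleteSpace X] {T M : ℝ}

/-- First order Taylor expansion in time. -/
lemma norm_sub_smul_deriv_le {g D : ℝ → X} {φ : ℝ → ℝ} (hD : ContinuousOn D (Icc 0 T))
    (hg : ∀ a ∈ Icc 0 T, ∀ b ∈ Icc 0 T, g b - g a = ∫ t in a..b, D t) (hφ : TimeBound T M φ)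
    (h : ∀ a ∈ Icc 0 T, ∀ b ∈ Icc 0 T, a ≤ b → ‖D b - D a‖ ≤ ∫ t in a..b, φ t) {a b c : ℝ}
    (ha : a ∈ Icc 0 T) (hb : b ∈ Icc 0 T) (hab : a ≤ b) (hc : c ∈ Icc a b) :
    ‖g b - g a - (b - a) • D c‖ ≤ (b - a) * ∫ t in a..b, φ t := by
  have hc' : c ∈ Icc 0 T := ⟨ha.1.trans hc.1, hc.2.trans hb.2⟩
  have h1 : g b - g a - (b - a) • D c = ∫ t in a..b, (D t - D c) := by
    rw [intervalIntegral.integral_sub (hD.mono (uIcc_subset_Icc ha hb)).intervalIntegrable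
      intervalIntegrable_const, intervalIntegral.integral_const, hg a ha b hb]
  rw [h1]
  refine (intervalIntegral.norm_integral_le_of_norm_le_const (C := ∫ t in a..b, φ t)
    fun t ht => ?_).trans_eq ?_
  · have ht1 : t ∈ Icc a b := by
      rw [uIoc_of_le hab] at ht
      exact Ioc_subset_Icc_self ht
    have ht' : t ∈ Icc 0 T := ⟨ha.1.trans ht1.1, ht1.2.trans hb.2⟩
    rcases le_total c t with hct | htc
    · exact (h c hc' t ht' hct).trans (hφ.integral_mono_interval ha hb hc.1 hct ht1.2)
    · rw [norm_sub_rev]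
      exact (h t ht' c hc' htc).trans (hφ.integral_mono_interval ha hb ht1.1 htc hc.2)
  · rw [abs_of_nonneg (by linarith), mul_comm]

lemma norm_deriv_le (hT : 0 < T) (hM : 0 ≤ M) {D : ℝ → X} {φ φ' : ℝ → ℝ}
    (hD : ContinuousOn D (Icc 0 T)) (hφ : TimeBound T M φ)
    (h : ∀ a ∈ Icc 0 T, ∀ b ∈ Icc 0 T, a ≤ b → ‖D b - D a‖ ≤ ∫ t in a..b, φ t)
    (hφ' : TimeBound T M φ')
    (h' : ∀ a ∈ Icc 0 T, ∀ b ∈ Icc 0 T, a ≤ b → ∫ t in a..b, ‖D t‖ ≤ ∫ t in a..b, φ' t)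
    {c : ℝ} (hc : c ∈ Icc 0 T) : ‖D c‖ ≤ √T * M / T + √T * M := by
  have h0 : (0 : ℝ) ∈ Icc 0 T := ⟨le_rfl, hT.le⟩
  have h1 : T ∈ Icc 0 T := ⟨hT.le, le_rfl⟩
  have hi : IntervalIntegrable (fun t => ‖D t‖) volume 0 T :=
    (hD.mono (uIcc_subset_Icc h0 h1)).norm.intervalIntegrable
  have e1 : ∫ t in (0 : ℝ)..T, ‖D c‖ ≤ ∫ t in (0 : ℝ)..T, (‖D t‖ + √T * M) := by
    refine intervalIntegral.integral_mono_on hT.le intervalIntegrable_const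
      (hi.add intervalIntegrable_const) fun t ht => ?_
    have e2 : ‖D c - D t‖ ≤ √T * M := by
      rcases le_total c t with hct | htc
      · rw [norm_sub_rev]
        exact (h c hc t ht hct).trans (hφ.integral_le hM hc ht hct)
      · exact (h t ht c hc htc).trans (hφ.integral_le hM ht hc htc)
    calc ‖D c‖ = ‖D t + (D c - D t)‖ := by rw [add_sub_cancel]
      _ ≤ ‖D t‖ + ‖D c - D t‖ := norm_add_le _ _
      _ ≤ _ := by gcongr
  rw [intervalIntegral.integral_add hi intervalIntegrable_const, intervalIntegral.integral_const,
    intervalIntegral.integral_const, smul_eq_mul, smul_eq_mul, sub_zero] at e1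
  have e3 := (h' 0 h0 T h1 hT.le).trans (hφ'.integral_le hM h0 h1 hT.le)
  have e4 : T * ‖D c‖ ≤ √T * M + T * (√T * M) := by linarith
  have e5 : ‖D c‖ ≤ (√T * M + T * (√T * M)) / T := by
    rw [le_div_iff₀ hT, mul_comm]
    exact e4
  refine e5.trans_eq ?_
  field_simp

end

section
variable {d : ℕ} {Ω : Set (Eu d)} {T M : ℝ}

lemma CTimeSobLe.exists_lift (hΩ : IsOpen Ω) (hb : Bornology.IsBounded Ω) {F : Type}
    [NormedAddCommGroup F] [NormedSpace ℝ F] [CompleteSpace F] {m : ℕ} (hm : 1 ≤ m)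
    {g : ℝ → Sob 1 2 Ω F} (h : CTimeSobLe T m M (fun t => val (g t))) :
    ∃ U : ℝ → Sob m 2 Ω F, (∀ t ∈ Icc 0 T, val (U t) = val (g t)) ∧
      (∀ t ∈ Icc 0 T, ‖U t‖ ≤ M) ∧ ContinuousOn g (Icc 0 T) ∧ ∀ t ∈ Icc 0 T, ‖g t‖ ≤ M := by
  obtain ⟨U, h1, h2, h3⟩ := h
  have h4 : ∀ t ∈ Icc 0 T, g t = resSob hm (U t) := fun t ht =>
    val_injective hΩ hb ((h1 t ht).symm.trans (val_resSob hm (U t)).symm)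
  refine ⟨U, h1, h3, ?_, fun t ht => ?_⟩
  · exact ((resSob hm).continuous.comp_continuousOn h2).congr h4
  · rw [h4 t ht]
    exact (norm_resSob_le hm _).trans (h3 t ht)

variable {k : ℕ} {ν : ℝ} {w : ℝ → Sob 1 ∞ Ω (Eu d)} {f : ℝ → LpΩ 2 Ω (Eu d)}
  {u0 : LpΩ 2 Ω (Eu d)} {u : ℝ → Sob 1 2 Ω (Eu d)} {p : ℝ → Sob 1 2 Ω ℝ}

lemma Regularity.nonneg (reg : Regularity T k M w u p) (hT : 0 < T) : 0 ≤ M :=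
  (norm_nonneg _).trans (reg.w_C.2 0 ⟨le_rfl, hT.le⟩)

lemma Regularity.semiW_le_semiCW (reg : Regularity T k M w u p) {t : ℝ} (ht : t ∈ Icc 0 T) :
    semiW (w t) ≤ semiCW T w := by
  refine le_csSup ⟨√d * M, ?_⟩ ⟨t, ht, rfl⟩
  rintro _ ⟨r, hr, rfl⟩
  have := reg.w_C.2 r hr
  exact (semiW_le _).trans (by gcongr)

lemma continuousOn_conv (hw : ContinuousOn w (Icc 0 T)) (hu : ContinuousOn u (Icc 0 T)) :
    ContinuousOn (fun t => conv (val (w t)) (u t)) (Icc 0 T) := by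
  intro t ht
  have hw' : ContinuousWithinAt (fun t => val (w t)) (Icc 0 T) t :=
    val.continuous.continuousAt.comp_continuousWithinAt (hw t ht)
  refine tendsto_iff_norm_sub_tendsto_zero.2 (squeeze_zero (fun _ => norm_nonneg _)
    (g := fun r => ‖val (w r) - val (w t)‖ * ‖u r‖ + ‖val (w t)‖ * ‖u r - u t‖) (fun r => ?_) ?_)
  · rw [conv_sub]
    exact (norm_add_le _ _).trans (add_le_add (norm_conv_le _ _) (norm_conv_le _ _))
  · have h1 : Filter.Tendsto (fun r => ‖val (w r) - val (w t)‖) (nhdsWithin t (Icc 0 T)) (nhds 0) :=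
      tendsto_iff_norm_sub_tendsto_zero.1 hw'
    have h2 : Filter.Tendsto (fun r => ‖u r - u t‖) (nhdsWithin t (Icc 0 T)) (nhds 0) :=
      tendsto_iff_norm_sub_tendsto_zero.1 (hu t ht)
    have h3 := (h1.mul (hu t ht).norm).add (h2.const_mul ‖val (w t)‖)
    simpa using h3

lemma IsOseenSolution.mem_Vdiv (hΩ : IsOpen Ω) (hb : Bornology.IsBounded Ω) (hT : 0 < T)
    (sol : IsOseenSolution T ν w f u0 u p) (hu : ContinuousOn u (Icc 0 T)) {t : ℝ}
    (ht : t ∈ Icc 0 T) : u t ∈ Vdiv Ω := by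
  refine ⟨sol.mem_u t ht, ?_⟩
  have h1 : EqOn (fun t => dvg (u t)) (fun _ => 0) (Ioo 0 T) := fun t ht =>
    inner_self_eq_zero.1 (sol.mass t ht _
      (dvg_mem_L20 hΩ hb (sol.mem_u t (Ioo_subset_Icc_self ht))))
  exact h1.of_subset_closure (dvg.continuous.comp_continuousOn hu) continuousOn_const
    Ioo_subset_Icc_self (by rw [closure_Ioo hT.ne]) ht

lemma continuous_gradInner (v : Sob 1 2 Ω (Eu d)) : Continuous fun u => gradInner u v := by
  unfold gradInner
  exact continuous_finsetSum _ fun i _ => (pd i).continuous.inner continuous_const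

/-- The momentum equation holds up to the endpoints of the time interval. -/
lemma IsOseenSolution.momentum_Icc (hT : 0 < T) (sol : IsOseenSolution T ν w f u0 u p)
    (hf : ContinuousOn f (Icc 0 T)) (hw : ContinuousOn w (Icc 0 T)) (hu : ContinuousOn u (Icc 0 T))
    (hp : ContinuousOn p (Icc 0 T)) {D : ℝ → LpΩ 2 Ω (Eu d)} (hD : ContinuousOn D (Icc 0 T))
    (hD' : ∀ t ∈ Ioo 0 T, HasDerivAt (fun r => val (u r)) (D t) t) {t : ℝ} (ht : t ∈ Icc 0 T)
    {v : Sob 1 2 Ω (Eu d)} (hv : v ∈ H10 Ω (Eu d)) :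
    inner ℝ (D t + conv (val (w t)) (u t)) (val v) + ν * gradInner (u t) v
      + inner ℝ (grad (p t)) (val v) = inner ℝ (f t) (val v) := by
  have h1 : EqOn (fun t => inner ℝ (D t + conv (val (w t)) (u t)) (val v) + ν * gradInner (u t) v
      + inner ℝ (grad (p t)) (val v)) (fun t => inner ℝ (f t) (val v)) (Ioo 0 T) := by
    intro t ht
    obtain ⟨du, hdu, h⟩ := sol.momentum t ht
    have h2 := h v hv
    rw [hdu.unique (hD' t ht), convInner_eq, ← inner_add_left] at h2
    exact h2
  refine h1.of_subset_closure ?_ (hf.inner continuousOn_const) Ioo_subset_Icc_self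
    (by rw [closure_Ioo hT.ne]) ht
  exact (((hD.add (continuousOn_conv hw hu)).inner continuousOn_const).add
    (continuousOn_const.mul ((continuous_gradInner v).comp_continuousOn hu))).add
    ((grad.continuous.comp_continuousOn hp).inner continuousOn_const)

end

/-! ### Consistency of the time discretization -/

section
variable {d : ℕ} {Ω : Set (Eu d)} {T M : ℝ}
variable {k : ℕ} {ν : ℝ} {w : ℝ → Sob 1 ∞ Ω (Eu d)} {f : ℝ → LpΩ 2 Ω (Eu d)}
  {u0 : LpΩ 2 Ω (Eu d)} {u : ℝ → Sob 1 2 Ω (Eu d)} {p : ℝ → Sob 1 2 Ω ℝ} {Δt : ℝ} {N : ℕ}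

/-- The exact solution satisfies the time-discrete momentum equation up to a residual of first order
in time. -/
lemma exists_residual (hΩ : IsOpen Ω) (hb : Bornology.IsBounded Ω) (hT : 0 < T) (hk : 1 ≤ k)
    (hf : ContinuousOn f (Icc 0 T)) (sol : IsOseenSolution T ν w f u0 u p)
    (reg : Regularity T k M w u p) (hΔ : 0 < Δt) (hN : N * Δt ≤ T) {K : ℝ} (hK : 0 ≤ K)
    {C : ℕ → LpΩ 2 Ω (Eu d) →ₗ[ℝ] LpΩ 2 Ω (Eu d)}
    (hC : ∀ n < N, ∀ g : Sob 2 2 Ω (Eu d), ‖val g - C n (val g)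
      - Δt • conv (val (w (n * Δt))) (resSob one_le_two g)‖ ≤ Δt ^ 2 * K * ‖g‖) :
    ∃ R : ℕ → LpΩ 2 Ω (Eu d),
      (∑ n ∈ Finset.range N, ‖R n‖ ≤ Δt * (√T * M + 2 * (√T * M * M) + K * M * T)) ∧
      ∀ n < N, ∀ v ∈ H10 Ω (Eu d),
        inner ℝ (val (u ((n + 1 : ℕ) * Δt)) - C n (val (u (n * Δt)))) (val v)
          + Δt * ν * gradInner (u ((n + 1 : ℕ) * Δt)) v
          + Δt * inner ℝ (grad (p ((n + 1 : ℕ) * Δt))) (val v)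
        = Δt * inner ℝ (f ((n + 1 : ℕ) * Δt)) (val v) - inner ℝ (R n) (val v) := by
  have hM := reg.nonneg hT
  obtain ⟨U, hU, hUM, huc, huM⟩ := reg.u_C.exists_lift hΩ hb (by omega : 1 ≤ k + 1)
  obtain ⟨-, -, -, hpc, -⟩ := reg.p_C.exists_lift hΩ hb (by omega : 1 ≤ k + 1)
  have hvc : ContinuousOn (fun t => val (u t)) (Icc 0 T) := val.continuous.comp_continuousOn huc
  obtain ⟨D, hD, hD', hDg, ⟨φ2, hφ2, hφ2'⟩, -⟩ := (reg.u_Z2 2 le_rfl).exists_deriv hT hvc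
  obtain ⟨φ1, hφ1, hφ1'⟩ := (reg.u_Z2 1 one_le_two).exists_increment hT hvc
  have hwc : ContinuousOn (fun t => val (w t)) (Icc 0 T) :=
    val.continuous.comp_continuousOn reg.w_C.1
  obtain ⟨φw, hφw, hφw'⟩ := HTimeLe.exists_increment (X := LpΩ ∞ Ω (Eu d)) hT hwc reg.w_H1
  refine ⟨fun n => Δt • (D ((n + 1 : ℕ) * Δt)
    + conv (val (w ((n + 1 : ℕ) * Δt))) (u ((n + 1 : ℕ) * Δt)))
    - (val (u ((n + 1 : ℕ) * Δt)) - C n (val (u (n * Δt)))), ?_, ?_⟩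
  · have key : ∀ n ∈ Finset.range N, ‖Δt • (D ((n + 1 : ℕ) * Δt)
        + conv (val (w ((n + 1 : ℕ) * Δt))) (u ((n + 1 : ℕ) * Δt)))
        - (val (u ((n + 1 : ℕ) * Δt)) - C n (val (u (n * Δt))))‖
        ≤ Δt * TimeBound.step φ2 Δt n + Δt * (TimeBound.step φw Δt n * M
          + M * TimeBound.step φ1 Δt n) + Δt ^ 2 * K * M := by
      intro n hn
      have hn' := Finset.mem_range.1 hn
      have ha := TimeBound.mem_Icc hΔ hN hn'.le
      have hb' := TimeBound.mem_Icc hΔ hN hn'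
      have hab : (n : ℝ) * Δt ≤ ((n + 1 : ℕ) : ℝ) * Δt := by push_cast; nlinarith
      have e1 := norm_sub_smul_deriv_le hD hDg hφ2 hφ2' ha hb' hab (right_mem_Icc.2 hab)
      have e0 : ((n + 1 : ℕ) : ℝ) * Δt - n * Δt = Δt := by push_cast; ring
      rw [e0] at e1
      have e2 : ‖conv (val (w ((n + 1 : ℕ) * Δt))) (u ((n + 1 : ℕ) * Δt))
          - conv (val (w (n * Δt))) (u (n * Δt))‖
          ≤ TimeBound.step φw Δt n * M + M * TimeBound.step φ1 Δt n := by
        rw [conv_sub]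
        refine (norm_add_le _ _).trans (add_le_add ((norm_conv_le _ _).trans ?_)
          ((norm_conv_le _ _).trans ?_))
        · exact mul_le_mul (hφw' _ ha _ hb' hab) (huM _ hb') (norm_nonneg _)
            (hφw.step_nonneg hΔ n)
        · refine mul_le_mul ((norm_val_top_le _).trans (reg.w_C.2 _ ha)) ?_ (norm_nonneg _) hM
          obtain ⟨v, hv, hv'⟩ := hφ1' _ ha _ hb' hab
          have : v = u ((n + 1 : ℕ) * Δt) - u (n * Δt) :=
            val_injective hΩ hb (by rw [hv, map_sub])
          rw [← this]
          exact hv'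
      have e3 := hC n hn' (resSob (by omega : 2 ≤ k + 1) (U (n * Δt)))
      have e4 : resSob one_le_two (resSob (by omega : 2 ≤ k + 1) (U (n * Δt))) = u (n * Δt) :=
        val_injective hΩ hb (hU _ ha)
      rw [e4, val_resSob, hU _ ha] at e3
      have e5 : ‖resSob (by omega : 2 ≤ k + 1) (U (n * Δt))‖ ≤ M :=
        (norm_resSob_le _ _).trans (hUM _ ha)
      have e6 : Δt • (D ((n + 1 : ℕ) * Δt)
          + conv (val (w ((n + 1 : ℕ) * Δt))) (u ((n + 1 : ℕ) * Δt)))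
          - (val (u ((n + 1 : ℕ) * Δt)) - C n (val (u (n * Δt))))
          = -(val (u ((n + 1 : ℕ) * Δt)) - val (u (n * Δt)) - Δt • D ((n + 1 : ℕ) * Δt))
            + Δt • (conv (val (w ((n + 1 : ℕ) * Δt))) (u ((n + 1 : ℕ) * Δt))
              - conv (val (w (n * Δt))) (u (n * Δt)))
            - (val (u (n * Δt)) - C n (val (u (n * Δt)))
              - Δt • conv (val (w (n * Δt))) (u (n * Δt))) := by module
      rw [e6]
      refine (norm_sub_le _ _).trans (add_le_add ((norm_add_le _ _).trans (add_le_add ?_ ?_)) ?_)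
      · rw [norm_neg]
        exact e1
      · rw [norm_smul, Real.norm_of_nonneg hΔ.le]
        gcongr
      · exact e3.trans (by gcongr)
    refine (Finset.sum_le_sum key).trans ?_
    simp only [Finset.sum_add_distrib, ← Finset.mul_sum, ← Finset.sum_mul, Finset.sum_const,
      Finset.card_range, nsmul_eq_mul]
    have s1 := hφ2.sum_step hM hΔ hN
    have s2 := hφ1.sum_step hM hΔ hN
    have s3 := hφw.sum_step hM hΔ hN
    have s4 := mul_le_mul_of_nonneg_left s1 hΔ.le
    have s5 := mul_le_mul_of_nonneg_left (mul_le_mul_of_nonneg_left s2 hM) hΔ.le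
    have s6 := mul_le_mul_of_nonneg_left (mul_le_mul_of_nonneg_left s3 hM) hΔ.le
    have s7 := mul_le_mul_of_nonneg_left hN (by positivity : 0 ≤ Δt * (K * M))
    linarith
  · intro n hn v hv
    have h1 := sol.momentum_Icc hT hf reg.w_C.1 huc hpc hD hD' (TimeBound.mem_Icc hΔ hN hn) hv
    rw [inner_sub_left (Δt • _), real_inner_smul_left, ← h1]
    ring

/-- The velocity has first differences of first order in time, uniformly, and its second differences
are summable with a bound of first order. -/
lemma second_difference_le (hΩ : IsOpen Ω) (hb : Bornology.IsBounded Ω) (hT : 0 < T)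
    (reg : Regularity T k M w u p) (hΔ : 0 < Δt) (hN : (N + 1 : ℕ) * Δt ≤ T) :
    ‖val (u ((0 + 1 : ℕ) * Δt)) - val (u ((0 : ℕ) * Δt))‖
        ≤ Δt * (√T * M / T + √T * M + √T * M) ∧
      ∑ n ∈ Finset.range N, ‖(val (u ((n + 1 + 1 : ℕ) * Δt)) - val (u ((n + 1 : ℕ) * Δt)))
        - (val (u ((n + 1 : ℕ) * Δt)) - val (u (n * Δt)))‖ ≤ Δt * (2 * (√T * M)) := by
  have hM := reg.nonneg hT
  obtain ⟨-, -, -, huc, -⟩ := reg.u_C.exists_lift hΩ hb (by omega : 1 ≤ k + 1)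
  have hvc : ContinuousOn (fun t => val (u t)) (Icc 0 T) := val.continuous.comp_continuousOn huc
  obtain ⟨D, hD, -, hDg, ⟨φ, hφ, hφ'⟩, ⟨ψ, hψ, hψ'⟩⟩ := (reg.u_Z2 2 le_rfl).exists_deriv hT hvc
  have e0 : ∀ n : ℕ, ((n + 1 : ℕ) : ℝ) * Δt - n * Δt = Δt := fun n => by push_cast; ring
  have hab : ∀ n : ℕ, (n : ℝ) * Δt ≤ ((n + 1 : ℕ) : ℝ) * Δt := fun n => by push_cast; nlinarith
  have hm : ∀ n ≤ N + 1, (n : ℝ) * Δt ∈ Icc 0 T := fun n hn => TimeBound.mem_Icc hΔ hN hn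
  have taylor : ∀ n ≤ N, ∀ c ∈ Icc ((n : ℝ) * Δt) (((n + 1 : ℕ) : ℝ) * Δt),
      ‖val (u ((n + 1 : ℕ) * Δt)) - val (u (n * Δt)) - Δt • D c‖ ≤ Δt * TimeBound.step φ Δt n := by
    intro n hn c hc
    have e1 := norm_sub_smul_deriv_le hD hDg hφ hφ' (hm n (by omega)) (hm (n + 1) (by omega))
      (hab n) hc
    rwa [e0] at e1
  constructor
  · have h1 := taylor 0 (Nat.zero_le _) _ (left_mem_Icc.2 (hab 0))
    have h2 := norm_deriv_le hT hM hD hφ hφ' hψ hψ' (hm 0 (Nat.zero_le _))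
    have h3 : TimeBound.step φ Δt 0 ≤ √T * M :=
      hφ.integral_le hM (hm 0 (Nat.zero_le _)) (hm 1 (by omega)) (hab 0)
    have h4 := norm_add_le (val (u ((0 + 1 : ℕ) * Δt)) - val (u ((0 : ℕ) * Δt))
      - Δt • D ((0 : ℕ) * Δt)) (Δt • D ((0 : ℕ) * Δt))
    rw [sub_add_cancel, norm_smul, Real.norm_of_nonneg hΔ.le] at h4
    refine h4.trans ?_
    have h5 := mul_le_mul_of_nonneg_left h2 hΔ.le
    have h6 := mul_le_mul_of_nonneg_left h3 hΔ.le
    exact (add_le_add (h1.trans h6) h5).trans_eq (by ring)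
  · have key : ∀ n ∈ Finset.range N,
        ‖(val (u ((n + 1 + 1 : ℕ) * Δt)) - val (u ((n + 1 : ℕ) * Δt)))
        - (val (u ((n + 1 : ℕ) * Δt)) - val (u (n * Δt)))‖
        ≤ Δt * TimeBound.step φ Δt n + Δt * TimeBound.step φ Δt (n + 1) := by
      intro n hn
      have hn' := Finset.mem_range.1 hn
      have h1 := taylor n hn'.le _ (right_mem_Icc.2 (hab n))
      have h2 := taylor (n + 1) hn' _ (left_mem_Icc.2 (hab (n + 1)))
      have h3 := norm_sub_le (val (u ((n + 1 + 1 : ℕ) * Δt)) - val (u ((n + 1 : ℕ) * Δt))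
          - Δt • D ((n + 1 : ℕ) * Δt))
        (val (u ((n + 1 : ℕ) * Δt)) - val (u (n * Δt)) - Δt • D ((n + 1 : ℕ) * Δt))
      rw [sub_sub_sub_cancel_right] at h3
      linarith
    refine (Finset.sum_le_sum key).trans ?_
    rw [Finset.sum_add_distrib, ← Finset.mul_sum, ← Finset.mul_sum]
    have s1 := hφ.sum_step hM hΔ hN
    have s2 := s1
    rw [Finset.sum_range_succ] at s1
    rw [Finset.sum_range_succ'] at s2
    have s3 := hφ.step_nonneg hΔ N
    have s4 := hφ.step_nonneg hΔ 0
    have s5 : ∑ n ∈ Finset.range N, TimeBound.step φ Δt n ≤ √T * M := by linarith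
    have s6 : ∑ n ∈ Finset.range N, TimeBound.step φ Δt (n + 1) ≤ √T * M := by linarith
    have s7 := mul_le_mul_of_nonneg_left s5 hΔ.le
    have s8 := mul_le_mul_of_nonneg_left s6 hΔ.le
    linarith

end

/-! ### The averaged interpolant of the velocity -/

section
variable {d : ℕ} {Ω : Set (Eu d)} {𝒯 : Triangulation Ω} {k : ℕ} {c : ℝ}
  {s : LinearMap.BilinForm ℝ (Qh 𝒯 k)} {Pr : LpΩ 2 Ω ℝ → Qh 𝒯 k} {I : Sob 1 2 Ω (Eu d) → Vh 𝒯 k}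

lemma Triangulation.h_nonneg (𝒯 : Triangulation Ω) : 0 ≤ 𝒯.h := by
  refine Real.sSup_nonneg ?_
  rintro _ ⟨K, -, rfl⟩
  exact Metric.diam_nonneg

lemma Triangulation.h_le_diam (hb : Bornology.IsBounded Ω) (𝒯 : Triangulation Ω) :
    𝒯.h ≤ Metric.diam (closure Ω) := by
  refine Real.sSup_le ?_ Metric.diam_nonneg
  rintro _ ⟨K, hK, rfl⟩
  refine Metric.diam_mono ?_ hb.closure
  rw [← 𝒯.union_eq]
  exact subset_biUnion_of_mem (u := fun K : Finset (Eu d) => convexHull ℝ (K : Set (Eu d))) hK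

lemma semi_nonneg {m : ℕ} {F : Type} [NormedAddCommGroup F] [NormedSpace ℝ F] [CompleteSpace F]
    (v : Sob m 2 Ω F) : 0 ≤ semi v := Real.sqrt_nonneg _

lemma weightedSq_nonneg (v : Sob 1 2 Ω (Eu d)) : 0 ≤ weightedSq 𝒯 v :=
  Finset.sum_nonneg fun _ _ => mul_nonneg (sq_nonneg _) (integral_nonneg fun _ => sq_nonneg _)

lemma StabHyp.mono {c' : ℝ} (hcc : c ≤ c') (hs : StabHyp 𝒯 k c s Pr I) :
    StabHyp 𝒯 k c' s Pr I := by
  have hh := 𝒯.h_nonneg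
  refine ⟨hs.symm, hs.nonneg, fun q => (hs.bounded q).trans (by gcongr), ?_, ?_, ?_, ?_⟩
  · intro q hq r hr q' hq'
    obtain ⟨h1, h2⟩ := hs.pr_approx q hq r hr q' hq'
    exact ⟨h1.trans (by gcongr), h2.trans (by gcongr)⟩
  · intro r hr q hq
    exact (hs.pr_stable r hr q hq).trans (by gcongr)
  · intro v hv q
    have : 0 ≤ snorm s q := Real.sqrt_nonneg _
    exact (hs.i_div v hv q).trans (by gcongr)
  · intro v hv r hr hr' v' hv'
    obtain ⟨h1, h2, h3⟩ := hs.i_approx v hv r hr hr' v' hv'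
    have := semi_nonneg v'
    exact ⟨h1.trans (by gcongr), h2.trans (by gcongr), h3.trans (by gcongr)⟩

/-- `v` has `H^1` norm at most `Y`, and so has its divergence, in the dual of the seminorm of the
stabilization. -/
def IsSmall (s : LinearMap.BilinForm ℝ (Qh 𝒯 k)) (v : Sob 1 2 Ω (Eu d)) (Y : ℝ) : Prop :=
  ‖v‖ ≤ Y ∧ ∀ q : Qh 𝒯 k, |inner ℝ (dvg v) (val q.1)| ≤ Y * snorm s q

lemma IsSmall.nonneg {v : Sob 1 2 Ω (Eu d)} {Y : ℝ} (h : IsSmall s v Y) : 0 ≤ Y :=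
  (norm_nonneg v).trans h.1

lemma IsSmall.mono {v : Sob 1 2 Ω (Eu d)} {Y Z : ℝ} (h : IsSmall s v Y) (hYZ : Y ≤ Z) :
    IsSmall s v Z :=
  ⟨h.1.trans hYZ, fun q => (h.2 q).trans (mul_le_mul_of_nonneg_right hYZ (Real.sqrt_nonneg _))⟩

lemma IsSmall.add {v w : Sob 1 2 Ω (Eu d)} {Y Z : ℝ} (hv : IsSmall s v Y) (hw : IsSmall s w Z) :
    IsSmall s (v + w) (Y + Z) := by
  refine ⟨(norm_add_le _ _).trans (add_le_add hv.1 hw.1), fun q => ?_⟩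
  rw [map_add, inner_add_left, add_mul]
  exact (abs_add_le _ _).trans (add_le_add (hv.2 q) (hw.2 q))

lemma IsSmall.smul {v : Sob 1 2 Ω (Eu d)} {Y a : ℝ} (ha : 0 ≤ a) (hv : IsSmall s v Y) :
    IsSmall s (a • v) (a * Y) := by
  refine ⟨?_, fun q => ?_⟩
  · rw [norm_smul, Real.norm_of_nonneg ha]
    exact mul_le_mul_of_nonneg_left hv.1 ha
  · rw [map_smul, real_inner_smul_left, abs_mul, abs_of_nonneg ha, mul_assoc]
    exact mul_le_mul_of_nonneg_left (hv.2 q) ha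

lemma StabHyp.isSmall_sub (hs : StabHyp 𝒯 k c s Pr I) (hc : 0 ≤ c) {v : Sob 1 2 Ω (Eu d)}
    (hv : v ∈ Vdiv Ω) {r : ℕ} (hr : 1 ≤ r) (hrk : r ≤ k) {v' : Sob (r + 1) 2 Ω (Eu d)}
    (hv' : val v' = val v) {R : ℝ} (hR : ‖v'‖ ≤ R) :
    IsSmall s (v - (I v).1) ((1 + c + 2 * c ^ 2) * 𝒯.h ^ r * R) := by
  obtain ⟨-, h2, h3⟩ := hs.i_approx v hv r hr hrk v' hv'
  have hh := 𝒯.h_nonneg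
  have hsemi : semi v' ≤ R := (semi_le_norm v').trans hR
  have hR0 : 0 ≤ R := (norm_nonneg _).trans hR
  have h2' : ‖v - (I v).1‖ ≤ c * 𝒯.h ^ r * R := h2.trans (by gcongr)
  have h3' : √(weightedSq 𝒯 (v - (I v).1)) ≤ c * 𝒯.h ^ r * R := h3.trans (by gcongr)
  have h4 : √(weightedSq 𝒯 (v - (I v).1) + ‖v - (I v).1‖ ^ 2) ≤ 2 * (c * 𝒯.h ^ r * R) := by
    rw [Real.sqrt_le_left (by positivity), ← Real.sq_sqrt (weightedSq_nonneg (𝒯 := 𝒯) _)]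
    have e1 := pow_le_pow_left₀ (norm_nonneg _) h2' 2
    have e2 := pow_le_pow_left₀ (Real.sqrt_nonneg _) h3' 2
    nlinarith
  have h5 : 0 ≤ 𝒯.h ^ r * R := by positivity
  refine ⟨h2'.trans ?_, fun q => (hs.i_div v hv q).trans ?_⟩
  · rw [mul_assoc, mul_assoc]
    gcongr
    nlinarith
  · have h6 : 0 ≤ snorm s q := Real.sqrt_nonneg _
    refine mul_le_mul_of_nonneg_right ?_ h6
    refine (mul_le_mul_of_nonneg_left h4 hc).trans ?_
    nlinarith

lemma isSmall_of_mem_Vdiv {v : Sob 1 2 Ω (Eu d)} (hv : v ∈ Vdiv Ω) {R : ℝ} (hR : ‖v‖ ≤ R) :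
    IsSmall s v R := by
  refine ⟨hR, fun q => ?_⟩
  rw [hv.2, inner_zero_left, abs_zero]
  exact mul_nonneg ((norm_nonneg _).trans hR) (Real.sqrt_nonneg _)

/-- Exponentially weighted averages in time of the interpolants `I u^n`, corrected by interpolants
`J` of the increments of `u`. -/
def average (θ : ℝ) (I J : Sob 1 2 Ω (Eu d) → Vh 𝒯 k) (u : ℕ → Sob 1 2 Ω (Eu d)) : ℕ → Vh 𝒯 k
  | 0 => I (u 0)
  | n + 1 => (1 - θ) • average θ I J u n + θ • I (u (n + 1)) + (1 - θ) • J (u (n + 1) - u n)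

lemma sub_average_succ (θ : ℝ) (I J : Sob 1 2 Ω (Eu d) → Vh 𝒯 k) (u : ℕ → Sob 1 2 Ω (Eu d))
    (n : ℕ) : u (n + 1) - (average θ I J u (n + 1)).1
      = (1 - θ) • ((u n - (average θ I J u n).1)
        + ((u (n + 1) - u n) - (J (u (n + 1) - u n)).1)) + θ • (u (n + 1) - (I (u (n + 1))).1) := by
  simp only [average, Submodule.coe_add, Submodule.coe_smul]
  module

set_option maxHeartbeats 1000000 in
/-- The discrete approximation of the velocity. The increments in time of the interpolants `I u^n`
are not controlled since `I` is not linear. The approximation `û` relaxes to them over a time of the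
order of `h`, and is advanced by `J` of the increments of `u`. These are bounded in `H^k`, so that
`J = I` is a good choice if `k ≥ 2`. If `k = 1` there is no approximation property for them, and
`J = 0`; then the increments of `u - û` are small by the bound for the second differences of `u`. -/
lemma exists_average (hs : StabHyp 𝒯 k c s Pr I) (hc : 0 ≤ c) (hk : 1 ≤ k) {H : ℝ} (hH : 1 ≤ H)
    (hh : 𝒯.h ≤ H) {Δt T M C2 S1 : ℝ} (hΔ : 0 < Δt) {N : ℕ} (hN1 : 1 ≤ N) (hN : N * Δt ≤ T)
    (hM : 0 ≤ M) {u : ℕ → Sob 1 2 Ω (Eu d)} (hu : ∀ n ≤ N, u n ∈ Vdiv Ω)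
    (hU : ∀ n ≤ N, ∃ U : Sob (k + 1) 2 Ω (Eu d), val U = val (u n) ∧ ‖U‖ ≤ M) {σ : ℕ → ℝ}
    (hσ0 : ∀ n, 0 ≤ σ n) (hσ1 : ∑ n ∈ Finset.range N, σ n ≤ S1)
    (hσ2 : ∑ n ∈ Finset.range N, σ n ^ 2 ≤ Δt * M ^ 2) (hC2 : 0 ≤ C2)
    (hδ : ∀ n < N, ∃ δ : Sob k 2 Ω (Eu d), val δ = val (u (n + 1)) - val (u n) ∧ ‖δ‖ ≤ σ n)
    (hΩ : IsOpen Ω) (hb : Bornology.IsBounded Ω)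
    (h2 : ‖val (u (0 + 1)) - val (u 0)‖ + ∑ n ∈ Finset.range (N - 1),
      ‖(val (u (n + 1 + 1)) - val (u (n + 1))) - (val (u (n + 1)) - val (u n))‖ ≤ Δt * C2) :
    ∃ (û : ℕ → Vh 𝒯 k) (Y : ℕ → ℝ), û 0 = I (u 0) ∧ (∀ n ≤ N, IsSmall s (u n - (û n).1) (Y n)) ∧
      Δt * ∑ n ∈ Finset.range (N + 1), Y n
        ≤ (1 + c + 2 * c ^ 2) * (2 * T * M + S1 * H ^ k) * (Δt + 𝒯.h ^ k) ∧
      Δt * ∑ n ∈ Finset.range (N + 1), Y n ^ 2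
        ≤ (1 + c + 2 * c ^ 2) ^ 2 * (4 * T + 2 * (H ^ k) ^ 2) * M ^ 2 * (Δt + 𝒯.h ^ k) ^ 2 ∧
      ∑ n ∈ Finset.range N, ‖val (u (n + 1) - (û (n + 1)).1) - val (u n - (û n).1)‖
        ≤ (2 * T * c * M + 2 * c * S1 + C2) * (Δt + 𝒯.h ^ k) ∧
      ‖val (u 0 - (û 0).1)‖ ≤ c * H * M * 𝒯.h ^ k := by
  have hh0 := 𝒯.h_nonneg
  set h := 𝒯.h
  set τ := Δt + h ^ k
  set c1 := 1 + c + 2 * c ^ 2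
  have hc1 : 1 ≤ c1 := by simp only [c1]; nlinarith [sq_nonneg c]
  have hH0 : 0 ≤ H := by linarith
  have hT : 0 < T := by
    have : (1 : ℝ) ≤ N := by exact_mod_cast hN1
    nlinarith
  have hN1' : ((N : ℝ) + 1) * Δt ≤ 2 * T := by
    have : (1 : ℝ) ≤ N := by exact_mod_cast hN1
    nlinarith
  have hS1 : 0 ≤ S1 := (Finset.sum_nonneg fun n _ => hσ0 n).trans hσ1
  obtain ⟨l, rfl⟩ : ∃ l, k = l + 1 := ⟨k - 1, by omega⟩
  have hθp : 0 < h + Δt := by linarith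
  set θ := Δt / (h + Δt)
  have hθ0 : 0 < θ := by positivity
  have hθ1 : θ ≤ 1 := (div_le_one hθp).2 (by linarith)
  have hθ : (h + Δt) * θ = Δt := by simp only [θ]; field_simp
  have hθh : θ * h ≤ Δt := by nlinarith
  have hhl : h ^ l ≤ H ^ (l + 1) :=
    (pow_le_pow_left₀ hh0 hh l).trans (pow_le_pow_right₀ hH (Nat.le_succ l))
  have hτ : (h + Δt) * h ^ l ≤ H ^ (l + 1) * τ := by
    have e1 : 1 ≤ H ^ (l + 1) := one_le_pow₀ hH
    have e2 : (h + Δt) * h ^ l = h ^ (l + 1) + Δt * h ^ l := by ring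
    have e3 := mul_le_mul_of_nonneg_left hhl hΔ.le
    have e4 : h ^ (l + 1) ≤ H ^ (l + 1) * h ^ (l + 1) := le_mul_of_one_le_left (by positivity) e1
    simp only [τ]
    nlinarith
  have hτ0 : 0 < τ := by positivity
  have hhτ : h ^ (l + 1) ≤ τ := by simp only [τ]; linarith
  -- with `k = l + 1` the case `k = 1` is `l = 0`
  set J : Sob 1 2 Ω (Eu d) → Vh 𝒯 (l + 1) := if l = 0 then fun _ => 0 else I
  set û := average θ I J u
  set g : ℕ → Sob 1 2 Ω (Eu d) := fun n => (u (n + 1) - u n) - (J (u (n + 1) - u n)).1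
  set r : ℕ → Sob 1 2 Ω (Eu d) := fun n => u n - (I (u n)).1
  set B := c1 * h ^ (l + 1) * M
  have hB : 0 ≤ B := by positivity
  have hr : ∀ n ≤ N, IsSmall s (r n) B := by
    intro n hn
    obtain ⟨U, hU1, hU2⟩ := hU n hn
    exact hs.isSmall_sub hc (hu n hn) (by omega) le_rfl hU1 hU2
  have hdiff : ∀ n < N, u (n + 1) - u n ∈ Vdiv Ω := fun n hn =>
    ⟨Submodule.sub_mem _ (hu (n + 1) hn).1 (hu n hn.le).1, by
      rw [map_sub, (hu (n + 1) hn).2, (hu n hn.le).2, sub_zero]⟩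
  have hg : ∀ n < N, IsSmall s (g n) (c1 * h ^ l * σ n) := by
    intro n hn
    obtain ⟨δ, hδ1, hδ2⟩ := hδ n hn
    rw [← map_sub] at hδ1
    by_cases hl : l = 0
    · subst hl
      have e1 : δ = u (n + 1) - u n := val_injective hΩ hb hδ1
      have e2 : g n = u (n + 1) - u n := by simp [g, J]
      rw [e2, pow_zero, mul_one]
      refine isSmall_of_mem_Vdiv (hdiff n hn) ?_
      rw [← e1]
      exact hδ2.trans (le_mul_of_one_le_left (hσ0 n) hc1)
    · have e2 : g n = (u (n + 1) - u n) - (I (u (n + 1) - u n)).1 := by simp [g, J, hl]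
      rw [e2]
      exact hs.isSmall_sub hc (hdiff n hn) (Nat.one_le_iff_ne_zero.2 hl) (Nat.le_succ l) hδ1 hδ2
  -- a majorant of the averages of `δ - J δ` for the increments `δ` of `u`
  let y : ℕ → ℝ := fun n => Nat.rec 0 (fun n x => (1 - θ) * (x + c1 * h ^ l * σ n)) n
  have hy0 : y 0 = 0 := rfl
  have hy : ∀ n, y (n + 1) = (1 - θ) * (y n + c1 * h ^ l * σ n) := fun n => rfl
  have hγ0 : ∀ n, 0 ≤ c1 * h ^ l * σ n := fun n => by have := hσ0 n; positivity
  have hyn : ∀ n, 0 ≤ y n := by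
    intro n
    induction n with
    | zero => exact le_rfl
    | succ n ih =>
      rw [hy]
      exact mul_nonneg (by linarith) (add_nonneg ih (hγ0 n))
  have hχ : ∀ n ≤ N, IsSmall s (u n - (û n).1) (B + y n) := by
    intro n
    induction n with
    | zero => intro hn; rw [hy0, add_zero]; exact hr 0 hn
    | succ n ih =>
      intro hn
      rw [sub_average_succ]
      refine ((((ih (by omega)).add (hg n hn)).smul (by linarith : 0 ≤ 1 - θ)).add
        ((hr (n + 1) hn).smul hθ0.le)).mono (le_of_eq ?_)
      rw [hy]
      ring
  have hsum1 : Δt * ∑ n ∈ Finset.range (N + 1), y n ≤ c1 * S1 * (H ^ (l + 1) * τ) := by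
    have e1 := sum_average_le hθ0.le hθ1 hyn hγ0 (N := N) (fun n _ => (hy n).le)
    rw [hy0, zero_add, ← Finset.mul_sum] at e1
    calc Δt * ∑ n ∈ Finset.range (N + 1), y n
        = (h + Δt) * (θ * ∑ n ∈ Finset.range (N + 1), y n) := by rw [← mul_assoc, hθ]
      _ ≤ (h + Δt) * (c1 * h ^ l * ∑ n ∈ Finset.range N, σ n) := by gcongr
      _ ≤ (h + Δt) * (c1 * h ^ l * S1) := by gcongr
      _ = c1 * S1 * ((h + Δt) * h ^ l) := by ring
      _ ≤ _ := by gcongr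
  have hsum2 : Δt * ∑ n ∈ Finset.range (N + 1), y n ^ 2 ≤ c1 ^ 2 * M ^ 2 * (H ^ (l + 1) * τ) ^ 2 := by
    have e1 := sum_sq_average_le hθ0 hθ1 hy0 (N := N) (fun n _ => hy n)
    simp only [mul_pow, ← Finset.mul_sum] at e1
    have e2 : Δt * (Δt * ∑ n ∈ Finset.range (N + 1), y n ^ 2)
        ≤ Δt * (c1 ^ 2 * M ^ 2 * (H ^ (l + 1) * τ) ^ 2) := by
      calc Δt * (Δt * ∑ n ∈ Finset.range (N + 1), y n ^ 2)
          = (h + Δt) ^ 2 * (θ ^ 2 * ∑ n ∈ Finset.range (N + 1), y n ^ 2) := by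
            rw [← mul_assoc, ← mul_assoc, ← mul_pow, hθ, sq]
        _ ≤ (h + Δt) ^ 2 * (c1 ^ 2 * (h ^ l) ^ 2 * ∑ n ∈ Finset.range N, σ n ^ 2) := by gcongr
        _ ≤ (h + Δt) ^ 2 * (c1 ^ 2 * (h ^ l) ^ 2 * (Δt * M ^ 2)) := by gcongr
        _ = Δt * (c1 ^ 2 * M ^ 2 * ((h + Δt) * h ^ l) ^ 2) := by ring
        _ ≤ _ := by gcongr
    exact le_of_mul_le_mul_left e2 hΔ
  refine ⟨û, fun n => B + y n, rfl, hχ, ?_, ?_, ?_, ?_⟩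
  · rw [Finset.sum_add_distrib, Finset.sum_const, Finset.card_range, nsmul_eq_mul, mul_add]
    have e1 : Δt * (((N + 1 : ℕ) : ℝ) * B) ≤ 2 * T * (c1 * τ * M) := by
      calc Δt * (((N + 1 : ℕ) : ℝ) * B) = (((N : ℝ) + 1) * Δt) * B := by push_cast; ring
        _ ≤ 2 * T * (c1 * τ * M) := by
          simp only [B]
          gcongr
    calc _ ≤ 2 * T * (c1 * τ * M) + c1 * S1 * (H ^ (l + 1) * τ) := add_le_add e1 hsum1
      _ = _ := by ring
  · have e1 : ∑ n ∈ Finset.range (N + 1), (B + y n) ^ 2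
        ≤ ∑ n ∈ Finset.range (N + 1), (2 * B ^ 2 + 2 * y n ^ 2) :=
      Finset.sum_le_sum fun n _ => by nlinarith [sq_nonneg (B - y n)]
    rw [Finset.sum_add_distrib, Finset.sum_const, Finset.card_range, nsmul_eq_mul,
      ← Finset.mul_sum] at e1
    have e2 : (((N : ℝ) + 1) * Δt) * (2 * B ^ 2) ≤ 2 * T * (2 * (c1 * τ * M) ^ 2) := by
      simp only [B]
      gcongr
    calc _ ≤ Δt * (((N + 1 : ℕ) : ℝ) * (2 * B ^ 2)
          + 2 * ∑ n ∈ Finset.range (N + 1), y n ^ 2) := by gcongr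
      _ = (((N : ℝ) + 1) * Δt) * (2 * B ^ 2) + 2 * (Δt * ∑ n ∈ Finset.range (N + 1), y n ^ 2) := by
          push_cast; ring
      _ ≤ 2 * T * (2 * (c1 * τ * M) ^ 2) + 2 * (c1 ^ 2 * M ^ 2 * (H ^ (l + 1) * τ) ^ 2) := by
          gcongr
      _ = _ := by ring
  · -- the increments of the two parts of the error: `ψ` averages `δ - J δ` for the increments `δ` of
    -- `u`, and `ρ` averages the interpolation errors
    let ψ : ℕ → LpΩ 2 Ω (Eu d) := fun n => Nat.rec 0 (fun n x => (1 - θ) • (x + val (g n))) n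
    let ρ : ℕ → LpΩ 2 Ω (Eu d) := fun n =>
      Nat.rec (val (r 0)) (fun n x => (1 - θ) • x + θ • val (r (n + 1))) n
    have hψ0 : ψ 0 = 0 := rfl
    have hψ : ∀ n, ψ (n + 1) = (1 - θ) • (ψ n + val (g n)) := fun n => rfl
    have hρ : ∀ n, ρ (n + 1) = (1 - θ) • ρ n + θ • val (r (n + 1)) := fun n => rfl
    have hsplit : ∀ n, val (u n - (û n).1) = ψ n + ρ n := by
      intro n
      induction n with
      | zero => rw [hψ0, zero_add]; rfl
      | succ n ih =>
        rw [sub_average_succ, map_add, map_smul, map_add, ih, hψ, hρ, map_smul]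
        module
    have hrL : ∀ n ≤ N, ‖val (r n)‖ ≤ c * h ^ (l + 1 + 1) * M := by
      intro n hn
      obtain ⟨U, hU1, hU2⟩ := hU n hn
      have e1 := (hs.i_approx (u n) (hu n hn) (l + 1) (by omega) le_rfl U hU1).1
      simp only [r, map_sub]
      exact e1.trans (by gcongr; exact (semi_le_norm U).trans hU2)
    have hρs : ∑ n ∈ Finset.range N, ‖ρ (n + 1) - ρ n‖ ≤ 2 * T * c * M * τ := by
      have e1 := norm_increment_le (r := fun n => val (r n)) hθ0.le hθ1 (rfl : ρ 0 = val (r 0)) hρ hrL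
      refine (Finset.sum_le_sum fun n hn => e1 n (Finset.mem_range.1 hn)).trans ?_
      rw [Finset.sum_const, Finset.card_range, nsmul_eq_mul]
      calc (N : ℝ) * (2 * θ * (c * h ^ (l + 1 + 1) * M))
          = N * (θ * h) * (2 * (c * h ^ (l + 1) * M)) := by ring
        _ ≤ N * Δt * (2 * (c * h ^ (l + 1) * M)) := by gcongr
        _ ≤ T * (2 * (c * τ * M)) := by gcongr
        _ = _ := by ring
    have hψs : ∑ n ∈ Finset.range N, ‖ψ (n + 1) - ψ n‖ ≤ (2 * c * S1 + C2) * τ := by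
      by_cases hl : l = 0
      · have e2 : ∀ n, val (g n) = val (u (n + 1)) - val (u n) := by
          intro n
          simp [g, J, hl]
        have e3 := sum_norm_increment_le_of_increment hθ0.le hθ1 hψ0 hψ (N - 1)
        rw [Nat.sub_add_cancel hN1] at e3
        simp only [e2] at e3
        have e4 : ∑ n ∈ Finset.range N, ‖ψ (n + 1) - ψ n‖ ≤ (h + Δt) * C2 := by
          refine le_of_mul_le_mul_left ?_ hθ0
          calc _ ≤ Δt * C2 := e3.trans h2
            _ = θ * ((h + Δt) * C2) := by rw [← mul_assoc, mul_comm θ, hθ]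
        have e5 : h + Δt = τ := by simp [τ, hl, add_comm]
        rw [e5] at e4
        refine e4.trans ?_
        have : 0 ≤ 2 * c * S1 * τ := by positivity
        linarith
      · have e1 : ∀ n ∈ Finset.range N, ‖val (g n)‖ ≤ c * h ^ (l + 1) * σ n := by
          intro n hn
          have hn' := Finset.mem_range.1 hn
          obtain ⟨δ, hδ1, hδ2⟩ := hδ n hn'
          rw [← map_sub] at hδ1
          have e2 : g n = (u (n + 1) - u n) - (I (u (n + 1) - u n)).1 := by simp [g, J, hl]
          rw [e2, map_sub]
          refine (hs.i_approx _ (hdiff n hn') l (Nat.one_le_iff_ne_zero.2 hl) (Nat.le_succ l)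
            δ hδ1).1.trans ?_
          gcongr
          exact (semi_le_norm δ).trans hδ2
        refine (sum_norm_increment_le hθ0.le hθ1 hψ0 hψ N).trans ?_
        have e2 := Finset.sum_le_sum e1
        rw [← Finset.mul_sum] at e2
        calc _ ≤ 2 * (c * h ^ (l + 1) * ∑ n ∈ Finset.range N, σ n) := by gcongr
          _ ≤ 2 * (c * τ * S1) := by
            have := Finset.sum_nonneg fun n (_ : n ∈ Finset.range N) => hσ0 n
            gcongr
          _ ≤ _ := by
            have : 0 ≤ C2 * τ := by positivity
            linarith
    have e1 : ∑ n ∈ Finset.range N, ‖val (u (n + 1) - (û (n + 1)).1) - val (u n - (û n).1)‖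
        ≤ ∑ n ∈ Finset.range N, (‖ψ (n + 1) - ψ n‖ + ‖ρ (n + 1) - ρ n‖) := by
      refine Finset.sum_le_sum fun n _ => ?_
      rw [hsplit, hsplit, add_sub_add_comm]
      exact norm_add_le _ _
    rw [Finset.sum_add_distrib] at e1
    calc _ ≤ (2 * c * S1 + C2) * τ + 2 * T * c * M * τ := e1.trans (add_le_add hψs hρs)
      _ = _ := by ring
  · obtain ⟨U, hU1, hU2⟩ := hU 0 (Nat.zero_le N)
    have e1 := (hs.i_approx (u 0) (hu 0 (Nat.zero_le N)) (l + 1) (by omega) le_rfl U hU1).1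
    have e2 : val (u 0 - (û 0).1) = val (u 0) - val (I (u 0)).1 := map_sub _ _ _
    rw [e2]
    refine e1.trans ?_
    have e3 : semi U ≤ M := (semi_le_norm U).trans hU2
    calc c * h ^ (l + 1 + 1) * semi U ≤ c * h ^ (l + 1 + 1) * M := by gcongr
      _ = c * h * M * h ^ (l + 1) := by ring
      _ ≤ _ := by gcongr

end

/-! ### The error equations -/

section
variable {d : ℕ} {Ω : Set (Eu d)}

lemma gradInner_sub_left (u u' v : Sob 1 2 Ω (Eu d)) :
    gradInner (u - u') v = gradInner u v - gradInner u' v := by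
  simp only [gradInner, map_sub, inner_sub_left, Finset.sum_sub_distrib]

lemma gradInner_self_nonneg (v : Sob 1 2 Ω (Eu d)) : 0 ≤ gradInner v v :=
  Finset.sum_nonneg fun _ _ => real_inner_self_nonneg

lemma gradNorm_sq (v : Sob 1 2 Ω (Eu d)) : gradNorm v ^ 2 = gradInner v v :=
  Real.sq_sqrt (gradInner_self_nonneg v)

lemma gradNorm_nonneg (v : Sob 1 2 Ω (Eu d)) : 0 ≤ gradNorm v := Real.sqrt_nonneg _

lemma gradNorm_le_norm (v : Sob 1 2 Ω (Eu d)) : gradNorm v ≤ ‖v‖ :=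
  (Real.sqrt_le_left (norm_nonneg v)).2 (gradInner_self_le v)

lemma gradNorm_eq (v : Sob 1 2 Ω (Eu d)) :
    gradNorm v = ‖WithLp.toLp 2 (fun i : Fin d => pd i v)‖ := by
  rw [gradNorm, PiLp.norm_eq_of_L2]
  simp only [gradInner, real_inner_self_eq_norm_sq]

lemma gradNorm_sub_le (u v : Sob 1 2 Ω (Eu d)) : gradNorm (u - v) ≤ gradNorm u + gradNorm v := by
  simp only [gradNorm_eq]
  refine le_trans (le_of_eq ?_) (norm_sub_le _ _)
  congr 1

lemma gradInner_le (u v : Sob 1 2 Ω (Eu d)) : gradInner u v ≤ gradNorm u * gradNorm v := by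
  have h := real_inner_le_norm (WithLp.toLp 2 (fun i : Fin d => pd i u))
    (WithLp.toLp 2 (fun i : Fin d => pd i v))
  rw [← gradNorm_eq, ← gradNorm_eq, PiLp.inner_apply] at h
  exact h

/-- The momentum equation for the error. -/
lemma momentum_error {Δt ν : ℝ} (hΔ : 0 < Δt) {ut' u' û' u û z : Sob 1 2 Ω (Eu d)}
    {ph p' ps ps' : Sob 1 2 Ω ℝ} {C : LpΩ 2 Ω (Eu d) →ₗ[ℝ] LpΩ 2 Ω (Eu d)}
    {f R : LpΩ 2 Ω (Eu d)}
    (h1 : (inner ℝ (val ut') (val (ut' - û')) - inner ℝ (C (val z)) (val (ut' - û'))) / Δt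
      + ν * gradInner ut' (ut' - û') + inner ℝ (grad ph) (val (ut' - û'))
      = inner ℝ f (val (ut' - û')))
    (h2 : inner ℝ (val u' - C (val u)) (val (ut' - û')) + Δt * ν * gradInner u' (ut' - û')
      + Δt * inner ℝ (grad p') (val (ut' - û'))
      = Δt * inner ℝ f (val (ut' - û')) - inner ℝ R (val (ut' - û'))) :
    inner ℝ (val (ut' - û') - C (val (z - û))) (val (ut' - û'))
      + Δt * ν * gradInner (ut' - û') (ut' - û')
      + Δt * inner ℝ (grad (ph - ps) - grad (ps' - ps)) (val (ut' - û'))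
    = inner ℝ (R + (val (u' - û') - val (u - û)) - (C (val (u - û)) - val (u - û))
        + Δt • grad (p' - ps')) (val (ut' - û'))
      + Δt * ν * gradInner (u' - û') (ut' - û') := by
  set v := ut' - û' with hv
  have e1 : inner ℝ (val ut') (val v) - inner ℝ (C (val z)) (val v)
      + Δt * ν * gradInner ut' v + Δt * inner ℝ (grad ph) (val v) = Δt * inner ℝ f (val v) := by
    rw [← h1]
    field_simp
  have e2 : gradInner v v = gradInner ut' v - gradInner û' v := by
    rw [← gradInner_sub_left, ← hv]
  have e3 : val v = val ut' - val û' := by rw [hv, map_sub]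
  have e4 : inner ℝ (val v - C (val (z - û))) (val v)
      = inner ℝ (val ut') (val v) - inner ℝ (val û') (val v) - inner ℝ (C (val z)) (val v)
        + inner ℝ (C (val û)) (val v) := by
    nth_rewrite 1 [e3]
    simp only [map_sub, inner_sub_left]
    ring
  rw [e2, e4]
  simp only [map_sub, inner_sub_left, inner_add_left, real_inner_smul_left,
    gradInner_sub_left] at h2 ⊢
  linear_combination e1 - h2

end

section
variable {d : ℕ} {Ω : Set (Eu d)} {𝒯 : Triangulation Ω} {k : ℕ} {c : ℝ}
  {s : LinearMap.BilinForm ℝ (Qh 𝒯 k)} {Pr : LpΩ 2 Ω ℝ → Qh 𝒯 k} {I : Sob 1 2 Ω (Eu d) → Vh 𝒯 k}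

lemma snorm_nonneg (q : Qh 𝒯 k) : 0 ≤ snorm s q := Real.sqrt_nonneg _

lemma StabHyp.abs_le (hs : StabHyp 𝒯 k c s Pr I) (q r : Qh 𝒯 k) :
    |s q r| ≤ snorm s q * snorm s r := by
  rw [snorm, snorm, ← Real.sqrt_mul (hs.nonneg q)]
  refine Real.abs_le_sqrt ?_
  exact LinearMap.BilinForm.apply_sq_le_of_symm s hs.nonneg ⟨hs.symm⟩ q r

/-- The mass equation for the error. -/
lemma mass_error (hs : StabHyp 𝒯 k c s Pr I) (hΩ : IsOpen Ω) (hb : Bornology.IsBounded Ω)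
    {δ₀ Y Z : ℝ} (hδ : 0 ≤ δ₀) {u' û' : Sob 1 2 Ω (Eu d)} {uh : LpΩ 2 Ω (Eu d)} {ph ps : Qh 𝒯 k}
    (hu' : dvg u' = 0) (hû' : û' ∈ H10 Ω (Eu d)) (hχ : IsSmall s (u' - û') Y)
    (hp : snorm s ps ≤ Z) (hZ : 0 ≤ Z)
    (h : inner ℝ uh (grad (ph - ps).1) - δ₀ * s ph (ph - ps) = 0) :
    δ₀ * snorm s (ph - ps) ^ 2 - (δ₀ + 1) * ((Z + Y) * snorm s (ph - ps))
      ≤ inner ℝ (uh - val û') (grad (ph - ps).1) := by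
  set ε := ph - ps with hε
  have e1 := inner_dvg_eq_neg_inner_grad hΩ hb hû' ε.1
  have e2 : dvg û' = -dvg (u' - û') := by rw [map_sub, hu', zero_sub, neg_neg]
  rw [e2, inner_neg_left] at e1
  have e3 : s ph ε = s ε ε + s ps ε := by
    rw [← LinearMap.add_apply, ← map_add, hε, sub_add_cancel]
  have e4 : snorm s ε ^ 2 = s ε ε := Real.sq_sqrt (hs.nonneg ε)
  have e5 := (abs_le.1 (hs.abs_le ps ε)).1
  have e6 := (abs_le.1 (hχ.2 ε)).2
  have e7 := snorm_nonneg (s := s) ε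
  have e8 := mul_le_mul_of_nonneg_right hp e7
  have e9 : -(Z * snorm s ε) ≤ s ps ε := by linarith
  have e10 := mul_le_mul_of_nonneg_left e9 hδ
  have e11 := mul_nonneg (mul_nonneg hδ hχ.nonneg) e7
  have e12 := mul_nonneg hZ e7
  rw [inner_sub_left, e4]
  rw [e3] at h
  linarith

lemma norm_val_sub_le_of_isProjVh {y : LpΩ 2 Ω (Eu d)} {z û : Sob 1 2 Ω (Eu d)}
    (hz : IsProjVh 𝒯 k y z) (hû : û ∈ Vh 𝒯 k) : ‖val (z - û)‖ ≤ ‖y - val û‖ := by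
  have hm : z - û ∈ Vh 𝒯 k := Submodule.sub_mem _ hz.1 hû
  have h1 : ‖val (z - û)‖ ^ 2 = inner ℝ (y - val û) (val (z - û)) := by
    rw [← real_inner_self_eq_norm_sq]
    nth_rewrite 1 [map_sub]
    rw [inner_sub_left, inner_sub_left, hz.2 _ hm]
  have h2 := real_inner_le_norm (y - val û) (val (z - û))
  rw [← h1, sq] at h2
  by_contra hcon
  rw [not_le] at hcon
  have := (norm_nonneg _).trans_lt hcon
  nlinarith

lemma sum_Icc_one (f : ℕ → ℝ) (N : ℕ) :
    ∑ n ∈ Finset.Icc 1 N, f n = ∑ n ∈ Finset.range N, f (n + 1) := by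
  induction N with
  | zero => simp
  | succ N ih => rw [Finset.sum_Icc_succ_top (by omega), ih, Finset.sum_range_succ]

end

/-! ### Approximation of the exact solution -/

lemma le_sq_one_add_sqrt {ν δ₀ : ℝ} (hν : 0 < ν) (hδ : 0 < δ₀) :
    1 ≤ 1 + √ν + √δ₀ + (√δ₀)⁻¹ ∧ ν ≤ (1 + √ν + √δ₀ + (√δ₀)⁻¹) ^ 2 ∧
      (δ₀ + 1) ^ 2 / δ₀ ≤ (1 + √ν + √δ₀ + (√δ₀)⁻¹) ^ 2 := by
  have h1 := Real.sqrt_nonneg ν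
  have h2 := Real.sqrt_pos.2 hδ
  have h3 : 0 ≤ (√δ₀)⁻¹ := by positivity
  refine ⟨by linarith, ?_, ?_⟩
  · nth_rewrite 1 [← Real.sq_sqrt hν.le]
    gcongr
    linarith
  · have e : (δ₀ + 1) ^ 2 / δ₀ = (√δ₀ + (√δ₀)⁻¹) ^ 2 := by
      nth_rewrite 1 2 [← Real.sq_sqrt hδ.le]
      field_simp
    rw [e]
    gcongr
    linarith

section
variable {d : ℕ} {Ω : Set (Eu d)} {T M : ℝ}
variable {k : ℕ} {ν : ℝ} {w : ℝ → Sob 1 ∞ Ω (Eu d)} {f : ℝ → LpΩ 2 Ω (Eu d)}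
  {u0 : LpΩ 2 Ω (Eu d)} {u : ℝ → Sob 1 2 Ω (Eu d)} {p : ℝ → Sob 1 2 Ω ℝ} {Δt : ℝ} {N : ℕ}
  {𝒯 : Triangulation Ω} {c : ℝ} {s : LinearMap.BilinForm ℝ (Qh 𝒯 k)} {Pr : LpΩ 2 Ω ℝ → Qh 𝒯 k}
  {I : Sob 1 2 Ω (Eu d) → Vh 𝒯 k}

lemma pressure_approx (hΩ : IsOpen Ω) (hb : Bornology.IsBounded Ω)
    (sol : IsOseenSolution T ν w f u0 u p) (reg : Regularity T k M w u p) (hc : 0 ≤ c)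
    (hs : StabHyp 𝒯 k c s Pr I) {t : ℝ} (ht : t ∈ Icc 0 T) :
    ‖p t - (Pr (val (p t))).1‖ ≤ c * 𝒯.h ^ k * M ∧ snorm s (Pr (val (p t))) ≤ c * 𝒯.h ^ k * M := by
  have hh := 𝒯.h_nonneg
  obtain ⟨P, hP1, hP2, -, -⟩ := reg.p_C.exists_lift hΩ hb (by omega : 1 ≤ k + 1)
  constructor
  · refine (hs.pr_approx (p t) (sol.mem_p t ht) k le_rfl (P t) (hP1 t ht)).2.trans ?_
    have := hP2 t ht
    gcongr
  · have e1 : val (resSob (Nat.le_succ k) (P t)) = val (p t) := hP1 t ht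
    have e2 := hs.pr_stable k le_rfl (resSob (Nat.le_succ k) (P t)) (by
      rw [e1]
      exact sol.mem_p t ht)
    rw [e1] at e2
    refine e2.trans ?_
    have := (norm_resSob_le (Nat.le_succ k) (P t)).trans (hP2 t ht)
    gcongr

lemma sum_pressure_increment (hΩ : IsOpen Ω) (hb : Bornology.IsBounded Ω) (hT : 0 < T)
    (sol : IsOseenSolution T ν w f u0 u p) (reg : Regularity T k M w u p) (hc : 0 ≤ c)
    (hs : StabHyp 𝒯 k c s Pr I) (hΔ : 0 < Δt) (hN : N * Δt ≤ T) :
    Δt * ∑ n ∈ Finset.range N, ‖grad ((Pr (val (p ((n + 1 : ℕ) * Δt)))).1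
      - (Pr (val (p (n * Δt)))).1)‖ ^ 2
      ≤ (2 * M ^ 2 + 8 * T * (c * M) ^ 2) * (Δt + 𝒯.h ^ k) ^ 2 := by
  have hh := 𝒯.h_nonneg
  have hM := reg.nonneg hT
  obtain ⟨-, -, -, hpc, -⟩ := reg.p_C.exists_lift hΩ hb (by omega : 1 ≤ k + 1)
  have hvc : ContinuousOn (fun t => val (p t)) (Icc 0 T) := val.continuous.comp_continuousOn hpc
  obtain ⟨φ, hφ, hφ'⟩ := reg.p_H1.exists_increment hT hvc
  have key : ∀ n ∈ Finset.range N, ‖grad ((Pr (val (p ((n + 1 : ℕ) * Δt)))).1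
      - (Pr (val (p (n * Δt)))).1)‖ ^ 2
      ≤ 2 * TimeBound.step φ Δt n ^ 2 + 8 * (c * 𝒯.h ^ k * M) ^ 2 := by
    intro n hn
    have hn' := Finset.mem_range.1 hn
    have ha := TimeBound.mem_Icc hΔ hN hn'.le
    have hb' := TimeBound.mem_Icc hΔ hN hn'
    have hab : (n : ℝ) * Δt ≤ ((n + 1 : ℕ) : ℝ) * Δt := by push_cast; nlinarith
    obtain ⟨v, hv, hv'⟩ := hφ' _ ha _ hb' hab
    have e1 : v = p ((n + 1 : ℕ) * Δt) - p (n * Δt) :=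
      val_injective hΩ hb (by rw [hv, map_sub])
    rw [e1] at hv'
    have e2 := (pressure_approx hΩ hb sol reg hc hs ha).1
    have e3 := (pressure_approx hΩ hb sol reg hc hs hb').1
    have e4 : (Pr (val (p ((n + 1 : ℕ) * Δt)))).1 - (Pr (val (p (n * Δt)))).1
        = (p ((n + 1 : ℕ) * Δt) - p (n * Δt))
          - (p ((n + 1 : ℕ) * Δt) - (Pr (val (p ((n + 1 : ℕ) * Δt)))).1)
          + (p (n * Δt) - (Pr (val (p (n * Δt)))).1) := by abel
    have e5 : ‖grad ((Pr (val (p ((n + 1 : ℕ) * Δt)))).1 - (Pr (val (p (n * Δt)))).1)‖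
        ≤ TimeBound.step φ Δt n + c * 𝒯.h ^ k * M + c * 𝒯.h ^ k * M := by
      refine (norm_grad_le _).trans ?_
      rw [e4]
      exact (norm_add_le _ _).trans (add_le_add ((norm_sub_le _ _).trans (add_le_add hv' e3)) e2)
    have e6 := pow_le_pow_left₀ (norm_nonneg _) e5 2
    nlinarith [sq_nonneg (TimeBound.step φ Δt n - 2 * (c * 𝒯.h ^ k * M))]
  have e1 := Finset.sum_le_sum key
  rw [Finset.sum_add_distrib, ← Finset.mul_sum, Finset.sum_const, Finset.card_range,
    nsmul_eq_mul] at e1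
  have e2 := hφ.sum_step_sq hΔ hN
  have e3 : (0 : ℝ) ≤ 𝒯.h ^ k := by positivity
  have e4 : Δt ≤ Δt + 𝒯.h ^ k := by linarith
  have e5 : 𝒯.h ^ k ≤ Δt + 𝒯.h ^ k := by linarith
  calc _ ≤ Δt * (2 * ∑ n ∈ Finset.range N, TimeBound.step φ Δt n ^ 2
        + N * (8 * (c * 𝒯.h ^ k * M) ^ 2)) := by gcongr
    _ ≤ Δt * (2 * (Δt * M ^ 2) + N * (8 * (c * 𝒯.h ^ k * M) ^ 2)) := by gcongr
    _ = 2 * M ^ 2 * Δt ^ 2 + 8 * (N * Δt) * (c * M) ^ 2 * (𝒯.h ^ k) ^ 2 := by ring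
    _ ≤ 2 * M ^ 2 * (Δt + 𝒯.h ^ k) ^ 2 + 8 * T * (c * M) ^ 2 * (Δt + 𝒯.h ^ k) ^ 2 := by gcongr
    _ = _ := by ring

end

section
variable {d : ℕ} {Ω : Set (Eu d)} {T M : ℝ}
variable {k : ℕ} {ν : ℝ} {w : ℝ → Sob 1 ∞ Ω (Eu d)} {f : ℝ → LpΩ 2 Ω (Eu d)}
  {u0 : LpΩ 2 Ω (Eu d)} {u : ℝ → Sob 1 2 Ω (Eu d)} {p : ℝ → Sob 1 2 Ω ℝ} {Δt : ℝ} {N : ℕ}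
  {𝒯 : Triangulation Ω} {c : ℝ} {s : LinearMap.BilinForm ℝ (Qh 𝒯 k)} {Pr : LpΩ 2 Ω ℝ → Qh 𝒯 k}
  {I : Sob 1 2 Ω (Eu d) → Vh 𝒯 k}

/-- The averaged interpolant of `exists_average` for the velocity at the time levels `n Δt`. -/
lemma exists_velocity_average (hΩ : IsOpen Ω) (hb : Bornology.IsBounded Ω) (hT : 0 < T)
    (hk : 1 ≤ k) (sol : IsOseenSolution T ν w f u0 u p) (reg : Regularity T k M w u p)
    (hc : 0 ≤ c) (hs : StabHyp 𝒯 k c s Pr I) (hΔ : 0 < Δt) (hN1 : 1 ≤ N) (hN : N * Δt ≤ T)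
    {H : ℝ} (hH : 1 ≤ H) (hh : 𝒯.h ≤ H) :
    ∃ (û : ℕ → Vh 𝒯 k) (Y : ℕ → ℝ), (∀ n ≤ N, IsSmall s (u (n * Δt) - (û n).1) (Y n)) ∧
      Δt * ∑ n ∈ Finset.range (N + 1), Y n
        ≤ (1 + c + 2 * c ^ 2) * (2 * T * M + √T * M * H ^ k) * (Δt + 𝒯.h ^ k) ∧
      Δt * ∑ n ∈ Finset.range (N + 1), Y n ^ 2
        ≤ (1 + c + 2 * c ^ 2) ^ 2 * (4 * T + 2 * (H ^ k) ^ 2) * M ^ 2 * (Δt + 𝒯.h ^ k) ^ 2 ∧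
      ∑ n ∈ Finset.range N,
          ‖val (u ((n + 1 : ℕ) * Δt) - (û (n + 1)).1) - val (u (n * Δt) - (û n).1)‖
        ≤ (2 * T * c * M + 2 * c * (√T * M) + (√T * M / T + 4 * (√T * M))) * (Δt + 𝒯.h ^ k) ∧
      ‖val (u ((0 : ℕ) * Δt) - (û 0).1)‖ ≤ c * H * M * 𝒯.h ^ k := by
  have hM := reg.nonneg hT
  obtain ⟨U, hU, hUM, huc, -⟩ := reg.u_C.exists_lift hΩ hb (by omega : 1 ≤ k + 1)
  have hvc : ContinuousOn (fun t => val (u t)) (Icc 0 T) := val.continuous.comp_continuousOn huc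
  obtain ⟨φ, hφ, hφ'⟩ := reg.u_H1.exists_increment hT hvc
  have hm : ∀ n ≤ N, (n : ℝ) * Δt ∈ Icc 0 T := fun n hn => TimeBound.mem_Icc hΔ hN hn
  have hN' : ((N - 1 + 1 : ℕ) : ℝ) * Δt ≤ T := by rwa [Nat.sub_add_cancel hN1]
  have h2 := second_difference_le hΩ hb hT reg hΔ hN'
  obtain ⟨û, Y, -, h3⟩ := exists_average (u := fun n : ℕ => u (n * Δt)) (σ := TimeBound.step φ Δt)
    (S1 := √T * M) (C2 := √T * M / T + 4 * (√T * M)) hs hc hk hH hh hΔ hN1 hN hM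
    (fun n hn => sol.mem_Vdiv hΩ hb hT huc (hm n hn))
    (fun n hn => ⟨U (n * Δt), hU _ (hm n hn), hUM _ (hm n hn)⟩)
    (hφ.step_nonneg hΔ) (hφ.sum_step hM hΔ hN) (hφ.sum_step_sq hΔ hN) (by positivity)
    (fun n hn => hφ' _ (hm n hn.le) _ (hm (n + 1) hn) (by push_cast; nlinarith)) hΩ hb
    ((add_le_add h2.1 h2.2).trans_eq (by ring))
  exact ⟨û, Y, h3⟩

end

/-! ### The energy bound -/

section
variable {d : ℕ} {Ω : Set (Eu d)} {T M : ℝ}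
variable {k : ℕ} {ν : ℝ} {w : ℝ → Sob 1 ∞ Ω (Eu d)} {f : ℝ → LpΩ 2 Ω (Eu d)}
  {u0 : LpΩ 2 Ω (Eu d)} {u : ℝ → Sob 1 2 Ω (Eu d)} {p : ℝ → Sob 1 2 Ω ℝ} {Δt : ℝ} {N : ℕ}

lemma exists_transport_sequence (hΩ : IsOpen Ω) (hb : Bornology.IsBounded Ω)
    (hi : interior (closure Ω) = Ω) (hT : 0 < T) (reg : Regularity T k M w u p) (hΔ : 0 < Δt)
    (hN : N * Δt ≤ T) (hΔw : Δt * (4 * semiCW T w) ≤ 1) :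
    ∃ C : ℕ → LpΩ 2 Ω (Eu d) →ₗ[ℝ] LpΩ 2 Ω (Eu d), ∀ n < N,
      (∀ z v : Sob 1 2 Ω (Eu d),
        compInner Δt (w (n * Δt)) z v = inner ℝ (C n (val z)) (val v)) ∧
      (∀ f, ‖C n f‖ ^ 2 ≤ (1 + κ d M * Δt) * ‖f‖ ^ 2) ∧
      (∀ v : Sob 1 2 Ω (Eu d), ‖C n (val v) - val v‖ ≤ Δt * κ d M * ‖v‖) ∧
      (∀ g : Sob 2 2 Ω (Eu d), ‖val g - C n (val g)
        - Δt • conv (val (w (n * Δt))) (resSob one_le_two g)‖ ≤ Δt ^ 2 * κ d M * ‖g‖) := by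
  have h : ∀ n : ℕ, ∃ C : LpΩ 2 Ω (Eu d) →ₗ[ℝ] LpΩ 2 Ω (Eu d), n < N →
      (∀ z v : Sob 1 2 Ω (Eu d), compInner Δt (w (n * Δt)) z v = inner ℝ (C (val z)) (val v)) ∧
      (∀ f, ‖C f‖ ^ 2 ≤ (1 + κ d M * Δt) * ‖f‖ ^ 2) ∧
      (∀ v : Sob 1 2 Ω (Eu d), ‖C (val v) - val v‖ ≤ Δt * κ d M * ‖v‖) ∧
      (∀ g : Sob 2 2 Ω (Eu d), ‖val g - C (val g)
        - Δt • conv (val (w (n * Δt))) (resSob one_le_two g)‖ ≤ Δt ^ 2 * κ d M * ‖g‖) := by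
    intro n
    by_cases hn : n < N
    · have ht := TimeBound.mem_Icc hΔ hN hn.le
      obtain ⟨C, hC⟩ := exists_transport hΩ hb hi (reg.nonneg hT) (reg.w_zero _ ht)
        (reg.w_C.2 _ ht) hΔ (le_trans (by gcongr; exact reg.semiW_le_semiCW ht) hΔw)
      exact ⟨C, fun _ => hC⟩
    · exact ⟨0, fun h => absurd h hn⟩
  choose C hC using h
  exact ⟨C, hC⟩

set_option maxHeartbeats 2000000 in
/-- The errors with respect to the averaged interpolant `û` of the velocity and the approximation
`Pr p` of the pressure, and the error of `û`. -/
lemma exists_energy_bound (hΩ : IsOpen Ω) (hb : Bornology.IsBounded Ω)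
    (hi : interior (closure Ω) = Ω) (hT : 0 < T) (hk : 1 ≤ k) (hM : 0 ≤ M) {c ci : ℝ} (hc : 0 ≤ c)
    (hci : 0 ≤ ci) : ∃ Γ : ℝ, 0 ≤ Γ ∧
      ∀ (ν δ₀ Δt : ℝ), 0 < ν → 0 < δ₀ → 0 < Δt →
      ∀ (w : ℝ → Sob 1 ∞ Ω (Eu d)) (f : ℝ → LpΩ 2 Ω (Eu d)) (u0 : LpΩ 2 Ω (Eu d))
        (u : ℝ → Sob 1 2 Ω (Eu d)) (p : ℝ → Sob 1 2 Ω ℝ),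
      ContinuousOn f (Set.Icc 0 T) →
      IsOseenSolution T ν w f u0 u p →
      Regularity T k M w u p →
      Δt * (4 * semiCW T w) ≤ 1 →
      ∀ (𝒯 : Triangulation Ω) (s : LinearMap.BilinForm ℝ (Qh 𝒯 k)) (Pr : LpΩ 2 Ω ℝ → Qh 𝒯 k)
        (I : Sob 1 2 Ω (Eu d) → Vh 𝒯 k),
      StabHyp 𝒯 k c s Pr I →
      ∀ (ut : ℕ → Vh 𝒯 k) (uh : ℕ → Yh 𝒯 k k) (ph : ℕ → Qh 𝒯 k),
      IsSchemeSolution 𝒯 k k δ₀ s T Δt ν w f ut uh ph →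
      ‖(uh 0).1 - u0‖ ≤ ci * 𝒯.h ^ k →
      ‖grad ((ph 0).1 - p 0)‖ ≤ ci → 1 ≤ NT T Δt →
      ∃ û : ℕ → Vh 𝒯 k,
        (∀ n ≤ NT T Δt, ‖(uh n).1 - val (û n).1‖ ^ 2
          ≤ Γ * ((1 + √ν + √δ₀ + (√δ₀)⁻¹) * (Δt + 𝒯.h ^ k)) ^ 2) ∧
        (∀ n < NT T Δt, ‖val ((ut (n + 1)).1 - (û (n + 1)).1)‖ ^ 2
          ≤ Γ * ((1 + √ν + √δ₀ + (√δ₀)⁻¹) * (Δt + 𝒯.h ^ k)) ^ 2) ∧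
        ν * (Δt * ∑ n ∈ Finset.range (NT T Δt), gradNorm ((ut (n + 1)).1 - (û (n + 1)).1) ^ 2)
          ≤ Γ * ((1 + √ν + √δ₀ + (√δ₀)⁻¹) * (Δt + 𝒯.h ^ k)) ^ 2 ∧
        δ₀ * (Δt * ∑ n ∈ Finset.range (NT T Δt),
            snorm s (ph (n + 1) - Pr (val (p ((n + 1 : ℕ) * Δt)))) ^ 2)
          ≤ Γ * ((1 + √ν + √δ₀ + (√δ₀)⁻¹) * (Δt + 𝒯.h ^ k)) ^ 2 ∧
        (∀ n ≤ NT T Δt, ‖val (u (n * Δt) - (û n).1)‖ ≤ Γ * (Δt + 𝒯.h ^ k)) ∧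
        Δt * ∑ n ∈ Finset.range (NT T Δt), gradNorm (u ((n + 1 : ℕ) * Δt) - (û (n + 1)).1) ^ 2
          ≤ Γ * (Δt + 𝒯.h ^ k) ^ 2 := by
  -- the constants, collected from the bounds of the single terms
  have hκ : 0 ≤ κ d M := by unfold κ; positivity
  obtain ⟨H, hH⟩ : ∃ H, H = 1 + Metric.diam (closure Ω) := ⟨_, rfl⟩
  have hH1 : 1 ≤ H := by rw [hH]; linarith [Metric.diam_nonneg (s := closure Ω)]
  have hH0 : 0 ≤ H := by linarith
  obtain ⟨KY, hKY⟩ : ∃ x, x = (1 + c + 2 * c ^ 2) * (2 * T * M + √T * M * H ^ k) := ⟨_, rfl⟩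
  obtain ⟨KY2, hKY2⟩ : ∃ x, x = (1 + c + 2 * c ^ 2) ^ 2 * (4 * T + 2 * (H ^ k) ^ 2) * M ^ 2 :=
    ⟨_, rfl⟩
  obtain ⟨Kχ, hKχ⟩ : ∃ x, x = 2 * T * c * M + 2 * c * (√T * M) + (√T * M / T + 4 * (√T * M)) :=
    ⟨_, rfl⟩
  obtain ⟨K0, hK0⟩ : ∃ x, x = c * H * M := ⟨_, rfl⟩
  obtain ⟨KR, hKR⟩ : ∃ x, x = √T * M + 2 * (√T * M * M) + κ d M * M * T := ⟨_, rfl⟩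
  obtain ⟨K3, hK3⟩ : ∃ x, x = KR + Kχ + κ d M * KY + T * (c * M) + 1 := ⟨_, rfl⟩
  obtain ⟨K5, hK5⟩ : ∃ x, x = 2 * M ^ 2 + 8 * T * (c * M) ^ 2 := ⟨_, rfl⟩
  obtain ⟨K6, hK6⟩ : ∃ x, x = 2 * T * (c * M) ^ 2 + 2 * KY2 := ⟨_, rfl⟩
  obtain ⟨KE, hKE⟩ : ∃ x, x = (ci + K0) ^ 2 + (ci + c * H ^ k * M) ^ 2 + (3 * K3 ^ 2 + KY2
    + (1 + T) * K5 + K6) := ⟨_, rfl⟩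
  obtain ⟨KB, hKB⟩ : ∃ x, x = Real.exp ((κ d M + 1) * T + 1) * KE := ⟨_, rfl⟩
  have pKY : 0 ≤ KY := by rw [hKY]; positivity
  have pKY2 : 0 ≤ KY2 := by rw [hKY2]; positivity
  have pKχ : 0 ≤ Kχ := by rw [hKχ]; positivity
  have pK0 : 0 ≤ K0 := by rw [hK0]; positivity
  have pKR : 0 ≤ KR := by rw [hKR]; positivity
  have pK3 : 0 < K3 := by rw [hK3]; positivity
  have pK5 : 0 ≤ K5 := by rw [hK5]; positivity
  have pK6 : 0 ≤ K6 := by rw [hK6]; positivity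
  have pKE : 0 ≤ KE := by rw [hKE]; positivity
  have pKB : 0 ≤ KB := by rw [hKB]; positivity
  have pκT : 0 ≤ κ d M * T := by positivity
  refine ⟨(6 + 2 * κ d M * T) * KB + Kχ + K0 + KY2, by positivity, ?_⟩
  intro ν δ₀ Δt hν hδ hΔ w f u0 u p hf sol reg hΔw 𝒯 s Pr I hs ut uh ph sch hi1 hi2 hN1
  have hN : (NT T Δt : ℝ) * Δt ≤ T := by
    rw [← le_div_iff₀ hΔ]
    exact Nat.floor_le (by positivity)
  obtain ⟨N, hNdef⟩ : ∃ N, N = NT T Δt := ⟨_, rfl⟩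
  rw [← hNdef] at hN hN1 ⊢
  have hm : ∀ n ≤ N, (n : ℝ) * Δt ∈ Icc 0 T := fun n hn => TimeBound.mem_Icc hΔ hN hn
  have hh0 := 𝒯.h_nonneg
  have hhH : 𝒯.h ≤ H := by rw [hH]; linarith [𝒯.h_le_diam hb]
  obtain ⟨û, Y, hY, hY1, hY2, hχi, hχ0⟩ :=
    exists_velocity_average hΩ hb hT hk sol reg hc hs hΔ hN1 hN hH1 hhH
  rw [← hKY] at hY1
  rw [← hKY2] at hY2
  rw [← hKχ] at hχi
  rw [← hK0] at hχ0
  obtain ⟨C, hC⟩ := exists_transport_sequence hΩ hb hi hT reg hΔ hN hΔw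
  obtain ⟨R, hR, hR'⟩ := exists_residual hΩ hb hT hk hf sol reg hΔ hN hκ
    (fun n hn => (hC n hn).2.2.2)
  rw [← hKR] at hR
  have hz : ∀ n : ℕ, ∃ z, n < N → IsProjVh 𝒯 k (uh n).1 z ∧ ∀ v ∈ Vh 𝒯 k,
      (inner ℝ (val (ut (n + 1)).1) (val v) - compInner Δt (w (n * Δt)) z v) / Δt
      + ν * gradInner (ut (n + 1)).1 v + inner ℝ (grad (ph n).1) (val v)
      = inner ℝ (f ((n + 1 : ℕ) * Δt)) (val v) := by
    intro n
    by_cases hn : n < N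
    · obtain ⟨z, hz⟩ := sch.momentum n (hNdef ▸ hn)
      exact ⟨z, fun _ => hz⟩
    · exact ⟨0, fun h => absurd h hn⟩
  choose z hz using hz
  have huc : ContinuousOn u (Icc 0 T) := by
    obtain ⟨-, -, -, huc, -⟩ := reg.u_C.exists_lift hΩ hb (by omega : 1 ≤ k + 1)
    exact huc
  obtain ⟨τ, hτ⟩ : ∃ τ, τ = Δt + 𝒯.h ^ k := ⟨_, rfl⟩
  obtain ⟨η, hη⟩ : ∃ η, η = 𝒯.h ^ k := ⟨_, rfl⟩
  obtain ⟨Λ, hΛ⟩ : ∃ Λ, Λ = 1 + √ν + √δ₀ + (√δ₀)⁻¹ := ⟨_, rfl⟩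
  obtain ⟨hΛ1, hΛν, hΛδ⟩ := le_sq_one_add_sqrt hν hδ
  rw [← hΛ] at hΛ1 hΛν hΛδ ⊢
  have hη0 : 0 ≤ η := by rw [hη]; positivity
  have hηH : η ≤ H ^ k := by rw [hη]; gcongr
  have hητ : η ≤ τ := by rw [hη, hτ]; linarith
  have hΔτ : Δt ≤ τ := by rw [← hη] at hτ; linarith
  have hτ0 : 0 < τ := by linarith
  have hpr : ∀ n ≤ N, ‖p (n * Δt) - (Pr (val (p (n * Δt)))).1‖ ≤ c * η * M ∧
      snorm s (Pr (val (p (n * Δt)))) ≤ c * η * M := fun n hn => by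
    rw [hη]
    exact pressure_approx hΩ hb sol reg hc hs (hm n hn)
  have hπ := sum_pressure_increment hΩ hb hT sol reg hc hs hΔ hN
  rw [← hK5] at hπ
  rw [← hτ] at hY1 hY2 hχi hπ ⊢
  rw [← hη] at hχ0 hi1
  have hΔT : Δt ≤ T := (le_mul_of_one_le_left hΔ.le (by exact_mod_cast hN1)).trans hN
  have hχ : ∀ n ≤ N, ‖val (u (n * Δt) - (û n).1)‖ ≤ (Kχ + K0) * τ := by
    intro n hn
    have e1 := norm_le_norm_add_norm_sub (val (u ((0 : ℕ) * Δt) - (û 0).1))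
      (val (u (n * Δt) - (û n).1))
    have e2 : ‖val (u (n * Δt) - (û n).1) - val (u ((0 : ℕ) * Δt) - (û 0).1)‖ ≤ Kχ * τ := by
      rw [← Finset.sum_range_sub (fun n : ℕ => val (u (n * Δt) - (û n).1))]
      refine (norm_sum_le _ _).trans (le_trans ?_ hχi)
      exact Finset.sum_le_sum_of_subset_of_nonneg (Finset.range_mono hn)
        fun n _ _ => norm_nonneg _
    rw [norm_sub_rev] at e1
    have e3 : K0 * η ≤ K0 * τ := by gcongr
    have e4 := norm_sub_norm_le (val (u (n * Δt) - (û n).1)) (val (u ((0 : ℕ) * Δt) - (û 0).1))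
    linarith
  have hYs : Δt * ∑ n ∈ Finset.range N, Y (n + 1) ^ 2 ≤ KY2 * τ ^ 2 := by
    refine le_trans ?_ hY2
    rw [Finset.sum_range_succ']
    have := sq_nonneg (Y 0)
    gcongr
    linarith
  have hYs1 : Δt * ∑ n ∈ Finset.range N, Y n ≤ KY * τ := by
    refine le_trans ?_ hY1
    rw [Finset.sum_range_succ]
    have := (hY N le_rfl).nonneg
    gcongr
    linarith
  -- the residual in the error equation: consistency of the scheme, increments of `u - û`, transport
  -- of `u - û`, approximation of the pressure
  obtain ⟨r, hr⟩ : ∃ r : ℕ → LpΩ 2 Ω (Eu d), ∀ n, r n = R n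
      + (val (u ((n + 1 : ℕ) * Δt) - (û (n + 1)).1) - val (u (n * Δt) - (û n).1))
      - (C n (val (u (n * Δt) - (û n).1)) - val (u (n * Δt) - (û n).1))
      + Δt • grad (p ((n + 1 : ℕ) * Δt) - (Pr (val (p ((n + 1 : ℕ) * Δt)))).1) :=
    ⟨_, fun n => rfl⟩
  have hrs : ∑ n ∈ Finset.range N, ‖r n‖ ≤ K3 * τ := by
    have e1 : ∀ n ∈ Finset.range N, ‖r n‖ ≤ ‖R n‖
        + ‖val (u ((n + 1 : ℕ) * Δt) - (û (n + 1)).1) - val (u (n * Δt) - (û n).1)‖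
        + Δt * κ d M * Y n + Δt * (c * η * M) := by
      intro n hn
      have hn' := Finset.mem_range.1 hn
      rw [hr]
      refine (norm_add_le _ _).trans (add_le_add ((norm_sub_le _ _).trans
        (add_le_add (norm_add_le _ _) ?_)) ?_)
      · refine ((hC n hn').2.2.1 _).trans ?_
        have := (hY n hn'.le).1
        gcongr
      · rw [norm_smul, Real.norm_of_nonneg hΔ.le]
        have := (norm_grad_le _).trans (hpr (n + 1) hn').1
        gcongr
    refine (Finset.sum_le_sum e1).trans ?_
    simp only [Finset.sum_add_distrib, ← Finset.mul_sum]
    rw [Finset.sum_const, Finset.card_range, nsmul_eq_mul]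
    have e2 : KR * Δt ≤ KR * τ := by gcongr
    have e3 := mul_le_mul_of_nonneg_left hYs1 hκ
    have e4 : N * Δt * (c * η * M) ≤ T * (c * τ * M) := by gcongr
    rw [hK3]
    linarith
  have hE := energy_estimate (N := N) (e := fun n => (uh n).1 - val (û n).1)
    (et := fun n => val ((ut n).1 - (û n).1))
    (G := fun n => grad ((ph n).1 - (Pr (val (p (n * Δt)))).1))
    (π := fun n => grad ((Pr (val (p ((n + 1 : ℕ) * Δt)))).1 - (Pr (val (p (n * Δt)))).1))
    (g := fun n => C n (val (z n - (û n).1)))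
    (A := fun n => gradNorm ((ut n).1 - (û n).1)) (a := Y)
    (S := fun n => snorm s (ph n - Pr (val (p (n * Δt))))) (b := fun n => c * η * M + Y n)
    (r := fun n => ‖r n‖) (T := T) (κ := κ d M) (ν := ν) (δ₀ := δ₀) (S0 := K3 * τ)
    (B := KB * (Λ * τ) ^ 2) hΔ hN hκ hν hδ (fun n => norm_nonneg _) (by positivity) hrs
    ?_ ?_ ?_ ?_ ?_
  · obtain ⟨E1, E2, E3, E4⟩ := hE
    have hP : 0 ≤ (Λ * τ) ^ 2 := sq_nonneg _
    have hΓ1 : KB ≤ (6 + 2 * κ d M * T) * KB := le_mul_of_one_le_left pKB (by linarith)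
    have hΓ : KB ≤ (6 + 2 * κ d M * T) * KB + Kχ + K0 + KY2 := by linarith
    refine ⟨û, fun n hn => (E1 n hn).trans ?_, fun n hn => (E2 n hn).trans ?_, E3.trans ?_,
      E4.trans ?_, fun n hn => (hχ n hn).trans ?_, ?_⟩
    · gcongr
    · rw [← mul_assoc]
      exact mul_le_mul_of_nonneg_right (by linarith) hP
    · gcongr
    · gcongr
    · exact mul_le_mul_of_nonneg_right (by linarith) hτ0.le
    · calc Δt * ∑ n ∈ Finset.range N, gradNorm (u ((n + 1 : ℕ) * Δt) - (û (n + 1)).1) ^ 2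
          ≤ Δt * ∑ n ∈ Finset.range N, Y (n + 1) ^ 2 := by
            gcongr with n hn
            · exact gradNorm_nonneg _
            · exact (gradNorm_le_norm _).trans (hY (n + 1) (Finset.mem_range.1 hn)).1
        _ ≤ KY2 * τ ^ 2 := hYs
        _ ≤ _ := mul_le_mul_of_nonneg_right (by linarith) (sq_nonneg τ)
  · intro n hn
    obtain ⟨-, hzn⟩ := hz n hn
    have hv : (ut (n + 1)).1 - (û (n + 1)).1 ∈ Vh 𝒯 k :=
      Submodule.sub_mem _ (ut (n + 1)).2 (û (n + 1)).2
    have h1 := hzn _ hv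
    rw [(hC n hn).1] at h1
    have h2 := hR' n hn _ hv.1
    have h3 := momentum_error (û := (û n).1) (ps := (Pr (val (p (n * Δt)))).1)
      (ps' := (Pr (val (p ((n + 1 : ℕ) * Δt)))).1) hΔ h1 h2
    rw [← hr] at h3
    have h4 := real_inner_le_norm (r n) (val ((ut (n + 1)).1 - (û (n + 1)).1))
    have h5 := gradInner_le (u ((n + 1 : ℕ) * Δt) - (û (n + 1)).1)
      ((ut (n + 1)).1 - (û (n + 1)).1)
    have h6 : gradInner (u ((n + 1 : ℕ) * Δt) - (û (n + 1)).1) ((ut (n + 1)).1 - (û (n + 1)).1)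
        ≤ Y (n + 1) * gradNorm ((ut (n + 1)).1 - (û (n + 1)).1) := by
      refine h5.trans (mul_le_mul_of_nonneg_right ?_ (gradNorm_nonneg _))
      exact (gradNorm_le_norm _).trans (hY (n + 1) hn).1
    have h7 := mul_le_mul_of_nonneg_left h6 (by positivity : 0 ≤ Δt * ν)
    simp only [gradNorm_sq]
    rw [h3]
    exact add_le_add h4 h7
  · intro n hn
    have h1 := sch.projection n (hNdef ▸ hn)
    have h2 : (uh (n + 1)).1 - val (ut (n + 1)).1 + Δt • grad ((ph (n + 1)).1 - (ph n).1) = 0 := by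
      have := congrArg (fun x => Δt • x) h1
      simpa [smul_add, smul_smul, hΔ.ne'] using this
    simp only [map_sub] at h2 ⊢
    rw [← sub_eq_zero] at h2 ⊢
    rw [← h2]
    module
  · intro n hn
    exact mass_error hs hΩ hb hδ.le (sol.mem_Vdiv hΩ hb hT huc (hm (n + 1) hn)).2
      (û (n + 1)).2.1 (hY (n + 1) hn) (hpr (n + 1) hn).2 (by positivity)
      (sch.mass n (hNdef ▸ hn) _)
  · intro n hn
    refine ((hC n hn).2.1 _).trans ?_
    have := norm_val_sub_le_of_isProjVh (hz n hn).1 (û n).2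
    gcongr
  · -- the sum of the data
    have t0 : τ ^ 2 ≤ (Λ * τ) ^ 2 := by
      rw [mul_pow]
      exact le_mul_of_one_le_left (sq_nonneg _) (one_le_pow₀ hΛ1)
    have tν : ν * τ ^ 2 ≤ (Λ * τ) ^ 2 := by
      rw [mul_pow]
      gcongr
    have tδ : (δ₀ + 1) ^ 2 / δ₀ * τ ^ 2 ≤ (Λ * τ) ^ 2 := by
      rw [mul_pow]
      gcongr
    have b1 : ‖(uh 0).1 - val (û 0).1‖ ^ 2 ≤ (ci + K0) ^ 2 * τ ^ 2 := by
      have e1 : (uh 0).1 - val (û 0).1 = ((uh 0).1 - u0) + val (u ((0 : ℕ) * Δt) - (û 0).1) := by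
        rw [map_sub, Nat.cast_zero, zero_mul, sol.init]
        abel
      rw [← mul_pow, e1]
      refine pow_le_pow_left₀ (norm_nonneg _) ((norm_add_le _ _).trans ?_) 2
      calc _ ≤ ci * η + K0 * η := add_le_add hi1 hχ0
        _ = (ci + K0) * η := by ring
        _ ≤ _ := by gcongr
    have b2 : Δt ^ 2 * ‖grad ((ph 0).1 - (Pr (val (p ((0 : ℕ) * Δt)))).1)‖ ^ 2
        ≤ (ci + c * H ^ k * M) ^ 2 * τ ^ 2 := by
      have e1 : (ph 0).1 - (Pr (val (p ((0 : ℕ) * Δt)))).1 = ((ph 0).1 - p 0)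
          + (p ((0 : ℕ) * Δt) - (Pr (val (p ((0 : ℕ) * Δt)))).1) := by
        rw [Nat.cast_zero, zero_mul]
        abel
      have e2 : ‖grad ((ph 0).1 - (Pr (val (p ((0 : ℕ) * Δt)))).1)‖ ≤ ci + c * H ^ k * M := by
        rw [e1, map_add]
        refine (norm_add_le _ _).trans (add_le_add hi2 ((norm_grad_le _).trans
          ((hpr 0 (Nat.zero_le N)).1.trans ?_)))
        gcongr
      rw [mul_comm]
      gcongr
    have b4 : ν * (Δt * ∑ n ∈ Finset.range N, Y (n + 1) ^ 2) ≤ KY2 * (Λ * τ) ^ 2 := by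
      calc _ ≤ ν * (KY2 * τ ^ 2) := by gcongr
        _ = KY2 * (ν * τ ^ 2) := by ring
        _ ≤ _ := by gcongr
    have b5 : (1 + Δt) * (Δt * ∑ n ∈ Finset.range N, ‖grad ((Pr (val (p ((n + 1 : ℕ) * Δt)))).1
        - (Pr (val (p (n * Δt)))).1)‖ ^ 2) ≤ (1 + T) * K5 * τ ^ 2 := by
      rw [mul_assoc (1 + T)]
      gcongr
    have b6 : (δ₀ + 1) ^ 2 / δ₀ * (Δt * ∑ n ∈ Finset.range N, (c * η * M + Y (n + 1)) ^ 2)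
        ≤ K6 * (Λ * τ) ^ 2 := by
      have e1 : ∑ n ∈ Finset.range N, (c * η * M + Y (n + 1)) ^ 2
          ≤ ∑ n ∈ Finset.range N, (2 * (c * η * M) ^ 2 + 2 * Y (n + 1) ^ 2) :=
        Finset.sum_le_sum fun n _ => add_sq_le.trans_eq (by ring)
      rw [Finset.sum_add_distrib, Finset.sum_const, Finset.card_range, nsmul_eq_mul,
        ← Finset.mul_sum] at e1
      have e2 : Δt * ∑ n ∈ Finset.range N, (c * η * M + Y (n + 1)) ^ 2 ≤ K6 * τ ^ 2 := by
        calc _ ≤ Δt * (N * (2 * (c * η * M) ^ 2) + 2 * ∑ n ∈ Finset.range N, Y (n + 1) ^ 2) := by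
              gcongr
          _ = N * Δt * (2 * (c * η * M) ^ 2) + 2 * (Δt * ∑ n ∈ Finset.range N, Y (n + 1) ^ 2) := by
              ring
          _ ≤ T * (2 * (c * τ * M) ^ 2) + 2 * (KY2 * τ ^ 2) := by gcongr
          _ = _ := by rw [hK6]; ring
      calc _ ≤ (δ₀ + 1) ^ 2 / δ₀ * (K6 * τ ^ 2) := by gcongr
        _ = K6 * ((δ₀ + 1) ^ 2 / δ₀ * τ ^ 2) := by ring
        _ ≤ _ := by gcongr
    rw [hKB, mul_assoc (Real.exp _)]
    refine mul_le_mul_of_nonneg_left ?_ (Real.exp_pos _).le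
    have c1 := mul_le_mul_of_nonneg_left t0 (sq_nonneg (ci + K0))
    have c2 := mul_le_mul_of_nonneg_left t0 (sq_nonneg (ci + c * H ^ k * M))
    have c3 := mul_le_mul_of_nonneg_left t0 (by positivity : 0 ≤ 3 * K3 ^ 2)
    have c5 := mul_le_mul_of_nonneg_left t0 (by positivity : 0 ≤ (1 + T) * K5)
    have e3 : 3 * (K3 * τ) ^ 2 = 3 * K3 ^ 2 * τ ^ 2 := by ring
    have e4 : KE * (Λ * τ) ^ 2 = (ci + K0) ^ 2 * (Λ * τ) ^ 2
        + (ci + c * H ^ k * M) ^ 2 * (Λ * τ) ^ 2 + (3 * K3 ^ 2 * (Λ * τ) ^ 2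
        + KY2 * (Λ * τ) ^ 2 + (1 + T) * K5 * (Λ * τ) ^ 2 + K6 * (Λ * τ) ^ 2) := by
      rw [hKE]
      ring
    rw [e4, e3]
    exact add_le_add (add_le_add (b1.trans c1) (b2.trans c2))
      (add_le_add (add_le_add (add_le_add c3 b4) (b5.trans c5)) b6)

end

end Oseen

end

open Oseen in
theorem theorem1 (d : ℕ) (hd : d = 2 ∨ d = 3) (Ω : Set (Eu d)) (hΩ : IsPolyhedralDomain Ω)
    (T : ℝ) (hT : 0 < T) (k : ℕ) (hk : 1 ≤ k)
    -- bound for the norms of the data and the exact solution, constant in the stabilization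
    -- hypotheses, constant in the hypothesis on the initial values, shape-regularity constant
    (M cs ci σ : ℝ) :
    ∃ c : ℝ, 0 < c ∧
      ∀ (ν δ₀ Δt : ℝ), 0 < ν → 0 < δ₀ → 0 < Δt →
      ∀ (w : ℝ → Sob 1 ∞ Ω (Eu d)) (f : ℝ → LpΩ 2 Ω (Eu d)) (u0 : LpΩ 2 Ω (Eu d))
        (u : ℝ → Sob 1 2 Ω (Eu d)) (p : ℝ → Sob 1 2 Ω ℝ),
      ContinuousOn f (Set.Icc 0 T) →
      IsOseenSolution T ν w f u0 u p →
      Regularity T k M w u p →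
      Δt * (4 * semiCW T w) ≤ 1 →
      ∀ (𝒯 : Triangulation Ω), 𝒯.ShapeRegular σ →
      ∀ (s : LinearMap.BilinForm ℝ (Qh 𝒯 k)) (Pr : LpΩ 2 Ω ℝ → Qh 𝒯 k)
        (I : Sob 1 2 Ω (Eu d) → Vh 𝒯 k),
      StabHyp 𝒯 k cs s Pr I →
      ∀ (ut : ℕ → Vh 𝒯 k) (uh : ℕ → Yh 𝒯 k k) (ph : ℕ → Qh 𝒯 k),
      IsSchemeSolution 𝒯 k k δ₀ s T Δt ν w f ut uh ph →
      ‖(uh 0).1 - u0‖ ≤ ci * 𝒯.h ^ k →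
      ‖grad ((ph 0).1 - p 0)‖ ≤ ci →
      (∀ n ≤ NT T Δt, ‖(uh n).1 - val (u (n * Δt))‖
        ≤ c * (1 + √ν + √δ₀ + (√δ₀)⁻¹) * (Δt + 𝒯.h ^ k)) ∧
      (∀ n, 1 ≤ n → n ≤ NT T Δt → ‖val (ut n).1 - val (u (n * Δt))‖
        ≤ c * (1 + √ν + √δ₀ + (√δ₀)⁻¹) * (Δt + 𝒯.h ^ k)) ∧
      √ν * ell2 T Δt (fun n => gradNorm ((ut n).1 - u (n * Δt)))
        ≤ c * (1 + √ν + √δ₀ + (√δ₀)⁻¹) * (Δt + 𝒯.h ^ k) ∧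
      √δ₀ * ell2 T Δt (fun n => snorm s (ph n - Pr (val (p (n * Δt)))))
        ≤ c * (1 + √ν + √δ₀ + (√δ₀)⁻¹) * (Δt + 𝒯.h ^ k) := by
  obtain ⟨hΩo, -, hb, hi, -⟩ := hΩ
  by_cases hM : 0 ≤ M
  swap
  · exact ⟨1, one_pos, fun _ _ _ _ _ _ _ _ _ _ _ _ _ reg => absurd (reg.nonneg hT) hM⟩
  obtain ⟨Γ, hΓ, h⟩ := exists_energy_bound (d := d) hΩo hb hi hT hk hM (abs_nonneg cs)
    (abs_nonneg ci)
  refine ⟨√Γ + Γ + √(4 * Γ) + |ci| + 1, by positivity, ?_⟩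
  intro ν δ₀ Δt hν hδ hΔ w f u0 u p hf sol reg hΔw 𝒯 _ s Pr I hs ut uh ph sch hi1 hi2
  have hh0 := 𝒯.h_nonneg
  have hη : 0 ≤ 𝒯.h ^ k := by positivity
  obtain ⟨hΛ1, -, -⟩ := le_sq_one_add_sqrt hν hδ
  have hsν : √ν ≤ 1 + √ν + √δ₀ + (√δ₀)⁻¹ := by
    have h1 := Real.sqrt_nonneg δ₀
    have h2 : 0 ≤ (√δ₀)⁻¹ := by positivity
    linarith
  replace h := h ν δ₀ Δt hν hδ hΔ w f u0 u p hf sol reg hΔw 𝒯 s Pr I (hs.mono (le_abs_self cs))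
    ut uh ph sch (hi1.trans (by gcongr; exact le_abs_self ci)) (hi2.trans (le_abs_self ci))
  obtain ⟨Λ, hΛ⟩ : ∃ Λ, Λ = 1 + √ν + √δ₀ + (√δ₀)⁻¹ := ⟨_, rfl⟩
  obtain ⟨τ, hτ⟩ : ∃ τ, τ = Δt + 𝒯.h ^ k := ⟨_, rfl⟩
  rw [← hΛ] at hΛ1 hsν
  simp only [← hΛ, ← hτ, mul_assoc _ Λ τ] at h ⊢
  have hητ : 𝒯.h ^ k ≤ τ := by linarith
  have hτ0 : 0 < τ := by linarith
  have hτΛ : τ ≤ Λ * τ := le_mul_of_one_le_left hτ0.le hΛ1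
  have hΛτ : 0 ≤ Λ * τ := hτ0.le.trans hτΛ
  have hs1 := Real.sqrt_nonneg Γ
  have hs2 := Real.sqrt_nonneg (4 * Γ)
  have hs3 := abs_nonneg ci
  rcases Nat.eq_zero_or_pos (NT T Δt) with hN | hN
  · refine ⟨fun n hn => ?_, fun n h1 h2 => by omega, ?_, ?_⟩
    · obtain rfl : n = 0 := by omega
      rw [Nat.cast_zero, zero_mul, sol.init]
      calc _ ≤ |ci| * 𝒯.h ^ k := hi1.trans (by gcongr; exact le_abs_self ci)
        _ ≤ |ci| * (Λ * τ) := by gcongr; exact hητ.trans hτΛ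
        _ ≤ _ := mul_le_mul_of_nonneg_right (by linarith) hΛτ
    · simp only [ell2, hN]
      simp
      positivity
    · simp only [ell2, hN]
      simp
      positivity
  · obtain ⟨û, h1, h2, h3, h4, h5, h6⟩ := h hN
    have hsq : ∀ {x K : ℝ}, 0 ≤ K → x ^ 2 ≤ K * (Λ * τ) ^ 2 → x ≤ √K * (Λ * τ) := by
      intro x K hK hx
      refine (le_abs_self x).trans (abs_le_of_sq_le_sq ?_ (by positivity))
      rwa [mul_pow, Real.sq_sqrt hK]
    have h5' : ∀ n ≤ NT T Δt, ‖val (u (n * Δt) - (û n).1)‖ ≤ Γ * (Λ * τ) := fun n hn =>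
      (h5 n hn).trans (by gcongr)
    refine ⟨fun n hn => ?_, fun n hn1 hn => ?_, ?_, ?_⟩
    · have e1 := hsq hΓ (h1 n hn)
      have e2 : (uh n).1 - val (u (n * Δt))
          = ((uh n).1 - val (û n).1) - val (u (n * Δt) - (û n).1) := by
        rw [map_sub]
        abel
      rw [e2]
      refine (norm_sub_le _ _).trans ((add_le_add e1 (h5' n hn)).trans ?_)
      rw [← add_mul]
      exact mul_le_mul_of_nonneg_right (by linarith) hΛτ
    · obtain ⟨m, rfl⟩ : ∃ m, n = m + 1 := ⟨n - 1, by omega⟩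
      have e1 := hsq hΓ (h2 m hn)
      have e2 : val (ut (m + 1)).1 - val (u ((m + 1 : ℕ) * Δt))
          = val ((ut (m + 1)).1 - (û (m + 1)).1) - val (u ((m + 1 : ℕ) * Δt) - (û (m + 1)).1) := by
        rw [map_sub, map_sub]
        abel
      rw [e2]
      refine (norm_sub_le _ _).trans ((add_le_add e1 (h5' _ hn)).trans ?_)
      rw [← add_mul]
      exact mul_le_mul_of_nonneg_right (by linarith) hΛτ
    · have e1 : √ν * ell2 T Δt (fun n => gradNorm ((ut n).1 - u (n * Δt))) ≤ √(4 * Γ) * (Λ * τ) := by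
        refine hsq (by positivity) ?_
        rw [ell2, mul_pow, Real.sq_sqrt hν.le, Real.sq_sqrt (mul_nonneg hΔ.le
          (Finset.sum_nonneg fun n _ => sq_nonneg _)), sum_Icc_one]
        have e2 : ∑ n ∈ Finset.range (NT T Δt),
            gradNorm ((ut (n + 1)).1 - u ((n + 1 : ℕ) * Δt)) ^ 2
            ≤ 2 * ∑ n ∈ Finset.range (NT T Δt), gradNorm ((ut (n + 1)).1 - (û (n + 1)).1) ^ 2
              + 2 * ∑ n ∈ Finset.range (NT T Δt),
                gradNorm (u ((n + 1 : ℕ) * Δt) - (û (n + 1)).1) ^ 2 := by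
          rw [Finset.mul_sum, Finset.mul_sum, ← Finset.sum_add_distrib]
          refine Finset.sum_le_sum fun n _ => ?_
          have e3 : (ut (n + 1)).1 - u ((n + 1 : ℕ) * Δt) = ((ut (n + 1)).1 - (û (n + 1)).1)
              - (u ((n + 1 : ℕ) * Δt) - (û (n + 1)).1) := by abel
          rw [e3]
          exact (pow_le_pow_left₀ (gradNorm_nonneg _) (gradNorm_sub_le _ _) 2).trans
            (add_sq_le.trans_eq (by ring))
        have e4 : ν * (Δt * ∑ n ∈ Finset.range (NT T Δt),
            gradNorm (u ((n + 1 : ℕ) * Δt) - (û (n + 1)).1) ^ 2) ≤ Γ * (Λ * τ) ^ 2 := by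
          have e5 := (le_sq_one_add_sqrt hν hδ).2.1
          rw [← hΛ] at e5
          calc _ ≤ Λ ^ 2 * (Γ * τ ^ 2) := by gcongr
            _ = _ := by ring
        have e6 := mul_le_mul_of_nonneg_left (mul_le_mul_of_nonneg_left e2 hΔ.le) hν.le
        linarith
      exact e1.trans (mul_le_mul_of_nonneg_right (by linarith) hΛτ)
    · have e1 : √δ₀ * ell2 T Δt (fun n => snorm s (ph n - Pr (val (p (n * Δt)))))
          ≤ √Γ * (Λ * τ) := by
        refine hsq hΓ ?_
        rw [ell2, mul_pow, Real.sq_sqrt hδ.le, Real.sq_sqrt (mul_nonneg hΔ.le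
          (Finset.sum_nonneg fun n _ => sq_nonneg _)), sum_Icc_one]
        exact h4
      exact e1.trans (mul_le_mul_of_nonneg_right (by linarith) hΛτ)
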